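/- **Setting.** Let $(M,d)$ be a metric space with its Borel $\sigma$-algebra (for instance a Riemannian manifold), let $T:M\to M$ be measurable (for instance a diffeomorphism, possibly with singularities), and let $Y\subset M$. Suppose that $Y$ is partitioned into "stable disks" and also into "unstable disks" (arbitrary nonempty subsets of $Y$) such that each stable disk meets each unstable disk in exactly one point; $W^s(y)$, $W^u(y)$ denote the disks containing $y$. Let $\{Y_j\}$ be an at most countable partition of $Y$, each $Y_j$ being a union of stable disks, and let $\tau:Y\to\{1,2,\dots\}$ be constant, equal to $\tau(j)$, on each $Y_j$, with $\gcd\{\tau(j)\}=1$, $T^{\tau(y)}y\in Y$ for all $y\in Y$, and $T^{\tau(j)}(W^s(y))\subset W^s(T^{\tau(j)}y)$ for $y\in Y_j$. Put $F(y)=T^{\tau(y)}y$, and let $s(y,z)$ be the least $n\ge0$ such that $F^ny,F^nz$ lie in distinct partition elements ($\infty$ if there is none). (P1) There are $K_0\ge1$, $\rho_0\in(0,1)$ such that (i) $d(F^ny,F^nz)\le K_0\rho_0^n$ for $z\in W^s(y)$, $n\ge0$; (ii) $d(F^ny,F^nz)\le K_0\rho_0^{s(y,z)-n}$ for $z\in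 W^u(y)$, $n\ge0$; (iii) $d(T^jy,T^jz)\le K_0d(y,z)$ for $y,z\in Y$, $0\le j<\min\{\tau(y),\tau(z)\}$. Let $\bar Y$ be the quotient of $Y$ obtained by collapsing stable disks, with quotient map $\bar\pi:Y\to\bar Y$, induced map $\bar F:\bar Y\to\bar Y$, partition $\alpha=\{\bar Y_j\}$ and return time $\tau:\bar Y\to\{1,2,\dots\}$; $\bar Y$ carries a $\sigma$-algebra for which $\bar\pi$ is measurable. Suppose that $\bar F$ and $\alpha$ separate points of $\bar Y$, fix $\theta\in(0,1)$, and let $d_\theta(y,z)=\theta^{s(y,z)}$, where $s$ is the separation time of $(\bar F,\alpha)$. Suppose that $\bar F$ is uniformly expanding on $(\bar Y,d_\theta)$, i.e. there are a probability measure $m$ on $\bar Y$ with respect to which $\bar F$ is nonsingular and a constant $K>0$ such that the elements of $\alpha$ are measurable, $\bar F$ maps each $a\in\alpha$ bijectively and bimeasurably onto $\bar Y$, and for $x,y$ in the same element of $\alpha$ $$d_\theta(\bar Fx,\bar Fy)\ge\theta^{-1}d_\theta(x,y),\qquad |\log\zeta(x)-\log\zeta(y)|\le K\,d_\theta(\bar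 Fx,\bar Fy),$$ where $\zeta=\frac{dm}{dm\circ\bar F}>0$ is the inverse Jacobian. Let $\bar\mu_Y$ be the $\bar F$-invariant probability measure absolutely continuous with respect to $m$, and let $\mu_Y$ be an $F$-invariant probability measure on $Y$ with $\bar\pi_*\mu_Y=\bar\mu_Y$. Let $\Delta=\{(y,\ell)\in Y\times\mathbb Z:0\le\ell\le\tau(y)-1\}$ with the probability measure $\mu_\Delta(A\times\{\ell\})=(\int\tau\,d\mu_Y)^{-1}\mu_Y(A)$ for measurable $A\subset\{\tau\ge\ell+1\}$, let $\pi(y,\ell)=T^\ell y$, and put $\mu=\pi_*\mu_\Delta$, a probability measure on $M$. Finally let $\delta>0$ and let $I=\{I_k\}$ be a finite set of positive integers with $\gcd\{I_k\}=1$ and $\bar\mu_Y(\tau=I_k)\ge\delta$ for every $k$. For $v:M\to\mathbb R$ and $\eta\in(0,1]$ let $\|v\|_\eta=\sup_x|v(x)|+\sup_{x\ne y}|v(x)-v(y)|/d(x,y)^\eta$, and let $C^\eta(M)$ be the set of $v$ with $\|v\|_\eta<\infty$. **Theorem.** Let $\eta\in(0,1]$. (a) There is a constant $C>0$, which is a continuous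 function of $\theta,K,\max I_k,\delta,\beta,C_\tau,\eta,\rho_0,K_0$ only, such that if $\bar\mu_Y(\tau\ge n)\le C_\tau n^{-\beta}$ for all $n\ge1$, where $\beta>1$ and $C_\tau>0$, then $$\Big|\int_M v\;w\circ T^n\,d\mu-\int_Mv\,d\mu\int_Mw\,d\mu\Big|\le C\,n^{-(\beta-1)}\|v\|_\eta\|w\|_\eta\qquad\text{for all }v,w\in C^\eta(M),\ n\ge1.$$ (b) There are constants $C>0$ and $B>0$, which are continuous functions of $\theta,K,\max I_k,\delta,A,\gamma,C_\tau,\eta,\rho_0,K_0$ only, such that if $\bar\mu_Y(\tau\ge n)\le C_\tau e^{-An^\gamma}$ for all $n\ge1$, where $A>0$, $\gamma\in(0,1]$ and $C_\tau>0$, then $$\Big|\int_M v\;w\circ T^n\,d\mu-\int_Mv\,d\mu\int_Mw\,d\mu\Big|\le C\,e^{-Bn^\gamma}\|v\|_\eta\|w\|_\eta\qquad\text{for all }v,w\in C^\eta(M),\ n\ge1.$$ -/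

import Mathlib

open MeasureTheory Set
open scoped ENNReal

noncomputable section

/-! ### Separation times and uniformly expanding maps -/

/-- The separation time of `x` and `y` with respect to a map `F` and a partition `α`: the least
`n ≥ 0` such that `F^n x`, `F^n y` lie in distinct elements of `α` (and `⊤` if there is none). -/
def sepTime {X : Type*} (F : X → X) (α : Set (Set X)) (x y : X) : ℕ∞ :=
  sInf {k : ℕ∞ | ∃ n : ℕ, k = n ∧ ∃ a ∈ α, F^[n] x ∈ a ∧ F^[n] y ∉ a}

open Classical in
/-- `d_θ(x,y) = θ ^ s(x,y)`, with `θ ^ ∞ = 0`. -/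
def symbolicDist {X : Type*} (F : X → X) (α : Set (Set X)) (θ : ℝ) (x y : X) : ℝ :=
  if sepTime F α x y = ⊤ then 0 else θ ^ (sepTime F α x y).toNat

/-- `F : X → X` is a uniformly expanding map on the probability space `(X, m)` with the metric `d`
(of diameter at most `1`), the partition `α` and the constants `lam`, `K`, `η`. -/
structure UniformlyExpanding {X : Type*} [MeasurableSpace X] (d : X → X → ℝ) (F : X → X)
    (m : Measure X) (α : Set (Set X)) (lam K η : ℝ) : Prop where
  dist_eq_zero : ∀ x y, d x y = 0 ↔ x = y
  dist_symm : ∀ x y, d x y = d y x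
  dist_triangle : ∀ x y z, d x z ≤ d x y + d y z
  diam_le : ∀ x y, d x y ≤ 1
  prob : IsProbabilityMeasure m
  nonsingular : Measure.QuasiMeasurePreserving F m m
  countable : α.Countable
  partition : Setoid.IsPartition α
  measurableSet : ∀ a ∈ α, MeasurableSet a
  bijOn : ∀ a ∈ α, BijOn F a univ
  measurableSet_image : ∀ a ∈ α, ∀ A ⊆ a, MeasurableSet A → MeasurableSet (F '' A)
  expanding : ∀ a ∈ α, ∀ x ∈ a, ∀ y ∈ a, lam * d x y ≤ d (F x) (F y)
  /-- `ζ` is the inverse Jacobian `dm / d(m ∘ F)`, i.e. `d(m ∘ F) = ζ⁻¹ dm` on each element of the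
  partition, and its logarithm has bounded distortion. -/
  distortion : ∃ ζ : X → ℝ, Measurable ζ ∧ (∀ x, 0 < ζ x) ∧
    (∀ a ∈ α, ∀ A ⊆ a, MeasurableSet A →
      m (F '' A) = ∫⁻ x in A, ENNReal.ofReal ((ζ x)⁻¹) ∂m) ∧
    (∀ a ∈ α, ∀ x ∈ a, ∀ y ∈ a,
      |Real.log (ζ x) - Real.log (ζ y)| ≤ K * d (F x) (F y) ^ η)

/-! ### Towers -/

/-- The tower `{(y, ℓ) : 0 ≤ ℓ ≤ τ(y) - 1}` over `X` with return time `τ`. -/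
def tower {X : Type*} (τ : X → ℕ) : Set (X × ℕ) := {p | p.2 < τ p.1}

/-- The measure on the tower that gives `A × {ℓ}` the mass `(∫ τ dμ)⁻¹ μ(A)`, for
`A ⊆ {τ ≥ ℓ + 1}`. -/
def towerMeasure {X : Type*} [MeasurableSpace X] (τ : X → ℕ) (μ : Measure X) :
    Measure (tower τ) :=
  (∫⁻ x, (τ x : ℝ≥0∞) ∂μ)⁻¹ • (μ.prod Measure.count).comap Subtype.val

/-! ### Product structure and induced map -/

/-- A map `T : M → M` with a subset `Y` that has a product structure and a partition `{Y_j}` with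
return times. The stable and unstable disks are taken inside `Y`. -/
structure ProductStructure (M : Type*) where
  T : M → M
  Y : Set M
  stable : Set (Set Y)
  unstable : Set (Set Y)
  stable_partition : Setoid.IsPartition stable
  unstable_partition : Setoid.IsPartition unstable
  inter_unique : ∀ S ∈ stable, ∀ U ∈ unstable, ∃! x, x ∈ S ∩ U
  /-- The partition `{Y_j}`. -/
  part : Set (Set Y)
  part_countable : part.Countable
  part_partition : Setoid.IsPartition part
  /-- Each `Y_j` is a union of stable disks, so that the quotient partition makes sense. -/
  part_saturated : ∀ a ∈ part, ∀ S ∈ stable, (S ∩ a).Nonempty → S ⊆ a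
  /-- The return time. -/
  τ : Y → ℕ
  τ_pos : ∀ y, 1 ≤ τ y
  τ_const : ∀ a ∈ part, ∀ y ∈ a, ∀ z ∈ a, τ y = τ z
  τ_gcd : ∀ k : ℕ, (∀ y, k ∣ τ y) → k = 1
  return_mem : ∀ y : Y, T^[τ y] y ∈ Y
  /-- `T^{τ(j)} W^s(y) ⊆ W^s(T^{τ(j)} y)` for `y ∈ Y_j`. -/
  stable_invariant : ∀ y : Y, ∀ S ∈ stable, y ∈ S → ∀ S' ∈ stable,
    (⟨T^[τ y] y, return_mem y⟩ : Y) ∈ S' →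
      T^[τ y] '' (Subtype.val '' S) ⊆ Subtype.val '' S'

namespace ProductStructure

variable {M : Type*} (D : ProductStructure M)

/-- The induced map `F(y) = T^{τ(y)}(y)` on `Y`. -/
def F (y : D.Y) : D.Y := ⟨D.T^[D.τ y] y, D.return_mem y⟩

/-- `y ∼ z` iff `y` and `z` lie in the same stable disk. -/
def stableSetoid : Setoid D.Y := Setoid.mkClasses D.stable D.stable_partition.2

theorem rel_iff (y z : D.Y) :
    D.stableSetoid y z ↔ ∃ S ∈ D.stable, y ∈ S ∧ z ∈ S := by
  constructor
  · intro h
    obtain ⟨S, ⟨hS, hy⟩, -⟩ := D.stable_partition.2 y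
    exact ⟨S, hS, hy, h S hS hy⟩
  · rintro ⟨S, hS, hy, hz⟩ S' hS' hy'
    rwa [(D.stable_partition.2 y).unique ⟨hS', hy'⟩ ⟨hS, hy⟩]

theorem τ_congr (y z : D.Y) (h : D.stableSetoid y z) : D.τ y = D.τ z := by
  obtain ⟨S, hS, hy, hz⟩ := (D.rel_iff y z).1 h
  obtain ⟨a, ⟨ha, hya⟩, -⟩ := D.part_partition.2 y
  exact D.τ_const a ha y hya z (D.part_saturated a ha S hS ⟨y, hy, hya⟩ hz)

theorem F_congr (y z : D.Y) (h : D.stableSetoid y z) : D.stableSetoid (D.F y) (D.F z) := by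
  have hτ := D.τ_congr y z h
  obtain ⟨S, hS, hy, hz⟩ := (D.rel_iff y z).1 h
  obtain ⟨S', ⟨hS', hy'⟩, -⟩ := D.stable_partition.2 (D.F y)
  refine (D.rel_iff _ _).2 ⟨S', hS', hy', ?_⟩
  obtain ⟨x, hx, hxz⟩ := D.stable_invariant y S hS hy S' hS' hy' ⟨z, ⟨z, hz, rfl⟩, rfl⟩
  have : x = D.F z := Subtype.ext (by rw [hxz, F, hτ])
  rwa [← this]

/-- The quotient `Ȳ = Y / ∼` along stable disks. It carries no default σ-algebra. -/
def Ybar : Type _ := Quotient D.stableSetoid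

/-- The quotient map `Y → Ȳ`. -/
def proj (y : D.Y) : D.Ybar := Quotient.mk D.stableSetoid y

/-- The quotient induced map on `Ȳ`. -/
def Fbar : D.Ybar → D.Ybar := Quotient.map D.F D.F_congr

/-- The quotient return time on `Ȳ`. -/
def τbar : D.Ybar → ℕ := Quotient.lift D.τ D.τ_congr

/-- The quotient partition `{Ȳ_j}` of `Ȳ`. -/
def partbar : Set (Set D.Ybar) := (fun a => D.proj '' a) '' D.part

/-- The metric `d_θ` on `Ȳ`. -/
def dθ (θ : ℝ) : D.Ybar → D.Ybar → ℝ := symbolicDist D.Fbar D.partbar θ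

/-- The projection `(y, ℓ) ↦ T^ℓ y` from the tower over `Y` to `M`. -/
def towerProj (p : tower D.τ) : M := D.T^[p.1.2] p.1.1

/-- The measure on `M` obtained by projecting the tower measure built from `μY`. -/
def measure [MeasurableSpace M] (μY : Measure D.Y) : Measure M :=
  (towerMeasure D.τ μY).map D.towerProj

/-- Condition (P1) with constants `K₀` and `ρ₀`. -/
structure P1 [MetricSpace M] (K₀ ρ₀ : ℝ) : Prop where
  stable : ∀ S ∈ D.stable, ∀ y ∈ S, ∀ z ∈ S, ∀ n : ℕ,
    dist (D.F^[n] y) (D.F^[n] z) ≤ K₀ * ρ₀ ^ n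
  /-- If `s(y,z) = ∞` then the right-hand side would be `0`; but then `y = z` as soon as the
  quotient map separates points. -/
  unstable : ∀ U ∈ D.unstable, ∀ y ∈ U, ∀ z ∈ U, ∀ n s : ℕ, sepTime D.F D.part y z = s →
    dist (D.F^[n] y) (D.F^[n] z) ≤ K₀ * ρ₀ ^ ((s : ℤ) - (n : ℤ))
  flight : ∀ y z : D.Y, ∀ j < min (D.τ y) (D.τ z),
    dist (D.T^[j] y) (D.T^[j] z) ≤ K₀ * dist y z

/-- `T` is nonuniformly hyperbolic: (P1) holds, the quotient induced map is uniformly expanding on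
`(Ȳ, d_θ)` with reference measure `m` and constants `1/θ`, `K`, `1`, `μbar` is its absolutely
continuous invariant probability measure, and `μY` is an `F`-invariant probability measure on `Y`
that projects to `μbar`. -/
structure NonuniformlyHyperbolic [MetricSpace M] [MeasurableSpace M] [MeasurableSpace D.Ybar]
    (m μbar : Measure D.Ybar) (μY : Measure D.Y) (θ K ρ₀ K₀ : ℝ) : Prop where
  measurable_T : Measurable D.T
  measurable_proj : Measurable D.proj
  p1 : D.P1 K₀ ρ₀
  separates : ∀ x y : D.Ybar, x ≠ y → sepTime D.Fbar D.partbar x y ≠ ⊤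
  uniformlyExpanding : UniformlyExpanding (D.dθ θ) D.Fbar m D.partbar θ⁻¹ K 1
  bar_prob : IsProbabilityMeasure μbar
  bar_invariant : MeasurePreserving D.Fbar μbar μbar
  bar_absolutelyContinuous : μbar ≪ m
  prob : IsProbabilityMeasure μY
  invariant : MeasurePreserving D.F μY μY
  map_proj : μY.map D.proj = μbar

end ProductStructure

/-- `I` is a finite set of positive integers with `gcd I = 1` and `μ(τ = i) ≥ δ` for `i ∈ I`. -/
def MixingReturnTimes {X : Type*} [MeasurableSpace X] (τ : X → ℕ) (μ : Measure X) (δ : ℝ)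
    (I : Finset ℕ) : Prop :=
  (∀ i ∈ I, 0 < i) ∧ I.gcd id = 1 ∧ ∀ i ∈ I, δ ≤ μ.real {x | τ x = i}

/-! ### Hölder observables -/

/-- `‖v‖_η = |v|_∞ + |v|_η`, as an extended nonnegative number. -/
def eHolderENorm {M : Type*} [MetricSpace M] (η : ℝ) (v : M → ℝ) : ℝ≥0∞ :=
  (⨆ x, ENNReal.ofReal |v x|) +
    ⨆ (x) (y) (_ : x ≠ y), ENNReal.ofReal (|v x - v y| / dist x y ^ η)

/-- `v ∈ C^η(M)`. -/
def MemCη {M : Type*} [MetricSpace M] (η : ℝ) (v : M → ℝ) : Prop := eHolderENorm η v < ⊤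

/-- `‖v‖_η` for `v ∈ C^η(M)`. -/
def cηNorm {M : Type*} [MetricSpace M] (η : ℝ) (v : M → ℝ) : ℝ := (eHolderENorm η v).toReal

/-- The correlation `∫ v · w ∘ T^n dμ - ∫ v dμ ∫ w dμ`. -/
def correlation {M : Type*} [MeasurableSpace M] (T : M → M) (μ : Measure M) (v w : M → ℝ)
    (n : ℕ) : ℝ :=
  ∫ x, v x * w (T^[n] x) ∂μ - (∫ x, v x ∂μ) * ∫ x, w x ∂μ

/-! ### Admissible constants -/

/-- Admissible constants `(θ, K, max I, δ, β, C_τ, η, ρ₀, K₀)` for polynomial tails. -/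
def polyParams : Set (ℝ × ℝ × ℕ × ℝ × ℝ × ℝ × ℝ × ℝ × ℝ) :=
  {(θ, K, _N, δ, β, Cτ, η, ρ₀, K₀) : ℝ × ℝ × ℕ × ℝ × ℝ × ℝ × ℝ × ℝ × ℝ |
    θ ∈ Ioo 0 1 ∧ 0 < K ∧ 0 < δ ∧ 1 < β ∧ 0 < Cτ ∧ η ∈ Ioc 0 1 ∧ ρ₀ ∈ Ioo 0 1 ∧ 1 ≤ K₀}

/-- Admissible constants `(θ, K, max I, δ, A, γ, C_τ, η, ρ₀, K₀)` for (stretched) exponential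
tails. -/
def expParams : Set (ℝ × ℝ × ℕ × ℝ × ℝ × ℝ × ℝ × ℝ × ℝ × ℝ) :=
  {(θ, K, _N, δ, A, γ, Cτ, η, ρ₀, K₀) : ℝ × ℝ × ℕ × ℝ × ℝ × ℝ × ℝ × ℝ × ℝ × ℝ |
    θ ∈ Ioo 0 1 ∧ 0 < K ∧ 0 < δ ∧ 0 < A ∧ γ ∈ Ioc 0 1 ∧ 0 < Cτ ∧ η ∈ Ioc 0 1 ∧ ρ₀ ∈ Ioo 0 1 ∧
      1 ≤ K₀}

end

/-! Up to the normalising factor `1 / ∫ τ`, a correlation on `M` compares the integral over the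
tower of `v (T^l y) * w (T^(l+n) y)` with a product of two tower integrals. Everything is therefore
done on the base, where a function on the tower becomes a sequence with `U n x = U (n - τ x) (F x)`
as soon as `τ x ≤ n` (`IsTowerSeq`).

The core is a regeneration argument. Take a density on `Ȳ` whose logarithm is Lipschitz in the
symbolic metric and push forward the part that returns at a given time. By bounded distortion the
result is log-Lipschitz with a strictly smaller constant, so a fixed fraction `ε` of the returning
mass can be split off as a multiple of the density `1` while the rest stays in the original cone
(`Cone.sub_const`). Thus every return is a regeneration with probability `ε`. The mass that has not
regenerated obeys a renewal inequality with factor `1 - ε < 1`, so the first regeneration time has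
tails of the same type as `τ`. The integrals against a tower sequence then solve a renewal equation
up to a small error. A coupling of renewal processes with different delays
(`exists_renewal_diff_le`) shows that they converge, at the rate of the summed tails: this is where
`n ^ (-β)` becomes `n ^ (-(β - 1))`, whereas a stretched exponential only loses in its constants.
The times `I_k` enter here, through a lower bound on the renewal probabilities. The outcome is
`exists_base_decay`, and `exists_tower_decay` carries it from the base to the tower.

Observables on `M` are not functions on the quotient. Since tower integrals are invariant, `v` may
be read `k = n / 2` steps later; by (P1) it is then a function of finitely many symbols, up to an
error geometric in the number of returns made (`approximable`). The mean of this error decays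
because each return contributes a contracting factor (`exists_returns_decay`). The pieces are put
together in `exists_decorrelation`. The invariant density is controlled by
`hasDensities_of_absolutelyContinuous`, which tests it on cylinders only, as nothing says that
cylinders generate the σ-algebra of `Ȳ`.

For the dependence on the parameters, both types of decay are treated at once through rates `r i L
n`, where each operation costs only a change of `L`, uniformly in the exponent `i`. One constant
then serves a whole neighbourhood of each parameter point. The admissible constants form an
up-closed, hence convex, set of reals, so a partition of unity yields a continuous choice
(`exists_continuousOn_forall_mem`). -/

/-! ### Families of rates -/

/-- A family of rate functions `n ↦ r i L n`, indexed by an exponent `i` and a constant `L ≥ 1`,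
whose operations used in renewal estimates cost only a change of `L` that is uniform in `i`. -/
structure RateFamily {ι : Type} (r : ι → ℝ → ℕ → ℝ) : Prop where
  nonneg : ∀ i L n, 1 ≤ L → 0 ≤ r i L n
  mono : ∀ i L L' n, 1 ≤ L → L ≤ L' → r i L n ≤ r i L' n
  anti : ∀ i L, 1 ≤ L → Antitone (r i L)
  at_zero : ∀ i L, r i L 0 = L
  scale : ∀ L, 1 ≤ L → ∀ c : ℝ, ∃ L', 1 ≤ L' ∧ ∀ i n, c * r i L n ≤ r i L' n
  half : ∀ L, 1 ≤ L → ∃ L', 1 ≤ L' ∧ ∀ i n, r i L (n / 2) ≤ r i L' n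
  small : ∀ L, 1 ≤ L → ∀ ε : ℝ, 0 < ε → ∃ n, ∀ i, r i L n ≤ ε
  solve : ∀ L, 1 ≤ L → ∀ ρ : ℝ, 0 ≤ ρ → ρ < 1 → ∃ L', 1 ≤ L' ∧ ∀ i n (b : ℕ → ℝ), (∀ t, 0 ≤ b t) →
    ∑ t ∈ Finset.range n, b t ≤ ρ → (∀ s ≤ n, ∑ t ∈ Finset.Ico s n, b t ≤ r i L s) →
    r i L n + ∑ t ∈ Finset.range n, b t * min 1 (r i L' (n - 1 - t)) ≤ r i L' n

/-- A pair of rates such that tail sums of `r₀` are bounded by `r₁`. -/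
structure RatePair {ι : Type} (r₀ r₁ : ι → ℝ → ℕ → ℝ) : Prop where
  fst : RateFamily r₀
  snd : RateFamily r₁
  sum : ∀ L, 1 ≤ L → ∃ L', 1 ≤ L' ∧ ∀ i n N, ∑ j ∈ Finset.Ico n N, r₀ i L j ≤ r₁ i L' n

theorem RateFamily.solve_mul {ι : Type} {r : ι → ℝ → ℕ → ℝ} (hr : RateFamily r) {L : ℝ}
    (hL : 1 ≤ L) {ρ : ℝ} (h0 : 0 ≤ ρ) (h1 : ρ < 1) :
    ∃ L', 1 ≤ L' ∧ ∀ i n (b : ℕ → ℝ) (M : ℝ), 0 ≤ M → (∀ t, 0 ≤ b t) →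
    ∑ t ∈ Finset.range n, b t ≤ ρ * M → (∀ s ≤ n, ∑ t ∈ Finset.Ico s n, b t ≤ M * r i L s) →
    M * r i L n + ∑ t ∈ Finset.range n, b t * min 1 (r i L' (n - 1 - t)) ≤ M * r i L' n := by
  obtain ⟨L', hL', h⟩ := hr.solve L hL ρ h0 h1
  refine ⟨L', hL', fun i n b M hM hb hs ht => ?_⟩
  rcases hM.eq_or_lt with rfl | hM
  · have hz : ∀ t ∈ Finset.range n, b t = 0 := by
      refine (Finset.sum_eq_zero_iff_of_nonneg fun t _ => hb t).1 (le_antisymm ?_ ?_)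
      · simpa using hs
      · exact Finset.sum_nonneg fun t _ => hb t
    rw [Finset.sum_eq_zero fun t ht => by rw [hz t ht, zero_mul]]
    simp
  · have := h i n (fun t => b t / M) (fun t => div_nonneg (hb t) hM.le)
      (by rw [← Finset.sum_div, div_le_iff₀ hM]; exact hs)
      (fun s hs => by rw [← Finset.sum_div, div_le_iff₀ hM, mul_comm]; exact ht s hs)
    have h2 := mul_le_mul_of_nonneg_left this hM.le
    rw [mul_add, Finset.mul_sum] at h2
    refine le_trans (le_of_eq ?_) h2
    congr 1
    refine Finset.sum_congr rfl fun t _ => ?_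
    field_simp

/-- The polynomial rates `L (n + 1) ^ (-s i)`. -/
noncomputable def polyRate {ι : Type} (s : ι → ℝ) (i : ι) (L : ℝ) (n : ℕ) : ℝ :=
  L * ((n : ℝ) + 1) ^ (-s i)

/-- The stretched exponential rates `L exp(-n ^ γ i / L)`. -/
noncomputable def expRate {ι : Type} (γ : ι → ℝ) (i : ι) (L : ℝ) (n : ℕ) : ℝ :=
  L * Real.exp (-((n : ℝ) ^ γ i / L))

/-- The delicate axiom is `solve`; the convolution is split where `n - t` is a fixed proportion of
`n`. For early `t` the rate at `n - 1 - t` exceeds the rate at `n` by a factor at most `1 / a`, with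
`ρ / a < 1`. For late `t` the cap `min 1` leaves a tail of `b`, which is bounded in terms of `L`
alone, so a large `L'` absorbs it. -/
theorem rateFamily_polyRate {ι : Type} (s : ι → ℝ) {s₁ s₂ : ℝ} (h₁ : 0 < s₁)
    (hs : ∀ i, s₁ ≤ s i ∧ s i ≤ s₂) : RateFamily (polyRate s) where
  nonneg i L n hL := by unfold polyRate; positivity
  mono i L L' n hL hLL := by unfold polyRate; gcongr
  anti i L hL := by
    intro a b hab
    unfold polyRate
    have : (a : ℝ) ≤ b := by exact_mod_cast hab
    refine mul_le_mul_of_nonneg_left ?_ (by linarith)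
    exact Real.rpow_le_rpow_of_nonpos (by positivity) (by linarith) (by linarith [(hs i).1])
  at_zero i L := by simp [polyRate]
  scale L hL c := by
    refine ⟨max 1 (c * L), le_max_left _ _, fun i n => ?_⟩
    unfold polyRate
    rw [← mul_assoc]
    gcongr
    exact le_max_right _ _
  half L hL := by
    refine ⟨max 1 (L * 2 ^ s₂), le_max_left _ _, fun i n => ?_⟩
    unfold polyRate
    refine le_trans ?_ (mul_le_mul_of_nonneg_right (le_max_right _ _) (by positivity))
    rw [mul_assoc]
    refine mul_le_mul_of_nonneg_left ?_ (by linarith)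
    have h2 : ((n : ℝ) + 1) / 2 ≤ ((n / 2 : ℕ) : ℝ) + 1 := by
      have : n ≤ 2 * (n / 2) + 1 := by omega
      have : (n : ℝ) ≤ 2 * ((n / 2 : ℕ) : ℝ) + 1 := by exact_mod_cast this
      linarith
    calc (((n / 2 : ℕ) : ℝ) + 1) ^ (-s i) ≤ (((n : ℝ) + 1) / 2) ^ (-s i) :=
          Real.rpow_le_rpow_of_nonpos (by positivity) h2 (by linarith [(hs i).1])
      _ = 2 ^ s i * ((n : ℝ) + 1) ^ (-s i) := by
          rw [Real.div_rpow (by positivity) (by norm_num), Real.rpow_neg (by norm_num : (0:ℝ) ≤ 2)]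
          field_simp
      _ ≤ _ := by
          gcongr
          · norm_num
          · exact (hs i).2
  small L hL ε hε := by
    have h : Filter.Tendsto (fun n : ℕ => L * ((n : ℝ) + 1) ^ (-s₁)) Filter.atTop (nhds (L * 0)) := by
      refine Filter.Tendsto.const_mul _ ?_
      exact (tendsto_rpow_neg_atTop h₁).comp
        (Filter.tendsto_atTop_add_const_right _ _ tendsto_natCast_atTop_atTop)
    rw [mul_zero] at h
    obtain ⟨n, hn⟩ := (h.eventually (gt_mem_nhds hε)).exists
    refine ⟨n, fun i => le_trans ?_ hn.le⟩
    unfold polyRate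
    refine mul_le_mul_of_nonneg_left ?_ (by linarith)
    exact Real.rpow_le_rpow_of_exponent_le (by linarith [Nat.cast_nonneg (α := ℝ) n])
      (by linarith [(hs i).1])
  solve L hL ρ h0 h1 := by
    by_cases hι : Nonempty ι
    swap
    · exact ⟨1, le_rfl, fun i => (hι ⟨i⟩).elim⟩
    have hs2 : 0 < s₂ := hι.elim fun i => by linarith [(hs i).1, (hs i).2]
    -- The midpoint of `1` and `2ρ / (1 + ρ)`: below `1`, yet large enough that `ρ / a ≤ (1 + ρ) /
    -- 2`, which leaves a margin `(1 - ρ) / 2` for the other terms.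
    set a : ℝ := (1 + 2 * ρ / (1 + ρ)) / 2 with ha
    have hq : 2 * ρ / (1 + ρ) < 1 := by rw [div_lt_one (by linarith)]; linarith
    have hq0 : 0 ≤ 2 * ρ / (1 + ρ) := by positivity
    have ha0 : 0 < a := by rw [ha]; linarith
    have ha1 : a < 1 := by rw [ha]; linarith
    have haq : ρ / a ≤ (1 + ρ) / 2 := by
      have : 2 * ρ / (1 + ρ) ≤ a := by rw [ha]; linarith
      rw [div_le_iff₀ (by linarith)] at this
      rw [div_le_iff₀ ha0]
      nlinarith
    -- Shrinking the argument by `κ` costs at most `1 / a`, for all exponents up to `s₂`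
    -- simultaneously.
    set κ : ℝ := a ^ s₂⁻¹ with hκ
    have hκ0 : 0 < κ := Real.rpow_pos_of_pos ha0 _
    have hκ1 : κ < 1 := Real.rpow_lt_one ha0.le ha1 (by positivity)
    have hκs : ∀ i, a ≤ κ ^ s i := fun i => by
      have : κ ^ s₂ = a := by
        rw [hκ, ← Real.rpow_mul ha0.le, inv_mul_cancel₀ hs2.ne', Real.rpow_one]
      rw [← this]
      exact Real.rpow_le_rpow_of_exponent_ge hκ0 hκ1.le (hs i).2
    set D : ℝ := L + L * ((1 - κ) ^ s₂)⁻¹ with hD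
    have hκ' : 0 < 1 - κ := by linarith
    have hD0 : 0 < D := by positivity
    refine ⟨max 1 (D * 2 / (1 - ρ)), le_max_left _ _, fun i n b hb hsum htail => ?_⟩
    set L' := max 1 (D * 2 / (1 - ρ)) with hL'
    have hL'1 : 1 ≤ L' := le_max_left _ _
    have hDL : D ≤ L' * ((1 - ρ) / 2) := by
      have : D * 2 / (1 - ρ) ≤ L' := le_max_right _ _
      rw [div_le_iff₀ (by linarith)] at this
      linarith
    set x : ℝ := (n : ℝ) + 1 with hx
    have hx0 : 0 < x := by positivity
    set y := x ^ (-s i) with hy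
    have hy0 : 0 ≤ y := by positivity
    have hsi : 0 < s i := by linarith [(hs i).1]
    set z : ℝ := n - κ * x with hz
    set s0 : ℕ := ⌈z⌉₊ with hs0
    have hzn : z ≤ n := by
      have : 0 ≤ κ * x := by positivity
      rw [hz]; linarith
    have hs0n : s0 ≤ n := Nat.ceil_le.2 hzn
    have hone : ∀ k : ℕ, min 1 (polyRate s i L' k) ≤ 1 := fun k => min_le_left _ _
    have key : ∀ t ∈ Finset.range n, b t * min 1 (polyRate s i L' (n - 1 - t)) ≤
        b t * (L' * a⁻¹ * y) + (if s0 ≤ t then b t else 0) := by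
      intro t ht
      have htn : t < n := Finset.mem_range.1 ht
      -- Late `t` are bounded through the cap `1`; for early `t` one still has `n - t ≥ κ (n + 1)`.
      by_cases hcase : z ≤ t
      · rw [if_pos (Nat.ceil_le.2 hcase)]
        have h3 := mul_le_mul_of_nonneg_left (hone (n - 1 - t)) (hb t)
        have h4 : 0 ≤ b t * (L' * a⁻¹ * y) := by have := hb t; positivity
        linarith
      · push Not at hcase
        have h5 : κ * x ≤ ((n - 1 - t : ℕ) : ℝ) + 1 := by
          have : ((n - 1 - t : ℕ) : ℝ) = n - 1 - t := by
            rw [Nat.cast_sub (by omega), Nat.cast_sub (by omega)]; simp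
          rw [this]; rw [hz] at hcase; linarith
        have h6 : polyRate s i L' (n - 1 - t) ≤ L' * a⁻¹ * y := by
          unfold polyRate
          rw [mul_assoc]
          refine mul_le_mul_of_nonneg_left ?_ (by linarith)
          calc (((n - 1 - t : ℕ) : ℝ) + 1) ^ (-s i) ≤ (κ * x) ^ (-s i) :=
                Real.rpow_le_rpow_of_nonpos (by positivity) h5 (by linarith)
            _ = (κ ^ s i)⁻¹ * y := by
                rw [Real.mul_rpow hκ0.le hx0.le, Real.rpow_neg hκ0.le]
            _ ≤ a⁻¹ * y := by
                gcongr
                exact hκs i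
        have h7 : 0 ≤ (if s0 ≤ t then b t else 0) := by split_ifs; exacts [hb t, le_rfl]
        have := mul_le_mul_of_nonneg_left ((min_le_right 1 _).trans h6) (hb t)
        linarith
    have hsum2 := Finset.sum_le_sum key
    rw [Finset.sum_add_distrib, ← Finset.sum_mul, ← Finset.sum_filter] at hsum2
    have hfil : (Finset.range n).filter (fun t => s0 ≤ t) = Finset.Ico s0 n := by
      ext t; simp [and_comm]
    rw [hfil] at hsum2
    have ht0 := htail s0 hs0n
    have hr0 : polyRate s i L s0 ≤ L * ((1 - κ) ^ s₂)⁻¹ * y := by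
      unfold polyRate
      rw [mul_assoc]
      refine mul_le_mul_of_nonneg_left ?_ (by linarith)
      have h8 : (1 - κ) * x ≤ (s0 : ℝ) + 1 := by
        have := Nat.le_ceil z
        rw [← hs0] at this
        rw [hz] at this
        rw [hx] at this ⊢
        linarith
      calc ((s0 : ℝ) + 1) ^ (-s i) ≤ ((1 - κ) * x) ^ (-s i) :=
            Real.rpow_le_rpow_of_nonpos (by positivity) h8 (by linarith)
        _ = ((1 - κ) ^ s i)⁻¹ * y := by
            rw [Real.mul_rpow hκ'.le hx0.le, Real.rpow_neg hκ'.le]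
        _ ≤ _ := by
            gcongr ?_⁻¹ * y
            exact Real.rpow_le_rpow_of_exponent_ge hκ' (by linarith) (hs i).2
    have hn : polyRate s i L n = L * y := rfl
    have hn' : polyRate s i L' n = L' * y := rfl
    have hb1 : (∑ t ∈ Finset.range n, b t) * (L' * a⁻¹ * y) ≤ (1 + ρ) / 2 * (L' * y) := by
      calc _ ≤ ρ * (L' * a⁻¹ * y) := by gcongr
        _ = ρ / a * (L' * y) := by field_simp
        _ ≤ _ := by gcongr
    rw [hn, hn']
    have : D * y ≤ L' * ((1 - ρ) / 2) * y := by gcongr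
    rw [hD] at this
    nlinarith

/-- Each term is compared with an increment of `(j + 1) ^ (-(β - 1))`, using `1 - 1/u ≤ log u`, and
the increments telescope. The factor `1 / (β₁ - 1)` is why the exponents must stay away from `1`. -/
theorem sum_polyRate_le {ι : Type} (β : ι → ℝ) {β₁ β₂ : ℝ} (h₁ : 1 < β₁)
    (hβ : ∀ i, β₁ ≤ β i ∧ β i ≤ β₂) (L : ℝ) (hL : 1 ≤ L) :
    ∃ L', 1 ≤ L' ∧ ∀ i n N, ∑ j ∈ Finset.Ico n N, polyRate β i L j ≤
      polyRate (fun i => β i - 1) i L' n := by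
  set D : ℝ := 2 ^ β₂ / (β₁ - 1) with hD
  have hβ1 : 0 < β₁ - 1 := by linarith
  refine ⟨max 1 (L * D), le_max_left _ _, fun i n N => ?_⟩
  obtain ⟨hi1, hi2⟩ := hβ i
  set s := β i - 1 with hs
  have hs0 : 0 < s := by linarith
  have step : ∀ j : ℕ, ((j : ℝ) + 1) ^ (-β i) ≤
      D * (((j : ℝ) + 1) ^ (-s) - ((j + 1 : ℕ) + 1 : ℝ) ^ (-s)) := by
    intro j
    set x : ℝ := (j : ℝ) + 1 with hx
    have hx0 : 1 ≤ x := by rw [hx]; linarith [Nat.cast_nonneg (α := ℝ) j]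
    have hxp : 0 < x := by linarith
    have e1 : ((j + 1 : ℕ) + 1 : ℝ) = x + 1 := by push_cast; rw [hx]
    rw [e1]
    have hlog : (x + 1)⁻¹ ≤ Real.log ((x + 1) / x) := by
      have := Real.one_sub_inv_le_log_of_pos (show 0 < (x + 1) / x by positivity)
      refine le_trans (le_of_eq ?_) this
      field_simp; ring
    have h2 : 1 + s * (x + 1)⁻¹ ≤ ((x + 1) / x) ^ s := by
      rw [Real.rpow_def_of_pos (by positivity)]
      have := Real.add_one_le_exp (Real.log ((x + 1) / x) * s)
      nlinarith
    have h3 : x ^ (-s) = (x + 1) ^ (-s) * ((x + 1) / x) ^ s := by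
      rw [Real.div_rpow (by positivity) hxp.le, Real.rpow_neg hxp.le, Real.rpow_neg (by positivity)]
      field_simp
    have h4 : s * (x + 1) ^ (-β i) ≤ x ^ (-s) - (x + 1) ^ (-s) := by
      rw [h3]
      have : (x + 1) ^ (-β i) = (x + 1) ^ (-s) * (x + 1)⁻¹ := by
        rw [show -β i = -s + -1 by rw [hs]; ring, Real.rpow_add (by positivity), Real.rpow_neg_one]
      rw [this]
      have hp : 0 ≤ (x + 1) ^ (-s) := by positivity
      nlinarith
    -- The telescoping bound controls the power of `x + 1`; since `x ≥ 1`, going back to `x` costs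
    -- `2 ^ β`.
    have h5 : x ^ (-β i) ≤ 2 ^ β₂ * (x + 1) ^ (-β i) := by
      have : (2 * x) ^ (-β i) ≤ (x + 1) ^ (-β i) :=
        Real.rpow_le_rpow_of_nonpos (by positivity) (by linarith) (by linarith)
      rw [Real.mul_rpow (by norm_num) hxp.le] at this
      calc x ^ (-β i) = 2 ^ β i * (2 ^ (-β i) * x ^ (-β i)) := by
            rw [← mul_assoc, ← Real.rpow_add (by norm_num)]; simp
        _ ≤ 2 ^ β₂ * (x + 1) ^ (-β i) := by
            gcongr
            norm_num
    rw [hD]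
    calc x ^ (-β i) ≤ 2 ^ β₂ * (x + 1) ^ (-β i) := h5
      _ = 2 ^ β₂ / (β₁ - 1) * ((β₁ - 1) * (x + 1) ^ (-β i)) := by field_simp
      _ ≤ 2 ^ β₂ / (β₁ - 1) * (s * (x + 1) ^ (-β i)) := by
          gcongr
          rw [hs]; linarith
      _ ≤ _ := by gcongr
  have hD0 : 0 ≤ D := by positivity
  rcases le_total N n with hN | hN
  · rw [Finset.Ico_eq_empty_of_le hN, Finset.sum_empty]
    unfold polyRate; positivity
  calc ∑ j ∈ Finset.Ico n N, polyRate β i L j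
      ≤ ∑ j ∈ Finset.Ico n N, L * (D * (((j : ℝ) + 1) ^ (-s) - ((j + 1 : ℕ) + 1 : ℝ) ^ (-s))) :=
        Finset.sum_le_sum fun j _ => mul_le_mul_of_nonneg_left (step j) (by linarith)
    _ = L * (D * (((n : ℝ) + 1) ^ (-s) - ((N : ℝ) + 1) ^ (-s))) := by
        rw [← Finset.mul_sum, ← Finset.mul_sum]
        congr 2
        have := Finset.sum_Ico_sub (fun j : ℕ => -((j : ℝ) + 1) ^ (-s)) hN
        rw [show ((n:ℝ) + 1) ^ (-s) - ((N:ℝ) + 1) ^ (-s) =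
          -((N:ℝ) + 1) ^ (-s) - -((n:ℝ) + 1) ^ (-s) by ring, ← this]
        refine Finset.sum_congr rfl fun j _ => by ring
    _ ≤ L * (D * ((n : ℝ) + 1) ^ (-s)) := by
        gcongr
        have : 0 ≤ ((N : ℝ) + 1) ^ (-s) := by positivity
        linarith
    _ = L * D * ((n : ℝ) + 1) ^ (-s) := by ring
    _ ≤ _ := by
        unfold polyRate
        gcongr
        exact le_max_right _ _

theorem ratePair_poly {ι : Type} (β : ι → ℝ) {β₁ β₂ : ℝ} (h₁ : 1 < β₁)
    (hβ : ∀ i, β₁ ≤ β i ∧ β i ≤ β₂) :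
    RatePair (polyRate β) (polyRate fun i => β i - 1) where
  fst := rateFamily_polyRate β (by linarith) hβ
  snd := rateFamily_polyRate _ (s₁ := β₁ - 1) (s₂ := β₂ - 1) (by linarith) fun i =>
    ⟨by linarith [(hβ i).1], by linarith [(hβ i).2]⟩
  sum := sum_polyRate_le β h₁ hβ

theorem summable_add_one_mul_exp_neg_rpow {c γ : ℝ} (hc : 0 < c) (hγ : 0 < γ) :
    Summable fun n : ℕ => ((n : ℝ) + 1) * Real.exp (-c * (n : ℝ) ^ γ) := by
  have h1 := (isLittleO_exp_neg_mul_rpow_atTop hc (-(3 / γ))).isBigO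
  have h2 : Filter.Tendsto (fun n : ℕ => (n : ℝ) ^ γ) Filter.atTop Filter.atTop :=
    (tendsto_rpow_atTop hγ).comp tendsto_natCast_atTop_atTop
  have h3 := h1.comp_tendsto h2
  have h4 : (fun n : ℕ => (n : ℝ) + 1) =O[Filter.atTop] fun n : ℕ => (n : ℝ) := by
    refine Asymptotics.IsBigO.of_bound 2 ?_
    filter_upwards [Filter.eventually_ge_atTop 1] with n hn
    have : (1 : ℝ) ≤ n := by exact_mod_cast hn
    rw [Real.norm_of_nonneg (by positivity), Real.norm_of_nonneg (by positivity)]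
    linarith
  refine summable_of_isBigO_nat (g := fun n : ℕ => (n : ℝ) ^ (-2 : ℝ))
    (Real.summable_nat_rpow.2 (by norm_num)) ((h4.mul h3).trans ?_)
  refine Asymptotics.IsBigO.of_bound 1 ?_
  filter_upwards [Filter.eventually_ge_atTop 1] with n hn
  have hn' : (0 : ℝ) < n := by exact_mod_cast hn
  refine le_of_eq ?_
  simp only [Function.comp]
  rw [one_mul, ← Real.rpow_mul hn'.le, show γ * -(3 / γ) = -3 by field_simp]
  congr 1
  rw [show (-2 : ℝ) = 1 + -3 by norm_num, Real.rpow_add hn', Real.rpow_one]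

/-! ### Stretched exponential rates. -/

section ExpRate

variable {ι : Type} {γ : ι → ℝ} {γ₁ : ℝ}

theorem natCast_rpow_mono_exponent {a b : ℝ} (ha : 0 < a) (hab : a ≤ b) (n : ℕ) :
    (n : ℝ) ^ a ≤ (n : ℝ) ^ b := by
  rcases Nat.eq_zero_or_pos n with rfl | hn
  · simp [Real.zero_rpow ha.ne', Real.zero_rpow (ha.trans_le hab).ne']
  · exact Real.rpow_le_rpow_of_exponent_le (by exact_mod_cast hn) hab

/-- For `γ ≤ 1` the function `x ^ γ` is subadditive, so the rate at `n - 1 - t` is at most the rate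
at `n` times `exp ((t + 1) ^ γ / L')`. In `solve`, this exponential is `1` plus a remainder of order
`1 / L'`: the `1` contributes a factor `ρ`, and the remainder is summable against `b t ≤ L exp (-t ^
γ / L)`. -/
theorem rateFamily_expRate (h₁ : 0 < γ₁) (hγ : ∀ i, γ₁ ≤ γ i ∧ γ i ≤ 1) :
    RateFamily (expRate γ) where
  nonneg i L n hL := by unfold expRate; positivity
  mono i L L' n hL hLL := by
    unfold expRate
    have : 0 ≤ L' := by linarith
    gcongr
  anti i L hL := by
    intro a b hab
    unfold expRate
    have : (a : ℝ) ≤ b := by exact_mod_cast hab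
    have : 0 ≤ γ i := h₁.le.trans (hγ i).1
    gcongr
  at_zero i L := by simp [expRate, Real.zero_rpow (h₁.trans_le (hγ i).1).ne']
  scale L hL c := by
    refine ⟨max L (c * L), le_max_of_le_left hL, fun i n => ?_⟩
    unfold expRate
    rw [← mul_assoc]
    have h1 : L ≤ max L (c * L) := le_max_left _ _
    have : c * L ≤ max L (c * L) := le_max_right _ _
    have h2 : 0 ≤ max L (c * L) := by linarith
    refine mul_le_mul this ?_ (Real.exp_pos _).le h2
    gcongr
  half L hL := by
    refine ⟨2 * L * Real.exp 1, ?_, fun i n => ?_⟩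
    · have := Real.add_one_le_exp 1
      nlinarith
    unfold expRate
    have hγi := hγ i
    have hL0 : 0 < L := by linarith
    have h1 : (n : ℝ) ^ γ i ≤ 2 * ((n / 2 : ℕ) : ℝ) ^ γ i + 1 := by
      have h2 : n ≤ (n / 2) + (n / 2) + 1 := by omega
      have h2 : (n : ℝ) ≤ ((n / 2 : ℕ) : ℝ) + ((n / 2 : ℕ) : ℝ) + 1 := by exact_mod_cast h2
      have h3 : (0:ℝ) ≤ γ i := by linarith
      calc (n : ℝ) ^ γ i ≤ (((n / 2 : ℕ) : ℝ) + ((n / 2 : ℕ) : ℝ) + 1) ^ γ i := by gcongr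
        _ ≤ (((n / 2 : ℕ) : ℝ) + ((n / 2 : ℕ) : ℝ)) ^ γ i + 1 ^ γ i :=
            Real.rpow_add_le_add_rpow (by positivity) (by positivity) h3 hγi.2
        _ ≤ ((n / 2 : ℕ) : ℝ) ^ γ i + ((n / 2 : ℕ) : ℝ) ^ γ i + 1 ^ γ i := by
            gcongr
            exact Real.rpow_add_le_add_rpow (by positivity) (by positivity) h3 hγi.2
        _ = _ := by rw [Real.one_rpow]; ring
    have he : 1 ≤ Real.exp 1 := by have := Real.add_one_le_exp 1; linarith
    calc L * Real.exp (-(((n / 2 : ℕ) : ℝ) ^ γ i / L))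
        ≤ L * Real.exp (1 + -((n : ℝ) ^ γ i / (2 * L))) := by
          gcongr
          have h5 : (n : ℝ) ^ γ i / (2 * L) ≤ (2 * ((n / 2 : ℕ) : ℝ) ^ γ i + 1) / (2 * L) := by
            gcongr
          have h6 : (2 * ((n / 2 : ℕ) : ℝ) ^ γ i + 1) / (2 * L) =
            ((n / 2 : ℕ) : ℝ) ^ γ i / L + 1 / (2 * L) := by field_simp
          have h7 : 1 / (2 * L) ≤ 1 := by rw [div_le_one (by positivity)]; linarith
          linarith
      _ = (L * Real.exp 1) * Real.exp (-((n : ℝ) ^ γ i / (2 * L))) := by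
          rw [Real.exp_add]; ring
      _ ≤ (2 * L * Real.exp 1) * Real.exp (-((n : ℝ) ^ γ i / (2 * L * Real.exp 1))) := by
          have h8 : 2 * L ≤ 2 * L * Real.exp 1 := by nlinarith
          gcongr
          nlinarith
  small L hL ε hε := by
    have h : Filter.Tendsto (fun n : ℕ => L * Real.exp (-((n : ℝ) ^ γ₁ / L))) Filter.atTop
        (nhds (L * 0)) := by
      refine Filter.Tendsto.const_mul _ (Real.tendsto_exp_neg_atTop_nhds_zero.comp ?_)
      exact ((tendsto_rpow_atTop h₁).comp tendsto_natCast_atTop_atTop).atTop_div_const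
        (by linarith)
    rw [mul_zero] at h
    obtain ⟨n, hn⟩ := (h.eventually (gt_mem_nhds hε)).exists
    refine ⟨n, fun i => le_trans ?_ hn.le⟩
    unfold expRate
    have := natCast_rpow_mono_exponent h₁ (hγ i).1 n
    gcongr
  solve L hL ρ h0 h1 := by
    have hL0 : 0 < L := by linarith
    have hsum := summable_add_one_mul_exp_neg_rpow (c := 1 / (2 * L)) (by positivity) h₁
    set S : ℝ := ∑' n : ℕ, ((n : ℝ) + 1) * Real.exp (-(1 / (2 * L)) * (n : ℝ) ^ γ₁) with hS
    have hS0 : 0 ≤ S := tsum_nonneg fun n => by positivity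
    have hρ : 0 < 1 - ρ := by linarith
    -- The three bounds respectively absorb the term `r i L n`, make the growing exponential cost at
    -- most half the decay of `b`, and make the remainder at most `(1 - ρ) / 2`.
    set L' : ℝ := max (2 * L / (1 - ρ)) (max (2 * L) (2 * L * Real.exp 1 * S / (1 - ρ))) with hL'
    have a1 : 2 * L / (1 - ρ) ≤ L' := le_max_left _ _
    have a2 : 2 * L ≤ L' := (le_max_left _ _).trans (le_max_right _ _)
    have a3 : 2 * L * Real.exp 1 * S / (1 - ρ) ≤ L' := (le_max_right _ _).trans (le_max_right _ _)
    rw [div_le_iff₀ hρ] at a1 a3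
    have hL'0 : 0 < L' := by linarith
    refine ⟨L', by linarith, fun i n b hb hsb htail => ?_⟩
    obtain ⟨hi1, hi2⟩ := hγ i
    have hi0 : 0 < γ i := by linarith
    set Y : ℝ := Real.exp (-((n : ℝ) ^ γ i / L')) with hY
    have hY0 : 0 < Y := Real.exp_pos _
    have hbt : ∀ t ∈ Finset.range n, b t ≤ L * Real.exp (-((t : ℝ) ^ γ i / L)) := by
      intro t ht
      have htn := Finset.mem_range.1 ht
      refine le_trans ?_ (htail t htn.le)
      exact Finset.single_le_sum (f := b) (fun j _ => hb j) (Finset.mem_Ico.2 ⟨le_rfl, htn⟩)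
    have key : ∀ t ∈ Finset.range n, b t * min 1 (expRate γ i L' (n - 1 - t)) ≤
        L' * Y * (b t + L * Real.exp 1 / L' *
          (((t : ℝ) + 1) * Real.exp (-(1 / (2 * L)) * (t : ℝ) ^ γ₁))) := by
      intro t ht
      have htn := Finset.mem_range.1 ht
      set z : ℝ := (t : ℝ) ^ γ i with hz
      have hz0 : 0 ≤ z := by positivity
      have c1 : (n : ℝ) ^ γ i ≤ ((n - 1 - t : ℕ) : ℝ) ^ γ i + ((t : ℝ) + 1) ^ γ i := by
        have : (n : ℝ) = ((n - 1 - t : ℕ) : ℝ) + ((t : ℝ) + 1) := by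
          have : n = (n - 1 - t) + (t + 1) := by omega
          exact_mod_cast this
        conv_lhs => rw [this]
        exact Real.rpow_add_le_add_rpow (by positivity) (by positivity) hi0.le hi2
      set w : ℝ := ((t : ℝ) + 1) ^ γ i with hw
      have c2 : w ≤ z + 1 := by
        have := Real.rpow_add_le_add_rpow (Nat.cast_nonneg (α := ℝ) t) zero_le_one hi0.le hi2
        rwa [Real.one_rpow] at this
      have c3 : w ≤ (t : ℝ) + 1 := by
        have := Real.rpow_le_rpow_of_exponent_le
          (show (1 : ℝ) ≤ (t : ℝ) + 1 by linarith [Nat.cast_nonneg (α := ℝ) t]) hi2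
        rwa [Real.rpow_one] at this
      have hw0 : 0 ≤ w := by positivity
      have c4 : expRate γ i L' (n - 1 - t) ≤ L' * Y * Real.exp (w / L') := by
        unfold expRate
        rw [mul_assoc, hY, ← Real.exp_add]
        gcongr
        have : (n : ℝ) ^ γ i / L' ≤ (((n - 1 - t : ℕ) : ℝ) ^ γ i + w) / L' := by gcongr
        rw [add_div] at this
        linarith
      have c5 : Real.exp (w / L') ≤ 1 + w / L' * Real.exp (w / L') := by
        have := Real.add_one_le_exp (-(w / L'))
        rw [Real.exp_neg] at this
        have hp := Real.exp_pos (w / L')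
        have h9 := mul_le_mul_of_nonneg_right this hp.le
        rw [inv_mul_cancel₀ hp.ne'] at h9
        linarith
      have c6 : b t * (w / L' * Real.exp (w / L')) ≤ L * Real.exp 1 / L' *
          (((t : ℝ) + 1) * Real.exp (-(1 / (2 * L)) * (t : ℝ) ^ γ₁)) := by
        have d1 : Real.exp (w / L') ≤ Real.exp (1 + z / (2 * L)) := by
          apply Real.exp_le_exp.2
          have d2 : w / L' ≤ (z + 1) / (2 * L) := by gcongr
          have d3 : (z + 1) / (2 * L) = z / (2 * L) + 1 / (2 * L) := by ring
          have d4 : 1 / (2 * L) ≤ 1 := by rw [div_le_one (by positivity)]; linarith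
          linarith
        have d5 : Real.exp (-(z / L)) * Real.exp (1 + z / (2 * L)) ≤
            Real.exp 1 * Real.exp (-(1 / (2 * L)) * (t : ℝ) ^ γ₁) := by
          rw [← Real.exp_add, ← Real.exp_add]
          apply Real.exp_le_exp.2
          have d6 := natCast_rpow_mono_exponent h₁ hi1 t
          have d7 : 1 / (2 * L) * (t : ℝ) ^ γ₁ ≤ 1 / (2 * L) * z := by gcongr
          have d8 : -(z / L) + (1 + z / (2 * L)) = 1 - 1 / (2 * L) * z := by field_simp; ring
          rw [d8]; linarith
        calc b t * (w / L' * Real.exp (w / L'))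
            ≤ (L * Real.exp (-(z / L))) * (((t : ℝ) + 1) / L' * Real.exp (1 + z / (2 * L))) := by
              have := hbt t ht
              gcongr
          _ = L / L' * ((t : ℝ) + 1) * (Real.exp (-(z / L)) * Real.exp (1 + z / (2 * L))) := by ring
          _ ≤ L / L' * ((t : ℝ) + 1) *
              (Real.exp 1 * Real.exp (-(1 / (2 * L)) * (t : ℝ) ^ γ₁)) := by gcongr
          _ = _ := by ring
      calc b t * min 1 (expRate γ i L' (n - 1 - t))
          ≤ b t * (L' * Y * (1 + w / L' * Real.exp (w / L'))) := by
            refine mul_le_mul_of_nonneg_left ((min_le_right _ _).trans (c4.trans ?_)) (hb t)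
            gcongr
        _ = L' * Y * (b t + b t * (w / L' * Real.exp (w / L'))) := by ring
        _ ≤ _ := by gcongr
    have hs2 := Finset.sum_le_sum key
    rw [← Finset.mul_sum, Finset.sum_add_distrib, ← Finset.mul_sum] at hs2
    have hpart : ∑ t ∈ Finset.range n, ((t : ℝ) + 1) * Real.exp (-(1 / (2 * L)) * (t : ℝ) ^ γ₁)
        ≤ S := hsum.sum_le_tsum _ fun t _ => by positivity
    have e1 : L * Real.exp 1 / L' * ∑ t ∈ Finset.range n,
        ((t : ℝ) + 1) * Real.exp (-(1 / (2 * L)) * (t : ℝ) ^ γ₁) ≤ (1 - ρ) / 2 := by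
      calc _ ≤ L * Real.exp 1 / L' * S := by gcongr
        _ ≤ _ := by
          rw [div_mul_eq_mul_div, div_le_iff₀ hL'0]
          linarith
    have e2 : expRate γ i L n ≤ L' * Y * ((1 - ρ) / 2) := by
      unfold expRate
      have : Real.exp (-((n : ℝ) ^ γ i / L)) ≤ Y := by
        rw [hY]; gcongr; linarith
      calc L * Real.exp (-((n : ℝ) ^ γ i / L)) ≤ L * Y := by gcongr
        _ ≤ (L' * ((1 - ρ) / 2)) * Y := by gcongr; linarith
        _ = _ := by ring
    have e3 : expRate γ i L' n = L' * Y := rfl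
    rw [e3]
    have hLY : 0 < L' * Y := by positivity
    nlinarith

/-- Half of the exponent is spent on summability and the other half, monotone in `j`, is evaluated
at `j = n`. Hence summed tails stay in the same family. -/
theorem ratePair_exp (h₁ : 0 < γ₁) (hγ : ∀ i, γ₁ ≤ γ i ∧ γ i ≤ 1) :
    RatePair (expRate γ) (expRate γ) where
  fst := rateFamily_expRate h₁ hγ
  snd := rateFamily_expRate h₁ hγ
  sum L hL := by
    have hL0 : 0 < L := by linarith
    have hsum := summable_add_one_mul_exp_neg_rpow (c := 1 / (2 * L)) (by positivity) h₁
    set S : ℝ := ∑' n : ℕ, ((n : ℝ) + 1) * Real.exp (-(1 / (2 * L)) * (n : ℝ) ^ γ₁) with hS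
    refine ⟨max (2 * L) (L * S), le_max_of_le_left (by linarith), fun i n N => ?_⟩
    obtain ⟨hi1, hi2⟩ := hγ i
    have hi0 : 0 < γ i := by linarith
    have key : ∀ j ∈ Finset.Ico n N, expRate γ i L j ≤
        L * Real.exp (-((n : ℝ) ^ γ i / (2 * L))) *
          (((j : ℝ) + 1) * Real.exp (-(1 / (2 * L)) * (j : ℝ) ^ γ₁)) := by
      intro j hj
      have hnj : (n : ℝ) ≤ j := by exact_mod_cast (Finset.mem_Ico.1 hj).1
      unfold expRate
      have d1 : (n : ℝ) ^ γ i ≤ (j : ℝ) ^ γ i := by gcongr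
      have d2 := natCast_rpow_mono_exponent h₁ hi1 j
      calc L * Real.exp (-((j : ℝ) ^ γ i / L))
          = L * (Real.exp (-((j : ℝ) ^ γ i / (2 * L))) *
              (1 * Real.exp (-(1 / (2 * L)) * (j : ℝ) ^ γ i))) := by
            rw [one_mul, ← Real.exp_add]
            congr 2
            field_simp; ring
        _ ≤ L * (Real.exp (-((n : ℝ) ^ γ i / (2 * L))) *
              (((j : ℝ) + 1) * Real.exp (-(1 / (2 * L)) * (j : ℝ) ^ γ₁))) := by
            have : -(1 / (2 * L)) * (j : ℝ) ^ γ i ≤ -(1 / (2 * L)) * (j : ℝ) ^ γ₁ := by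
              have : 1 / (2 * L) * (j : ℝ) ^ γ₁ ≤ 1 / (2 * L) * (j : ℝ) ^ γ i := by gcongr
              linarith
            gcongr
            linarith [Nat.cast_nonneg (α := ℝ) j]
        _ = _ := by ring
    refine (Finset.sum_le_sum key).trans ?_
    rw [← Finset.mul_sum]
    have hpart : ∑ t ∈ Finset.Ico n N, ((t : ℝ) + 1) * Real.exp (-(1 / (2 * L)) * (t : ℝ) ^ γ₁)
        ≤ S := hsum.sum_le_tsum _ fun t _ => by positivity
    unfold expRate
    have f1 : 2 * L ≤ max (2 * L) (L * S) := le_max_left _ _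
    have f2 : L * S ≤ max (2 * L) (L * S) := le_max_right _ _
    calc _ ≤ L * Real.exp (-((n : ℝ) ^ γ i / (2 * L))) * S := by gcongr
      _ = L * S * Real.exp (-((n : ℝ) ^ γ i / (2 * L))) := by ring
      _ ≤ _ := by gcongr

end ExpRate


/-! ### Consequences of the rate axioms -/

section Rates

variable {ι : Type} {r r₀ r₁ : ι → ℝ → ℕ → ℝ}

theorem RateFamily.exists_half_pow (hr : RateFamily r) {L : ℝ} (hL : 1 ≤ L) (m : ℕ) :
    ∃ L', 1 ≤ L' ∧ ∀ i n, r i L (n / 2 ^ m) ≤ r i L' n := by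
  induction m with
  | zero => exact ⟨L, hL, fun i n => by simp⟩
  | succ m ih =>
    obtain ⟨L₁, h1, h2⟩ := ih
    obtain ⟨L₂, h3, h4⟩ := hr.half L₁ h1
    refine ⟨L₂, h3, fun i n => ?_⟩
    rw [pow_succ', ← Nat.div_div_eq_div_mul]
    exact (h2 i (n / 2)).trans (h4 i n)

/-- Translations reduce to halvings: `n / 2 ^ (2 * k + 1) ≤ n - k`, since the quotient vanishes for
`n < 2 * k` and `n / 2 ≤ n - k` otherwise. -/
theorem RateFamily.exists_sub (hr : RateFamily r) {L : ℝ} (hL : 1 ≤ L) (k : ℕ) :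
    ∃ L', 1 ≤ L' ∧ ∀ i n, r i L (n - k) ≤ r i L' n := by
  obtain ⟨L', h1, h2⟩ := hr.exists_half_pow hL (2 * k + 1)
  refine ⟨L', h1, fun i n => le_trans (hr.anti i L hL ?_) (h2 i n)⟩
  rcases lt_or_ge n (2 * k) with h | h
  · rw [Nat.div_eq_of_lt]
    · exact Nat.zero_le _
    · exact (h.trans (by omega : 2 * k < 2 * k + 1)).trans Nat.lt_two_pow_self
  · have : n / 2 ^ (2 * k + 1) ≤ n / 2 := by
      apply Nat.div_le_div_left _ two_pos
      exact Nat.le_self_pow (by omega) 2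
    omega

theorem RateFamily.one_le_zero (hr : RateFamily r) (i : ι) {L : ℝ} (hL : 1 ≤ L) : 1 ≤ r i L 0 := by
  rw [hr.at_zero]; exact hL

theorem RatePair.exists_fst_le (hr : RatePair r₀ r₁) {L : ℝ} (hL : 1 ≤ L) :
    ∃ L', 1 ≤ L' ∧ ∀ i n, r₀ i L n ≤ r₁ i L' n := by
  obtain ⟨L', h1, h2⟩ := hr.sum L hL
  exact ⟨L', h1, fun i n => by simpa using h2 i n (n + 1)⟩

/-- Split at `n / 2`: below it `f` is at most the rate at `n / 2` and the weights have bounded sum;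
above it `f ≤ 1` and the weights form a tail. -/
theorem RatePair.exists_conv (hr : RatePair r₀ r₁) {L : ℝ} (hL : 1 ≤ L) :
    ∃ L', 1 ≤ L' ∧ ∀ i n N (f : ℕ → ℝ), (∀ j, f j ≤ 1) →
      (∀ j ≤ n, f j ≤ r₁ i L (n - j)) → ∑ j ∈ Finset.range N, r₀ i L j * f j ≤ r₁ i L' n := by
  obtain ⟨L₁, h1, hsum⟩ := hr.sum L hL
  obtain ⟨L₂, h2, hhalf⟩ := hr.snd.half L hL
  obtain ⟨L₃, h3, hhalf'⟩ := hr.snd.half L₁ h1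
  obtain ⟨L₄, h4, hsc⟩ := hr.snd.scale (max L₂ L₃) (le_max_of_le_left h2) (L₁ + 1)
  refine ⟨L₄, h4, fun i n N f hf1 hf => ?_⟩
  have hr0 : ∀ j, 0 ≤ r₀ i L j := fun j => hr.fst.nonneg i L j hL
  have key : ∀ j ∈ Finset.range N, r₀ i L j * f j ≤
      r₀ i L j * r₁ i L (n / 2) + (if n / 2 ≤ j then r₀ i L j else 0) := by
    intro j _
    by_cases hj : n / 2 ≤ j
    · rw [if_pos hj]
      have := mul_le_mul_of_nonneg_left (hf1 j) (hr0 j)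
      have := mul_nonneg (hr0 j) (hr.snd.nonneg i L (n / 2) hL)
      linarith
    · rw [if_neg hj, add_zero]
      refine mul_le_mul_of_nonneg_left ((hf j (by omega)).trans ?_) (hr0 j)
      exact hr.snd.anti i L hL (by omega)
  refine (Finset.sum_le_sum key).trans ?_
  rw [Finset.sum_add_distrib, ← Finset.sum_mul, ← Finset.sum_filter]
  have hfil : (Finset.range N).filter (fun t => n / 2 ≤ t) = Finset.Ico (n / 2) N := by
    ext t; simp [and_comm]
  rw [hfil]
  have e1 : ∑ j ∈ Finset.range N, r₀ i L j ≤ L₁ := by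
    rw [Finset.range_eq_Ico]
    exact (hsum i 0 N).trans (hr.snd.at_zero i L₁).le
  have e2 := (hsum i (n / 2) N).trans (hhalf' i n)
  have e3 : r₁ i L (n / 2) ≤ r₁ i (max L₂ L₃) n :=
    (hhalf i n).trans (hr.snd.mono i _ _ n h2 (le_max_left _ _))
  have e4 : r₁ i L₃ n ≤ r₁ i (max L₂ L₃) n := hr.snd.mono i _ _ n h3 (le_max_right _ _)
  have e5 := hsc i n
  have e6 : (∑ j ∈ Finset.range N, r₀ i L j) * r₁ i L (n / 2) ≤ L₁ * r₁ i (max L₂ L₃) n :=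
    mul_le_mul e1 e3 (hr.snd.nonneg i L _ hL) (by linarith)
  linarith

end Rates

/-! ### Renewal sequences -/

/-- The law of the residual waiting time at time `d` of the renewal process whose waiting time
equals `t + 1` with probability `p t`. -/
def residualLaw (p : ℕ → ℝ) : ℕ → ℕ → ℝ
  | 0, j => if j = 0 then 1 else 0
  | d + 1, j => residualLaw p d (j + 1) + residualLaw p d 0 * p j

section Renewal

variable {p : ℕ → ℝ}

/-- Decomposition according to the last renewal `k` before time `d`. -/
theorem residual_eq (p : ℕ → ℝ) (d j : ℕ) : residualLaw p d j = (if d + j = 0 then 1 else 0) +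
    ∑ k ∈ Finset.range d, residualLaw p k 0 * p (d - 1 - k + j) := by
  induction d generalizing j with
  | zero => simp [residualLaw]
  | succ d ih =>
    rw [residualLaw, ih (j + 1), Finset.sum_range_succ]
    simp only [show ¬ d + (j + 1) = 0 by omega, show ¬ d + 1 + j = 0 by omega, if_false,
      zero_add, Nat.add_sub_cancel, Nat.sub_self]
    congr 1
    refine Finset.sum_congr rfl fun k hk => ?_
    have := Finset.mem_range.1 hk
    congr 2; omega

theorem renewal_succ (p : ℕ → ℝ) (n : ℕ) :
    residualLaw p (n + 1) 0 = ∑ j ∈ Finset.range (n + 1), p j * residualLaw p (n - j) 0 := by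
  rw [residual_eq, ← Finset.sum_range_reflect]
  simp only [add_zero, Nat.add_sub_cancel, Nat.succ_ne_zero, if_false, zero_add]
  refine Finset.sum_congr rfl fun k hk => ?_
  have := Finset.mem_range.1 hk
  rw [mul_comm]
  congr 2; omega

/-- The Markov property at time `d`: wait for the residual time `j`, then renew afresh. -/
theorem renewal_add (p : ℕ → ℝ) (d n : ℕ) : residualLaw p (d + n) 0 =
    ∑ j ∈ Finset.range (n + 1), residualLaw p d j * residualLaw p (n - j) 0 := by
  induction d generalizing n with
  | zero =>
    rw [Finset.sum_range_succ']
    simp [residualLaw]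
  | succ d ih =>
    rw [show d + 1 + n = d + (n + 1) by ring, ih (n + 1), Finset.sum_range_succ']
    have hdef : ∀ j, residualLaw p (d + 1) j =
      residualLaw p d (j + 1) + residualLaw p d 0 * p j := fun _ => rfl
    simp only [hdef, add_mul, Finset.sum_add_distrib, Nat.add_sub_add_right, Nat.sub_zero]
    congr 1
    rw [renewal_succ, Finset.mul_sum]
    exact Finset.sum_congr rfl fun j _ => by ring

theorem residual_nonneg (hp : ∀ t, 0 ≤ p t) (d j : ℕ) : 0 ≤ residualLaw p d j := by
  induction d generalizing j with
  | zero => rw [residualLaw]; split_ifs <;> norm_num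
  | succ d ih => exact add_nonneg (ih _) (mul_nonneg (ih _) (hp j))

theorem residual_tail_succ (p : ℕ → ℝ) (d i : ℕ) : 1 - ∑ j ∈ Finset.range i, residualLaw p (d + 1) j =
    (1 - ∑ j ∈ Finset.range (i + 1), residualLaw p d j) +
      residualLaw p d 0 * (1 - ∑ t ∈ Finset.range i, p t) := by
  simp only [residualLaw]
  rw [Finset.sum_range_succ', Finset.sum_add_distrib, ← Finset.mul_sum]
  ring

theorem sum_residual_le_one (hp : ∀ t, 0 ≤ p t)
    (hp1 : ∀ n, ∑ t ∈ Finset.range n, p t ≤ 1) (d i : ℕ) : ∑ j ∈ Finset.range i, residualLaw p d j ≤ 1 := by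
  induction d generalizing i with
  | zero =>
    cases i with
    | zero => simp
    | succ i => rw [Finset.sum_range_succ']; simp [residualLaw]
  | succ d ih =>
    have h1 := residual_tail_succ p d i
    have h2 := ih (i + 1)
    have h3 : 0 ≤ residualLaw p d 0 * (1 - ∑ t ∈ Finset.range i, p t) :=
      mul_nonneg (residual_nonneg hp d 0) (by linarith [hp1 i])
    linarith

theorem renewal_le_one (hp : ∀ t, 0 ≤ p t)
    (hp1 : ∀ n, ∑ t ∈ Finset.range n, p t ≤ 1) (d : ℕ) : residualLaw p d 0 ≤ 1 := by
  simpa using sum_residual_le_one hp hp1 d 1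

/-- Each unit of time moves the old residual tail by one step and adds at most one fresh waiting
tail, because a renewal probability is at most `1`. This is where summed tails come in. -/
theorem residual_tail_le (hp : ∀ t, 0 ≤ p t)
    (hp1 : ∀ n, ∑ t ∈ Finset.range n, p t ≤ 1) (d i : ℕ) : 1 - ∑ j ∈ Finset.range (i + 1), residualLaw p d j ≤
    ∑ k ∈ Finset.Ico (i + 1) (i + 1 + d), (1 - ∑ t ∈ Finset.range k, p t) := by
  induction d generalizing i with
  | zero => rw [Finset.sum_range_succ']; simp [residualLaw]
  | succ d ih =>
    have h1 := residual_tail_succ p d (i + 1)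
    have h2 := ih (i + 1)
    have h3 : residualLaw p d 0 * (1 - ∑ t ∈ Finset.range (i + 1), p t) ≤
        1 - ∑ t ∈ Finset.range (i + 1), p t :=
      mul_le_of_le_one_left (by linarith [hp1 (i + 1)]) (renewal_le_one hp hp1 d)
    rw [Finset.sum_eq_sum_Ico_succ_bot (by omega), show i + 1 + (d + 1) = i + 1 + 1 + d by ring]
    linarith

end Renewal

/-- Only finitely many sets `I` lie below `N`; the sum of their thresholds is a threshold that
depends on `N` alone. -/
theorem exists_mem_closure_of_gcd_eq_one (N : ℕ) : ∃ n₁ : ℕ, ∀ I : Finset ℕ, (∀ k ∈ I, k ≤ N) →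
    I.gcd id = 1 → ∀ m, n₁ ≤ m → m ∈ AddSubmonoid.closure (I : Set ℕ) := by
  have h : ∀ I : Finset ℕ, ∃ n : ℕ, ∀ m, n ≤ m → Nat.setGcd (I : Set ℕ) ∣ m →
      m ∈ AddSubmonoid.closure (I : Set ℕ) := fun I => Nat.exists_mem_closure_of_ge _
  choose n hn using h
  refine ⟨∑ I ∈ (Finset.range (N + 1)).powerset, n I, fun I hI hg m hm => ?_⟩
  refine hn I m (le_trans ?_ hm) ?_
  · refine Finset.single_le_sum (f := n) (fun _ _ => Nat.zero_le _) (Finset.mem_powerset.2 ?_)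
    intro k hk
    exact Finset.mem_range.2 (Nat.lt_succ_of_le (hI k hk))
  · have : Nat.setGcd (I : Set ℕ) ∣ I.gcd id :=
      Finset.dvd_gcd fun k hk => Nat.setGcd_dvd_of_mem hk
    rw [hg] at this
    exact this.trans (one_dvd m)

/-- Write `m` as a sum of elements of `I` and renew at every partial sum. Each summand is at least
`1`, so at most `m` factors `δ` occur. -/
theorem pow_le_renewal {p : ℕ → ℝ} (hp : ∀ t, 0 ≤ p t) {δ : ℝ} (hδ : 0 ≤ δ) (hδ1 : δ ≤ 1)
    {I : Finset ℕ} (hI : ∀ k ∈ I, 0 < k) (hIδ : ∀ k ∈ I, δ ≤ p (k - 1)) {m : ℕ}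
    (hm : m ∈ AddSubmonoid.closure (I : Set ℕ)) : δ ^ m ≤ residualLaw p m 0 := by
  induction hm using AddSubmonoid.closure_induction_left with
  | zero => simp [residualLaw]
  | add_left k hk m hm ih =>
    have hk' : k ∈ I := hk
    obtain ⟨k, rfl⟩ : ∃ j, k = j + 1 := ⟨k - 1, by have := hI k hk'; omega⟩
    have h1 := hIδ _ hk'
    rw [Nat.add_sub_cancel] at h1
    rw [show k + 1 + m = (k + m) + 1 by ring, renewal_succ]
    have h2 : p k * residualLaw p (k + m - k) 0 ≤
        ∑ j ∈ Finset.range (k + m + 1), p j * residualLaw p (k + m - j) 0 :=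
      Finset.single_le_sum (f := fun j => p j * residualLaw p (k + m - j) 0)
        (fun j _ => mul_nonneg (hp j) (residual_nonneg hp _ _)) (Finset.mem_range.2 (by omega))
    rw [Nat.add_sub_cancel_left] at h2
    refine le_trans ?_ h2
    calc δ ^ (k + m + 1) = δ ^ k * (δ * δ ^ m) := by ring
      _ ≤ 1 * (p k * residualLaw p m 0) := by
        have := pow_le_one₀ hδ hδ1 (n := k)
        have := hp k
        gcongr
      _ = _ := one_mul _

/-! ### Uniform bounds for renewal sequences. -/

section RenewalRates

variable {ι : Type} {r₀ r₁ : ι → ℝ → ℕ → ℝ}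

/-- Waiting time laws whose tails are bounded by the rate `r₀ i L` and which charge, with mass at
least `δ`, a set of times at most `N` with greatest common divisor `1`. -/
structure WaitingLaw (r₀ : ι → ℝ → ℕ → ℝ) (i : ι) (L δ : ℝ) (N : ℕ) (p : ℕ → ℝ) : Prop where
  nonneg : ∀ t, 0 ≤ p t
  sum_le : ∀ n, ∑ t ∈ Finset.range n, p t ≤ 1
  tail : ∀ n, 1 - ∑ t ∈ Finset.range n, p t ≤ r₀ i L n
  aperiodic : ∃ I : Finset ℕ, (∀ k ∈ I, 0 < k ∧ k ≤ N) ∧ I.gcd id = 1 ∧ ∀ k ∈ I, δ ≤ p (k - 1)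

theorem exists_residual_tail_le (hr : RatePair r₀ r₁) {L : ℝ} (hL : 1 ≤ L) :
    ∃ L', 1 ≤ L' ∧ ∀ i δ N p, WaitingLaw r₀ i L δ N p → ∀ d j,
      1 - ∑ k ∈ Finset.range j, residualLaw p d k ≤ r₁ i L' j := by
  obtain ⟨L', h1, h2⟩ := hr.sum L hL
  refine ⟨L', h1, fun i δ N p hp d j => ?_⟩
  cases j with
  | zero => simpa using hr.snd.one_le_zero i h1
  | succ j =>
    refine (residual_tail_le hp.nonneg hp.sum_le d j).trans (le_trans ?_ (h2 i _ (j + 1 + d)))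
    exact Finset.sum_le_sum fun k _ => hp.tail k

/-- With probability at least `1 / 2` the residual time is below some fixed `m`. After it, a number
of steps between `n₁` and `n₁ + m` remains, all of which are reached with probability at least `δ ^
(n₁ + m)`. -/
theorem exists_le_renewal (hr : RatePair r₀ r₁) {L δ : ℝ} (hL : 1 ≤ L) (hδ : 0 < δ)
    (hδ1 : δ ≤ 1) (N : ℕ) : ∃ (c : ℝ) (n₀ : ℕ), 0 < c ∧ c ≤ 1 ∧ 0 < n₀ ∧ ∀ i p,
      WaitingLaw r₀ i L δ N p → ∀ d, n₀ ≤ d → c ≤ residualLaw p d 0 := by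
  obtain ⟨L', h1, h2⟩ := exists_residual_tail_le hr hL
  obtain ⟨m, hm⟩ := hr.snd.small L' h1 (1 / 2) (by norm_num)
  obtain ⟨n₁, hn₁⟩ := exists_mem_closure_of_gcd_eq_one N
  refine ⟨1 / 2 * δ ^ (n₁ + m), n₁ + m + 1, by positivity, ?_, by omega, fun i p hp d hd => ?_⟩
  · have := pow_le_one₀ hδ.le hδ1 (n := n₁ + m)
    linarith
  obtain ⟨I, hI, hg, hIδ⟩ := hp.aperiodic
  have hlow : ∀ k, n₁ ≤ k → k ≤ n₁ + m → δ ^ (n₁ + m) ≤ residualLaw p k 0 := fun k hk hk' =>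
    (pow_le_pow_of_le_one hδ.le hδ1 hk').trans
      (pow_le_renewal hp.nonneg hδ.le hδ1 (fun k hk => (hI k hk).1) hIδ
        (hn₁ I (fun k hk => (hI k hk).2) hg k hk))
  obtain ⟨e, rfl⟩ : ∃ e, d = e + (n₁ + m) := ⟨d - (n₁ + m), by omega⟩
  rw [renewal_add]
  have h3 : 1 / 2 ≤ ∑ j ∈ Finset.range m, residualLaw p e j := by
    have := (h2 i δ N p hp e m).trans (hm i)
    linarith
  calc 1 / 2 * δ ^ (n₁ + m) ≤ (∑ j ∈ Finset.range m, residualLaw p e j) * δ ^ (n₁ + m) := by gcongr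
    _ ≤ ∑ j ∈ Finset.range m, residualLaw p e j * residualLaw p (n₁ + m - j) 0 := by
        rw [Finset.sum_mul]
        refine Finset.sum_le_sum fun j hj => ?_
        have := Finset.mem_range.1 hj
        exact mul_le_mul_of_nonneg_left (hlow _ (by omega) (by omega))
          (residual_nonneg hp.nonneg _ _)
    _ ≤ _ := by
        refine Finset.sum_le_sum_of_subset_of_nonneg ?_ fun j _ _ =>
          mul_nonneg (residual_nonneg hp.nonneg _ _) (residual_nonneg hp.nonneg _ _)
        exact Finset.range_subset_range.2 (by omega)

/-- The coupling identity: the two renewal sequences are compared at the first renewal of the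
later process after the starting point of the other. -/
theorem abs_renewal_sub_le {p : ℕ → ℝ} (hp : ∀ t, 0 ≤ p t)
    (hp1 : ∀ n, ∑ t ∈ Finset.range n, p t ≤ 1) (a : ℝ) (ha : |a| ≤ 1) (d n : ℕ) :
    |a - residualLaw p (d + n) 0| ≤ (1 - ∑ j ∈ Finset.range (n + 1), residualLaw p d j) +
      ∑ j ∈ Finset.range (n + 1), residualLaw p d j * |a - residualLaw p (n - j) 0| := by
  have h1 : a - residualLaw p (d + n) 0 =
      a * (1 - ∑ j ∈ Finset.range (n + 1), residualLaw p d j) +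
        ∑ j ∈ Finset.range (n + 1), residualLaw p d j * (a - residualLaw p (n - j) 0) := by
    rw [renewal_add]
    simp only [mul_sub, Finset.sum_sub_distrib]
    rw [← Finset.sum_mul]
    ring
  have h2 : 0 ≤ 1 - ∑ j ∈ Finset.range (n + 1), residualLaw p d j := by
    linarith [sum_residual_le_one hp hp1 d (n + 1)]
  rw [h1]
  refine (abs_add_le _ _).trans (add_le_add ?_ ?_)
  · rw [abs_mul, abs_of_nonneg h2]
    exact mul_le_of_le_one_left h2 ha
  · refine (Finset.abs_sum_le_sum_abs _ _).trans (Finset.sum_le_sum fun j _ => ?_)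
    rw [abs_mul, abs_of_nonneg (residual_nonneg hp _ _)]

theorem abs_renewal_sub_renewal_le_one {p : ℕ → ℝ} (hp : ∀ t, 0 ≤ p t)
    (hp1 : ∀ n, ∑ t ∈ Finset.range n, p t ≤ 1) (a b : ℕ) :
    |residualLaw p a 0 - residualLaw p b 0| ≤ 1 := by
  have h1 := residual_nonneg hp a 0
  have h2 := residual_nonneg hp b 0
  have h3 := renewal_le_one hp hp1 a
  have h4 := renewal_le_one hp hp1 b
  rw [abs_le]; constructor <;> linarith

/-- Two copies of the process are compared by strong induction on `n`, for all gaps `d` at once. For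
a gap of at least `n₀`, the later copy renews exactly at the start of the other with probability at
least `c`, and then nothing is left to compare. For a smaller gap there is no such gain, but letting
the later copy run `n₀` steps more turns the gap into one of at least `n₀`. Weights on the gaps make
both moves strict contractions, to which `solve` applies. -/
theorem exists_renewal_diff_le (hr : RatePair r₀ r₁) {L δ : ℝ} (hL : 1 ≤ L) (hδ : 0 < δ)
    (hδ1 : δ ≤ 1) (N : ℕ) : ∃ L', 1 ≤ L' ∧ ∀ i p, WaitingLaw r₀ i L δ N p → ∀ n d,
      |residualLaw p n 0 - residualLaw p (n + d) 0| ≤ r₁ i L' n := by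
  obtain ⟨c, n₀, hc0, hc1, hn₀, hc⟩ := exists_le_renewal hr hL hδ hδ1 N
  obtain ⟨L₁, hL₁, htail⟩ := exists_residual_tail_le hr hL
  obtain ⟨L₂, hL₂, hsc⟩ := hr.snd.scale L₁ hL₁ 2
  obtain ⟨L₃, hL₃, hsub⟩ := hr.snd.exists_sub hL₁ n₀
  set L₄ := max L₂ L₃ with hL₄d
  have hL₄ : 1 ≤ L₄ := le_max_of_le_left hL₂
  -- A large gap contracts by `(1 + c/2)(1 - c) ≤ 1 - c/2`, a small gap by the ratio of weights `1 /
  -- (1 + c/2)`.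
  set ρ : ℝ := max (1 - c / 2) (1 / (1 + c / 2)) with hρ
  have hρ1 : ρ < 1 := by
    rw [hρ, max_lt_iff, div_lt_one (by positivity)]
    constructor <;> linarith
  have hρ0 : 0 ≤ ρ := le_max_of_le_right (by positivity)
  have hρa : 1 - c / 2 ≤ ρ := le_max_left _ _
  have hρb : 1 ≤ ρ * (1 + c / 2) := by
    have : 1 / (1 + c / 2) ≤ ρ := le_max_right _ _
    rwa [div_le_iff₀ (by positivity)] at this
  obtain ⟨L₅, hL₅, hsolve⟩ := hr.snd.solve_mul hL₄ hρ0 hρ1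
  obtain ⟨L₆, hL₆, hfin⟩ := hr.snd.scale L₅ hL₅ 2
  refine ⟨L₆, hL₆, fun i p hp n d => ?_⟩
  have hH := residual_nonneg hp.nonneg
  have h45 : ∀ n, r₁ i L₄ n ≤ r₁ i L₅ n := fun n => by
    have := hsolve i n (fun _ => 0) 1 zero_le_one (fun _ => le_rfl) (by simpa using hρ0)
      (fun s _ => by simpa using hr.snd.nonneg i L₄ s hL₄)
    simpa using this
  set u : ℕ → ℝ := fun n => residualLaw p n 0 with hu
  set W : ℕ → ℝ := fun d => if n₀ ≤ d then 1 else 1 + c / 2 with hW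
  have hW1 : ∀ d, 1 ≤ W d := fun d => by
    simp only [hW]; split_ifs <;> linarith
  have hW2 : ∀ d, W d ≤ 1 + c / 2 := fun d => by
    simp only [hW]; split_ifs <;> linarith
  have hT2 : ∀ n, r₁ i L₁ n ≤ r₁ i L₄ n := fun n => by
    have h1 := hsc i n
    have h2 := hr.snd.nonneg i L₁ n hL₁
    have h3 := hr.snd.mono i _ _ n hL₂ (le_max_left L₂ L₃)
    rw [hL₄d]; linarith
  have main : ∀ n d, 0 < d → |u n - u (n + d)| ≤ W d * r₁ i L₅ n := by
    intro n
    induction n using Nat.strong_induction_on with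
    | _ n ih =>
    intro d hd
    have ih' : ∀ k < n, ∀ d, 0 < d → |u k - u (k + d)| ≤ W d * min 1 (r₁ i L₅ k) := by
      intro k hk d hd
      rw [mul_min_of_nonneg _ _ (by linarith [hW1 d]), mul_one]
      exact le_min ((abs_renewal_sub_renewal_le_one hp.nonneg hp.sum_le _ _).trans (hW1 d))
        (ih k hk d hd)
    have hmin : ∀ k, 0 ≤ min 1 (r₁ i L₅ k) := fun k => le_min zero_le_one (hr.snd.nonneg _ _ _ hL₅)
    have hua : |u n| ≤ 1 := by
      rw [abs_of_nonneg (hH n 0)]; exact renewal_le_one hp.nonneg hp.sum_le n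
    by_cases hdn : n₀ ≤ d
    -- Large gap: the term `j = 0` cancels, and the new gaps `t + 1` may be small, hence the factor
    -- `1 + c / 2`.
    · have hWd : W d = 1 := by simp [hW, hdn]
      rw [add_comm n d, hWd]
      refine (abs_renewal_sub_le hp.nonneg hp.sum_le _ hua d n).trans ?_
      refine le_trans (add_le_add ?_ ?_) (hsolve i n (fun t => (1 + c / 2) * residualLaw p d (t + 1)) 1
        zero_le_one (fun t => mul_nonneg (by positivity) (hH _ _)) ?_ ?_)
      · rw [one_mul]
        exact ((htail i δ N p hp d (n + 1)).trans (hr.snd.anti i L₁ hL₁ (Nat.le_succ n))).trans (hT2 n)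
      · rw [Finset.sum_range_succ']
        simp only [Nat.sub_zero]
        rw [show u n - residualLaw p n 0 = 0 from sub_self _, abs_zero, mul_zero, add_zero]
        refine Finset.sum_le_sum fun t ht => ?_
        have htn := Finset.mem_range.1 ht
        have h1 := ih' (n - (t + 1)) (by omega) (t + 1) (by omega)
        rw [Nat.sub_add_cancel (by omega : t + 1 ≤ n)] at h1
        rw [abs_sub_comm] at h1
        have h2 : W (t + 1) * min 1 (r₁ i L₅ (n - (t + 1))) ≤
            (1 + c / 2) * min 1 (r₁ i L₅ (n - 1 - t)) := by
          rw [show n - (t + 1) = n - 1 - t by omega]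
          exact mul_le_mul_of_nonneg_right (hW2 _) (hmin _)
        have h3 := mul_le_mul_of_nonneg_left (h1.trans h2) (hH d (t + 1))
        linarith
      · rw [← Finset.mul_sum]
        have h1 := sum_residual_le_one hp.nonneg hp.sum_le d (n + 1)
        rw [Finset.sum_range_succ'] at h1
        have h2 := hc i p hp d hdn
        have h3 : (1 + c / 2) * ∑ t ∈ Finset.range n, residualLaw p d (t + 1) ≤
            (1 + c / 2) * (1 - c) := by
          gcongr; linarith
        nlinarith
      · intro s hs
        rw [← Finset.mul_sum, one_mul]
        have h1 := htail i δ N p hp d (s + 1)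
        have h2 := sum_residual_le_one hp.nonneg hp.sum_le d (n + 1)
        rw [Finset.range_eq_Ico, ← Finset.sum_Ico_consecutive _ (Nat.zero_le (s + 1)) (by omega : s + 1 ≤ n + 1),
          ← Finset.sum_Ico_add' _ s n 1, ← Finset.range_eq_Ico] at h2
        have h3 := hr.snd.anti i L₁ hL₁ (Nat.le_succ s)
        have h4 := hsc i s
        have h5 := hr.snd.mono i _ _ s hL₂ (le_max_left L₂ L₃)
        have h6 : 0 ≤ ∑ t ∈ Finset.Ico s n, residualLaw p d (t + 1) :=
          Finset.sum_nonneg fun t _ => hH _ _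
        have h7 := hr.snd.nonneg i L₁ s hL₁
        simp only [Nat.succ_eq_add_one] at h3
        nlinarith
    -- Small gap: for `n < n₀` the claimed bound is at least `1`; otherwise the later copy is
    -- stopped after `d + n₀` steps, and all new gaps `n₀ + j` carry weight `1`.
    · have hWd : W d = 1 + c / 2 := by simp [hW, hdn]
      rcases lt_or_ge n n₀ with hn | hn
      · have h1 := hsub i n
        rw [Nat.sub_eq_zero_of_le hn.le] at h1
        have h2 := hr.snd.one_le_zero i hL₁
        have h3 := hr.snd.mono i _ _ n hL₃ (le_max_right L₂ L₃)
        have h4 := h45 n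
        have h5 : 1 ≤ r₁ i L₅ n := by linarith
        have h6 := abs_renewal_sub_renewal_le_one hp.nonneg hp.sum_le n (n + d)
        have h7 := hW1 d
        simp only [hu]
        nlinarith
      · obtain ⟨n', rfl⟩ : ∃ n', n = n₀ + n' := ⟨n - n₀, by omega⟩
        rw [show n₀ + n' + d = (d + n₀) + n' by ring, hWd]
        refine (abs_renewal_sub_le hp.nonneg hp.sum_le _ hua (d + n₀) n').trans ?_
        have hrange : ∀ s, ∑ t ∈ Finset.range s,
            (if n₀ ≤ t + 1 then residualLaw p (d + n₀) (t + 1 - n₀) else 0) =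
            ∑ j ∈ Finset.range (s + 1 - n₀), residualLaw p (d + n₀) j := by
          intro s
          induction s with
          | zero => rw [Nat.sub_eq_zero_of_le (by omega)]; simp
          | succ s ihs =>
            rw [Finset.sum_range_succ, ihs]
            split_ifs with h
            · rw [show s + 1 + 1 - n₀ = s + 1 - n₀ + 1 by omega, Finset.sum_range_succ]
            · rw [show s + 1 + 1 - n₀ = s + 1 - n₀ by omega, add_zero]
        -- The residual time `j` sits at index `t = n₀ - 1 + j`, so that the remaining time `n - 1 -
        -- t` equals `n' - j`.
        refine le_trans (add_le_add ?_ ?_) (hsolve i (n₀ + n')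
          (fun t => if n₀ ≤ t + 1 then residualLaw p (d + n₀) (t + 1 - n₀) else 0) (1 + c / 2)
          (by linarith) (fun t => by split_ifs; exacts [hH _ _, le_rfl]) ?_ ?_)
        · have h1 := htail i δ N p hp (d + n₀) (n' + 1)
          have h2 := hr.snd.anti i L₁ hL₁ (Nat.le_succ n')
          have h3 := hsub i (n₀ + n')
          rw [Nat.add_sub_cancel_left] at h3
          have h4 := hr.snd.mono i _ _ (n₀ + n') hL₃ (le_max_right L₂ L₃)
          have h5 := hr.snd.nonneg i L₄ (n₀ + n') hL₄
          simp only [Nat.succ_eq_add_one] at h2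
          nlinarith
        · rw [show n₀ + n' = (n₀ - 1) + (n' + 1) by omega, Finset.sum_range_add _ (n₀ - 1) (n' + 1)]
          refine le_trans ?_ (le_add_of_nonneg_left ?_)
          · refine Finset.sum_le_sum fun j hj => ?_
            have hjn := Finset.mem_range.1 hj
            rw [if_pos (by omega), show n₀ - 1 + j + 1 - n₀ = j by omega,
              show n₀ - 1 + (n' + 1) - 1 - (n₀ - 1 + j) = n' - j by omega]
            refine mul_le_mul_of_nonneg_left ?_ (hH _ _)
            have h1 := ih' (n' - j) (by omega) (n₀ + j) (by omega)
            rw [show n' - j + (n₀ + j) = n₀ - 1 + (n' + 1) by omega, abs_sub_comm] at h1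
            have : W (n₀ + j) = 1 := by simp [hW]
            rw [this, one_mul] at h1
            exact h1
          · refine Finset.sum_nonneg fun j _ => mul_nonneg ?_ (hmin _)
            split_ifs
            exacts [hH _ _, le_rfl]
        · rw [hrange, show n₀ + n' + 1 - n₀ = n' + 1 by omega]
          exact (sum_residual_le_one hp.nonneg hp.sum_le _ _).trans hρb
        · intro s hs
          have h1 := hrange (n₀ + n')
          rw [Finset.range_eq_Ico, ← Finset.sum_Ico_consecutive _ (Nat.zero_le s) hs,
            ← Finset.range_eq_Ico, hrange] at h1
          have h2 := htail i δ N p hp (d + n₀) (s + 1 - n₀)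
          have h3 := sum_residual_le_one hp.nonneg hp.sum_le (d + n₀) (n₀ + n' + 1 - n₀)
          have h4 := hsub i s
          have h5 := hr.snd.mono i _ _ s hL₃ (le_max_right L₂ L₃)
          have h6 := hr.snd.nonneg i L₄ s hL₄
          have h7 := hr.snd.anti i L₁ hL₁ (show s - n₀ ≤ s + 1 - n₀ by omega)
          nlinarith
  rcases Nat.eq_zero_or_pos d with rfl | hd
  · rw [add_zero, sub_self, abs_zero]
    exact hr.snd.nonneg i _ _ hL₆
  · refine (main n d hd).trans (le_trans ?_ (hfin i n))
    exact mul_le_mul_of_nonneg_right ((hW2 d).trans (by linarith)) (hr.snd.nonneg i _ _ hL₅)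

end RenewalRates


/-- With generating functions, `w = e + X p w` and `u = 1 + X p u`. Multiplying the first by `u`,
the second by `w` and subtracting gives `w = e u`, without inverting a series. -/
theorem renewal_convolution {p w e : ℕ → ℝ}
    (h : ∀ n, w n = e n + ∑ t ∈ Finset.range n, p t * w (n - 1 - t)) (n : ℕ) :
    w n = ∑ i ∈ Finset.range (n + 1), e i * residualLaw p (n - i) 0 := by
  have hmul : ∀ f g : ℕ → ℝ, ∀ n, PowerSeries.coeff n (PowerSeries.mk f * PowerSeries.mk g) =
      ∑ t ∈ Finset.range (n + 1), f t * g (n - t) := fun f g n => by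
    rw [PowerSeries.coeff_mul, Finset.Nat.sum_antidiagonal_eq_sum_range_succ_mk]
    simp
  have key : ∀ f g : ℕ → ℝ, (∀ n, g n = f n + ∑ t ∈ Finset.range n, p t * g (n - 1 - t)) →
      PowerSeries.mk g = PowerSeries.mk f +
        PowerSeries.X * (PowerSeries.mk p * PowerSeries.mk g) := by
    intro f g hfg
    ext n
    rw [map_add, PowerSeries.coeff_mk, PowerSeries.coeff_mk, hfg n]
    cases n with
    | zero => simp
    | succ n =>
      rw [PowerSeries.coeff_succ_X_mul, hmul]
      simp
  have hW := key e w h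
  have hU := key (fun n => if n = 0 then 1 else 0) (fun n => residualLaw p n 0) fun n => by
    cases n with
    | zero => simp [residualLaw]
    | succ n => rw [renewal_succ]; simp
  have h1 : PowerSeries.mk (fun n => if n = 0 then (1 : ℝ) else 0) = 1 := by
    ext n; simp [PowerSeries.coeff_one]
  rw [h1] at hU
  have : PowerSeries.mk w = PowerSeries.mk e * PowerSeries.mk (fun n => residualLaw p n 0) := by
    linear_combination PowerSeries.mk (fun n => residualLaw p n 0) * hW - PowerSeries.mk w * hU
  have h2 := congrArg (PowerSeries.coeff n) this
  rwa [hmul, PowerSeries.coeff_mk] at h2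

/-- The solution is the convolution of the defect with the renewal sequence. The defect decays like
`r₀` and the increments of the renewal sequence like `r₁`, so their convolution decays like `r₁`. -/
theorem exists_abs_sub_le_of_renewal {ι : Type} {r₀ r₁ : ι → ℝ → ℕ → ℝ} (hr : RatePair r₀ r₁)
    {L δ : ℝ} (hL : 1 ≤ L) (hδ : 0 < δ) (hδ1 : δ ≤ 1) (N : ℕ) :
    ∃ L', 1 ≤ L' ∧ ∀ i p, WaitingLaw r₀ i L δ N p → ∀ (w : ℕ → ℝ) (B : ℝ), 0 ≤ B →
      (∀ n, |w n - ∑ t ∈ Finset.range n, p t * w (n - 1 - t)| ≤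
        B * (1 - ∑ t ∈ Finset.range n, p t)) → ∀ n d, |w n - w (n + d)| ≤ B * r₁ i L' n := by
  obtain ⟨L₁, hL₁, hdiff⟩ := exists_renewal_diff_le hr hL hδ hδ1 N
  set L₂ := max L L₁ with hL₂d
  have hL₂ : 1 ≤ L₂ := le_max_of_le_left hL
  obtain ⟨L₃, hL₃, hconv⟩ := hr.exists_conv hL₂
  refine ⟨L₃, hL₃, fun i p hp w B hB h n d => ?_⟩
  set e : ℕ → ℝ := fun n => w n - ∑ t ∈ Finset.range n, p t * w (n - 1 - t) with he
  have hsol := renewal_convolution (p := p) (w := w) (e := e) fun n => by simp [he]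
  -- For `j > n` only the later solution contains the `j`-th defect; there the bound `1` suffices.
  set f : ℕ → ℝ := fun j => if j ≤ n then |residualLaw p (n - j) 0 - residualLaw p (n - j + d) 0|
    else residualLaw p (n + d - j) 0 with hf
  have hf0 : ∀ j, 0 ≤ f j := fun j => by
    simp only [hf]; split_ifs; exacts [abs_nonneg _, residual_nonneg hp.nonneg _ _]
  have hc := hconv i n (n + d + 1) f
    (fun j => by
      simp only [hf]
      split_ifs
      exacts [abs_renewal_sub_renewal_le_one hp.nonneg hp.sum_le _ _,
        renewal_le_one hp.nonneg hp.sum_le _])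
    (fun j hj => by
      simp only [hf, if_pos hj]
      exact (hdiff i p hp _ _).trans (hr.snd.mono i _ _ _ hL₁ (le_max_right _ _)))
  refine le_trans ?_ (mul_le_mul_of_nonneg_left hc hB)
  have hext : w n = ∑ j ∈ Finset.range (n + d + 1),
      if j ≤ n then e j * residualLaw p (n - j) 0 else 0 := by
    rw [hsol n, ← Finset.sum_filter]
    refine Finset.sum_congr ?_ fun _ _ => rfl
    ext j; simp; omega
  rw [hext, hsol (n + d), ← Finset.sum_sub_distrib, Finset.mul_sum]
  refine (Finset.abs_sum_le_sum_abs _ _).trans (Finset.sum_le_sum fun j hj => ?_)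
  have hj' := Finset.mem_range.1 hj
  have h1 : |e j| ≤ B * r₀ i L₂ j := by
    refine (h j).trans (mul_le_mul_of_nonneg_left ?_ hB)
    exact (hp.tail j).trans (hr.fst.mono i _ _ j hL (le_max_left _ _))
  rw [← mul_assoc]
  refine le_trans (le_of_eq ?_) (mul_le_mul_of_nonneg_right h1 (hf0 j))
  simp only [hf]
  split_ifs with hjn
  · rw [← mul_sub, abs_mul, show n + d - j = n - j + d by omega]
  · rw [zero_sub, abs_neg, abs_mul, abs_of_nonneg (residual_nonneg hp.nonneg _ _)]

/-! ### Abstract regeneration -/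

/-- A system of states `g` of mass `M g`. At time `t + 1` the mass `pt t g` returns; the fraction
`ε` of it regenerates, and the rest is in the state `Rt t g`. -/
structure Regenerative {G : Type*} (M : G → ℝ) (pt : ℕ → G → ℝ) (Rt : ℕ → G → G) (ε : ℝ) :
    Prop where
  pos : 0 < ε
  mass_nonneg : ∀ g, 0 ≤ M g
  nonneg : ∀ t g, 0 ≤ pt t g
  sum_le : ∀ n g, ∑ t ∈ Finset.range n, pt t g ≤ M g
  mass_rest : ∀ t g, M (Rt t g) = (1 - ε) * pt t g

section Regenerative

variable {G : Type*} {M : G → ℝ} {pt : ℕ → G → ℝ} {Rt : ℕ → G → G} {ε : ℝ}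

/-- The mass that has not regenerated up to time `n`. -/
def survival (M : G → ℝ) (pt : ℕ → G → ℝ) (Rt : ℕ → G → G) (n : ℕ) (g : G) : ℝ :=
  (M g - ∑ t ∈ Finset.range n, pt t g) +
    ∑ t : Fin n, survival M pt Rt (n - 1 - t) (Rt t g)
termination_by n
decreasing_by omega

theorem survival_eq (M : G → ℝ) (pt : ℕ → G → ℝ) (Rt : ℕ → G → G) (n : ℕ) (g : G) :
    survival M pt Rt n g = (M g - ∑ t ∈ Finset.range n, pt t g) +
      ∑ t ∈ Finset.range n, survival M pt Rt (n - 1 - t) (Rt t g) := by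
  rw [survival, Finset.sum_range (fun t => survival M pt Rt (n - 1 - t) (Rt t g))]

theorem survival_zero (M : G → ℝ) (pt : ℕ → G → ℝ) (Rt : ℕ → G → G) (g : G) :
    survival M pt Rt 0 g = M g := by
  rw [survival_eq]; simp

/-- The mass that regenerates for the first time at time `n + 1`. -/
def regeneration (M : G → ℝ) (pt : ℕ → G → ℝ) (Rt : ℕ → G → G) (n : ℕ) (g : G) : ℝ :=
  survival M pt Rt n g - survival M pt Rt (n + 1) g

theorem sum_regeneration (M : G → ℝ) (pt : ℕ → G → ℝ) (Rt : ℕ → G → G) (n : ℕ) (g : G) :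
    ∑ t ∈ Finset.range n, regeneration M pt Rt t g = M g - survival M pt Rt n g := by
  unfold regeneration
  rw [Finset.sum_range_sub', survival_zero]

theorem survival_nonneg (h : Regenerative M pt Rt ε) (n : ℕ) (g : G) :
    0 ≤ survival M pt Rt n g := by
  induction n using Nat.strong_induction_on generalizing g with
  | _ n ih =>
  rw [survival_eq]
  refine add_nonneg (by linarith [h.sum_le n g]) (Finset.sum_nonneg fun t ht => ih _ ?_ _)
  have := Finset.mem_range.1 ht
  omega

theorem survival_le (h : Regenerative M pt Rt ε) (n : ℕ) (g : G) :
    survival M pt Rt n g ≤ M g := by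
  induction n using Nat.strong_induction_on generalizing g with
  | _ n ih =>
  rw [survival_eq]
  have h1 : ∑ t ∈ Finset.range n, survival M pt Rt (n - 1 - t) (Rt t g) ≤
      ∑ t ∈ Finset.range n, pt t g := by
    refine Finset.sum_le_sum fun t ht => ?_
    have := Finset.mem_range.1 ht
    refine (ih (n - 1 - t) (by omega) (Rt t g)).trans ?_
    rw [h.mass_rest]
    have := mul_nonneg h.pos.le (h.nonneg t g)
    linarith
  linarith

/-- Either the mass regenerates at its first return, or it returned at an earlier time and restarts
from the rest state. -/
theorem regeneration_eq (h : Regenerative M pt Rt ε) (n : ℕ) (g : G) :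
    regeneration M pt Rt n g = ε * pt n g +
      ∑ t ∈ Finset.range n, regeneration M pt Rt (n - 1 - t) (Rt t g) := by
  rw [regeneration, survival_eq M pt Rt n, survival_eq M pt Rt (n + 1), Finset.sum_range_succ,
    Finset.sum_range_succ]
  rw [show n + 1 - 1 - n = 0 by omega, survival_zero, h.mass_rest]
  have : ∑ t ∈ Finset.range n, regeneration M pt Rt (n - 1 - t) (Rt t g) =
      ∑ t ∈ Finset.range n, survival M pt Rt (n - 1 - t) (Rt t g) -
      ∑ t ∈ Finset.range n, survival M pt Rt (n + 1 - 1 - t) (Rt t g) := by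
    rw [← Finset.sum_sub_distrib]
    refine Finset.sum_congr rfl fun t ht => ?_
    have := Finset.mem_range.1 ht
    rw [regeneration, show n - 1 - t + 1 = n + 1 - 1 - t by omega]
  rw [this]
  ring

theorem regeneration_nonneg (h : Regenerative M pt Rt ε) (n : ℕ) (g : G) :
    0 ≤ regeneration M pt Rt n g := by
  induction n using Nat.strong_induction_on generalizing g with
  | _ n ih =>
  rw [regeneration_eq h]
  refine add_nonneg (mul_nonneg h.pos.le (h.nonneg n g)) (Finset.sum_nonneg fun t ht => ih _ ?_ _)
  have := Finset.mem_range.1 ht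
  omega

theorem le_regeneration (h : Regenerative M pt Rt ε) (n : ℕ) (g : G) :
    ε * pt n g ≤ regeneration M pt Rt n g := by
  rw [regeneration_eq h]
  exact le_add_of_nonneg_right (Finset.sum_nonneg fun t _ => regeneration_nonneg h _ _)

theorem sum_range_sum_range_sub (F : ℕ → ℕ → ℝ) (n : ℕ) :
    ∑ t ∈ Finset.range n, ∑ s ∈ Finset.range t, F s (t - 1 - s) =
      ∑ s ∈ Finset.range n, ∑ k ∈ Finset.range (n - 1 - s), F s k := by
  induction n with
  | zero => simp
  | succ n ih =>
    rw [Finset.sum_range_succ, ih, Finset.sum_range_succ, Nat.add_sub_cancel, Nat.sub_self,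
      Finset.sum_range_zero, add_zero, ← Finset.sum_add_distrib]
    refine Finset.sum_congr rfl fun s hs => ?_
    have := Finset.mem_range.1 hs
    rw [show n - s = n - 1 - s + 1 by omega, Finset.sum_range_succ]

/-- Iterates the one-return identity up to the first regeneration: the errors committed along the
way add up to `B` times the mass that has not regenerated. -/
theorem abs_sub_regeneration_le (h : Regenerative M pt Rt ε) {ev : ℕ → G → ℝ} {w : ℕ → ℝ} {B : ℝ}
    (hev : ∀ n g, |ev n g - ∑ t ∈ Finset.range n,
      (ev (n - 1 - t) (Rt t g) + ε * pt t g * w (n - 1 - t))| ≤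
        B * (M g - ∑ t ∈ Finset.range n, pt t g)) (n : ℕ) (g : G) :
    |ev n g - ∑ t ∈ Finset.range n, regeneration M pt Rt t g * w (n - 1 - t)| ≤
      B * survival M pt Rt n g := by
  induction n using Nat.strong_induction_on generalizing g with
  | _ n ih =>
  have h1 : ∑ t ∈ Finset.range n, regeneration M pt Rt t g * w (n - 1 - t) =
      ∑ t ∈ Finset.range n, ε * pt t g * w (n - 1 - t) +
      ∑ s ∈ Finset.range n, ∑ k ∈ Finset.range (n - 1 - s),
        regeneration M pt Rt k (Rt s g) * w (n - 1 - s - 1 - k) := by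
    rw [← sum_range_sum_range_sub (fun s k =>
      regeneration M pt Rt k (Rt s g) * w (n - 1 - s - 1 - k)), ← Finset.sum_add_distrib]
    refine Finset.sum_congr rfl fun t ht => ?_
    have htn := Finset.mem_range.1 ht
    rw [regeneration_eq h, add_mul, Finset.sum_mul]
    congr 1
    refine Finset.sum_congr rfl fun s hs => ?_
    have hst := Finset.mem_range.1 hs
    rw [show n - 1 - s - 1 - (t - 1 - s) = n - 1 - t by omega]
  have h2 : ev n g - ∑ t ∈ Finset.range n, regeneration M pt Rt t g * w (n - 1 - t) =
      (ev n g - ∑ t ∈ Finset.range n, (ev (n - 1 - t) (Rt t g) + ε * pt t g * w (n - 1 - t))) +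
      ∑ s ∈ Finset.range n, (ev (n - 1 - s) (Rt s g) - ∑ k ∈ Finset.range (n - 1 - s),
        regeneration M pt Rt k (Rt s g) * w (n - 1 - s - 1 - k)) := by
    rw [h1, Finset.sum_sub_distrib, Finset.sum_add_distrib]
    ring
  rw [h2, survival_eq, mul_add, Finset.mul_sum]
  refine (abs_add_le _ _).trans (add_le_add (hev n g) ?_)
  refine (Finset.abs_sum_le_sum_abs _ _).trans (Finset.sum_le_sum fun s hs => ?_)
  have := Finset.mem_range.1 hs
  exact ih _ (by omega) _

end Regenerative

/-- Survival satisfies a renewal inequality with factor `1 - ε`, hence decays like `r₀`. Started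
from `g₁`, the process is a genuine renewal process with the regeneration times as waiting times,
still aperiodic with `ε δ` in place of `δ`; so `ev n g₁` converges. Any other state is averaged over
its first regeneration time, after which it behaves like `g₁`. -/
theorem exists_regenerative_decay {ι : Type} {r₀ r₁ : ι → ℝ → ℕ → ℝ} (hr : RatePair r₀ r₁)
    {L δ ε : ℝ} (hL : 1 ≤ L) (hε : 0 < ε) (hε1 : ε < 1) (hδ : 0 < δ) (hδ1 : δ ≤ 1) (N : ℕ) :
    ∃ L', 1 ≤ L' ∧ ∀ (i : ι) {G : Type*} {M : G → ℝ} {pt : ℕ → G → ℝ} {Rt : ℕ → G → G},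
      Regenerative M pt Rt ε →
      (∀ n g, M g - ∑ t ∈ Finset.range n, pt t g ≤ M g * r₀ i L n) →
      ∀ g₁ : G, M g₁ = 1 → ∀ I : Finset ℕ, (∀ k ∈ I, 0 < k ∧ k ≤ N) → I.gcd id = 1 →
      (∀ k ∈ I, δ ≤ pt (k - 1) g₁) →
      ∀ (ev : ℕ → G → ℝ) (B : ℝ), 0 ≤ B → (∀ n, |ev n g₁| ≤ B) →
      (∀ n g, |ev n g - ∑ t ∈ Finset.range n,
        (ev (n - 1 - t) (Rt t g) + ε * pt t g * ev (n - 1 - t) g₁)| ≤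
          B * (M g - ∑ t ∈ Finset.range n, pt t g)) →
      ∃ w : ℝ, |w| ≤ B ∧ ∀ n g, |ev n g - M g * w| ≤ B * M g * r₁ i L' n := by
  obtain ⟨L₁, hL₁, hsolve⟩ := hr.fst.solve_mul hL (show 0 ≤ 1 - ε by linarith)
    (show 1 - ε < 1 by linarith)
  obtain ⟨L₂, hL₂, hdiff⟩ := exists_abs_sub_le_of_renewal hr hL₁ (mul_pos hε hδ)
    (mul_le_one₀ hε1.le hδ.le hδ1) N
  obtain ⟨L₃, hL₃, hhalf⟩ := hr.snd.half L₂ hL₂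
  obtain ⟨L₄, hL₄, hfs⟩ := hr.exists_fst_le hL₁
  obtain ⟨L₅, hL₅, hhalf'⟩ := hr.snd.half L₄ hL₄
  set L₆ := max L₃ (max L₄ L₅) with hL₆d
  have hL₆ : 1 ≤ L₆ := le_max_of_le_left hL₃
  obtain ⟨L₇, hL₇, hsc⟩ := hr.snd.scale L₆ hL₆ 5
  refine ⟨L₇, hL₇, fun i G M pt Rt hR htail g₁ hg₁ I hI hIg hIδ ev B hB hevB hev => ?_⟩
  -- the tail of the first regeneration time
  have hS : ∀ n g, survival M pt Rt n g ≤ M g * r₀ i L₁ n := by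
    intro n
    induction n using Nat.strong_induction_on with
    | _ n ih =>
    intro g
    rw [survival_eq]
    refine le_trans (add_le_add (htail n g) ?_) (hsolve i n (fun t => (1 - ε) * pt t g) (M g)
      (hR.mass_nonneg g) (fun t => mul_nonneg (by linarith) (hR.nonneg t g)) ?_ ?_)
    · refine Finset.sum_le_sum fun t ht => ?_
      have := Finset.mem_range.1 ht
      have h1 := ih (n - 1 - t) (by omega) (Rt t g)
      have h2 := survival_le hR (n - 1 - t) (Rt t g)
      rw [hR.mass_rest] at h1 h2
      rw [mul_min_of_nonneg _ _ (mul_nonneg (by linarith) (hR.nonneg t g)), mul_one]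
      exact le_min h2 h1
    · rw [← Finset.mul_sum]
      exact mul_le_mul_of_nonneg_left (hR.sum_le n g) (by linarith)
    · intro s hs
      rw [← Finset.mul_sum]
      have h1 := hR.sum_le n g
      rw [Finset.range_eq_Ico, ← Finset.sum_Ico_consecutive _ (Nat.zero_le s) hs,
        ← Finset.range_eq_Ico] at h1
      have h2 := htail s g
      have h3 : 0 ≤ ∑ t ∈ Finset.Ico s n, pt t g := Finset.sum_nonneg fun t _ => hR.nonneg t g
      nlinarith
  set p : ℕ → ℝ := fun t => regeneration M pt Rt t g₁ with hp
  have hpsum : ∀ n, ∑ t ∈ Finset.range n, p t = 1 - survival M pt Rt n g₁ := fun n => by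
    rw [← hg₁]; exact sum_regeneration M pt Rt n g₁
  have hW : WaitingLaw r₀ i L₁ (ε * δ) N p :=
    { nonneg := fun t => regeneration_nonneg hR t g₁
      sum_le := fun n => by rw [hpsum]; linarith [survival_nonneg hR n g₁]
      tail := fun n => by
        rw [hpsum]
        have := hS n g₁
        rw [hg₁] at this
        linarith
      aperiodic := ⟨I, hI, hIg, fun k hk =>
        (mul_le_mul_of_nonneg_left (hIδ k hk) hε.le).trans (le_regeneration hR _ _)⟩ }
  have hmain := fun n g => abs_sub_regeneration_le (w := fun n => ev n g₁) hR hev n g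
  have hd := hdiff i p hW (fun n => ev n g₁) B hB fun n => by
    rw [hpsum, sub_sub_cancel]; exact hmain n g₁
  -- the limit
  have hcau : CauchySeq fun n => ev n g₁ := by
    rw [Metric.cauchySeq_iff']
    intro η hη
    obtain ⟨n, hn⟩ := hr.snd.small L₂ hL₂ (η / (2 * (B + 1))) (by positivity)
    refine ⟨n, fun m hm => ?_⟩
    obtain ⟨d, rfl⟩ := Nat.exists_eq_add_of_le hm
    rw [dist_comm, Real.dist_eq]
    calc |ev n g₁ - ev (n + d) g₁| ≤ B * (η / (2 * (B + 1))) :=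
          (hd n d).trans (mul_le_mul_of_nonneg_left (hn i) hB)
      _ < η := by
          rw [mul_div_assoc', div_lt_iff₀ (by positivity)]
          nlinarith
  obtain ⟨w, hw⟩ := cauchySeq_tendsto_of_complete hcau
  have hwB : |w| ≤ B := le_of_tendsto hw.abs (Filter.Eventually.of_forall hevB)
  have hwn : ∀ n, |ev n g₁ - w| ≤ B * r₁ i L₂ n := fun n => by
    have h1 : Filter.Tendsto (fun d => |ev n g₁ - ev (n + d) g₁|) Filter.atTop
        (nhds |ev n g₁ - w|) := by
      refine (Filter.Tendsto.const_sub _ ?_).abs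
      have := (Filter.tendsto_add_atTop_iff_nat (f := fun n => ev n g₁) n).2 hw
      simpa [add_comm] using this
    exact le_of_tendsto h1 (Filter.Eventually.of_forall (hd n))
  refine ⟨w, hwB, fun n g => ?_⟩
  have hM := hR.mass_nonneg g
  set q : ℕ → ℝ := fun t => regeneration M pt Rt t g with hq
  have hq0 : ∀ t, 0 ≤ q t := fun t => regeneration_nonneg hR t g
  have hqs : ∀ n, ∑ t ∈ Finset.range n, q t = M g - survival M pt Rt n g :=
    fun n => sum_regeneration M pt Rt n g
  -- Error of the regeneration formula, error of `ev` after regeneration, and the mass that never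
  -- got there; their bounds contain `1`, `3` and `1` times `B * M g * r₁`, whence the factor `5`.
  have e1 : ev n g - M g * w =
      (ev n g - ∑ t ∈ Finset.range n, q t * ev (n - 1 - t) g₁) +
      ∑ t ∈ Finset.range n, q t * (ev (n - 1 - t) g₁ - w) - survival M pt Rt n g * w := by
    simp only [mul_sub, Finset.sum_sub_distrib]
    rw [← Finset.sum_mul, hqs]
    ring
  have e2 : ∑ t ∈ Finset.range n, q t * |ev (n - 1 - t) g₁ - w| ≤
      M g * (B * r₁ i L₂ (n / 2)) + survival M pt Rt (n / 2) g * (2 * B) := by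
    have key : ∀ t ∈ Finset.range n, q t * |ev (n - 1 - t) g₁ - w| ≤
        q t * (B * r₁ i L₂ (n / 2)) + (if n / 2 ≤ t then q t * (2 * B) else 0) := by
      intro t ht
      have htn := Finset.mem_range.1 ht
      have h0 : 0 ≤ B * r₁ i L₂ (n / 2) := mul_nonneg hB (hr.snd.nonneg i _ _ hL₂)
      by_cases hc : n / 2 ≤ t
      · rw [if_pos hc]
        have h1 : |ev (n - 1 - t) g₁ - w| ≤ 2 * B :=
          (abs_sub _ _).trans (by linarith [hevB (n - 1 - t)])
        have h2 := mul_le_mul_of_nonneg_left h1 (hq0 t)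
        have h3 := mul_nonneg (hq0 t) h0
        linarith
      · rw [if_neg hc, add_zero]
        refine mul_le_mul_of_nonneg_left ((hwn _).trans (mul_le_mul_of_nonneg_left ?_ hB)) (hq0 t)
        exact hr.snd.anti i L₂ hL₂ (by omega)
    refine (Finset.sum_le_sum key).trans ?_
    rw [Finset.sum_add_distrib, ← Finset.sum_mul, ← Finset.sum_filter, ← Finset.sum_mul]
    have hfil : (Finset.range n).filter (fun t => n / 2 ≤ t) = Finset.Ico (n / 2) n := by
      ext t; simp [and_comm]
    rw [hfil]
    have h1 := hqs n
    have h4 := h1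
    rw [Finset.range_eq_Ico, ← Finset.sum_Ico_consecutive _ (Nat.zero_le (n / 2)) (by omega),
        ← Finset.range_eq_Ico, hqs] at h1
    have h2 := survival_nonneg hR n g
    have h3 : 0 ≤ B * r₁ i L₂ (n / 2) := mul_nonneg hB (hr.snd.nonneg i _ _ hL₂)
    refine add_le_add (mul_le_mul_of_nonneg_right (by linarith) h3)
      (mul_le_mul_of_nonneg_right (by linarith) (by linarith))
  have f1 : r₁ i L₂ (n / 2) ≤ r₁ i L₆ n :=
    (hhalf i n).trans (hr.snd.mono i _ _ n hL₃ (le_max_left _ _))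
  have f2 : survival M pt Rt n g ≤ M g * r₁ i L₆ n := by
    refine (hS n g).trans (mul_le_mul_of_nonneg_left ?_ hM)
    exact (hfs i n).trans (hr.snd.mono i _ _ n hL₄ ((le_max_left _ _).trans (le_max_right _ _)))
  have f3 : survival M pt Rt (n / 2) g ≤ M g * r₁ i L₆ n := by
    refine (hS _ g).trans (mul_le_mul_of_nonneg_left ?_ hM)
    exact ((hfs i _).trans (hhalf' i n)).trans
      (hr.snd.mono i _ _ n hL₅ ((le_max_right _ _).trans (le_max_right _ _)))
  have f4 : |ev n g - ∑ t ∈ Finset.range n, q t * ev (n - 1 - t) g₁| ≤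
      B * (M g * r₁ i L₆ n) := (hmain n g).trans (mul_le_mul_of_nonneg_left f2 hB)
  have f5 : |∑ t ∈ Finset.range n, q t * (ev (n - 1 - t) g₁ - w)| ≤
      M g * (B * r₁ i L₆ n) + (M g * r₁ i L₆ n) * (2 * B) := by
    refine (Finset.abs_sum_le_sum_abs _ _).trans (le_trans (le_of_eq ?_) (e2.trans ?_))
    · exact Finset.sum_congr rfl fun t _ => by rw [abs_mul, abs_of_nonneg (hq0 t)]
    · gcongr
  have f6 : |survival M pt Rt n g * w| ≤ (M g * r₁ i L₆ n) * B := by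
    rw [abs_mul, abs_of_nonneg (survival_nonneg hR n g)]
    exact mul_le_mul f2 hwB (abs_nonneg _) (mul_nonneg hM (hr.snd.nonneg i _ _ hL₆))
  rw [e1]
  refine (abs_sub _ _).trans ((add_le_add ((abs_add_le _ _).trans (add_le_add f4 f5)) f6).trans ?_)
  calc _ = B * M g * (5 * r₁ i L₆ n) := by ring
    _ ≤ _ := mul_le_mul_of_nonneg_left (hsc i n) (mul_nonneg hB hM)


/-! ### Full-branch expanding systems and their transfer operators -/

/-- A full-branch map `F` of a probability space: `sym x` is the branch that contains `x`, `br a` is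
the inverse of the branch `a`, and `J a` is the Jacobian of `br a`. -/
structure FullBranchMap (X A : Type*) [MeasurableSpace X] where
  F : X → X
  sym : X → A
  br : A → X → X
  J : A → X → ℝ
  m : Measure X
  prob : IsProbabilityMeasure m
  measurable_F : Measurable F
  measurableSet_sym : ∀ a, MeasurableSet (sym ⁻¹' {a})
  measurable_br : ∀ a, Measurable (br a)
  measurable_J : ∀ a, Measurable (J a)
  J_pos : ∀ a x, 0 < J a x
  sym_br : ∀ a x, sym (br a x) = a
  F_br : ∀ a x, F (br a x) = x
  lintegral_branch : ∀ a (u : X → ℝ≥0∞), Measurable u →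
    ∫⁻ x in sym ⁻¹' {a}, u x ∂m = ∫⁻ x, ENNReal.ofReal (J a x) * u (br a x) ∂m

theorem integrable_of_abs_le {X : Type*} [MeasurableSpace X] {m : Measure X} [IsFiniteMeasure m]
    {f : X → ℝ} (hf : Measurable f) {C : ℝ} (h : ∀ x, |f x| ≤ C) : Integrable f m :=
  Integrable.of_bound hf.aestronglyMeasurable C (Filter.Eventually.of_forall h)

namespace FullBranchMap

variable {X A : Type*} [MeasurableSpace X] (S : FullBranchMap X A)

instance : IsProbabilityMeasure S.m := S.prob

theorem nonempty {X A : Type*} [MeasurableSpace X] (S : FullBranchMap X A) : Nonempty X := Measure.nonempty_of_neZero S.m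

/-- The first `n` symbols of `x` and `y` agree. -/
def Agree (n : ℕ) (x y : X) : Prop := ∀ i < n, S.sym (S.F^[i] x) = S.sym (S.F^[i] y)

/-- Bounded distortion of the Jacobian. -/
def Distortion (θ K : ℝ) : Prop :=
  ∀ a n x y, S.Agree n x y → S.J a x ≤ Real.exp (K * θ ^ n) * S.J a y

variable {S} {θ K : ℝ}

theorem Agree.mono {n k : ℕ} {x y : X} (h : S.Agree n x y) (hk : k ≤ n) : S.Agree k x y :=
  fun i hi => h i (hi.trans_le hk)

theorem Agree.symm {n : ℕ} {x y : X} (h : S.Agree n x y) : S.Agree n y x :=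
  fun i hi => (h i hi).symm

theorem Agree.trans {n : ℕ} {x y z : X} (h : S.Agree n x y) (h' : S.Agree n y z) :
    S.Agree n x z := fun i hi => (h i hi).trans (h' i hi)

theorem agree_zero (x y : X) : S.Agree 0 x y := fun _ h => absurd h (Nat.not_lt_zero _)

theorem agree_succ {n : ℕ} {x y : X} :
    S.Agree (n + 1) x y ↔ S.sym x = S.sym y ∧ S.Agree n (S.F x) (S.F y) := by
  constructor
  · intro h
    refine ⟨h 0 (Nat.succ_pos _), fun i hi => ?_⟩
    have := h (i + 1) (by omega)
    rwa [Function.iterate_succ_apply, Function.iterate_succ_apply] at this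
  · rintro ⟨h0, h⟩ i hi
    cases i with
    | zero => exact h0
    | succ i =>
      rw [Function.iterate_succ_apply, Function.iterate_succ_apply]
      exact h i (by omega)

theorem Agree.br {n : ℕ} {x y : X} (h : S.Agree n x y) (a : A) :
    S.Agree (n + 1) (S.br a x) (S.br a y) :=
  agree_succ.2 ⟨by rw [S.sym_br, S.sym_br], by rwa [S.F_br, S.F_br]⟩

theorem restrict_sym (a : A) : S.m.restrict (S.sym ⁻¹' {a}) =
    (S.m.withDensity fun x => ENNReal.ofReal (S.J a x)).map (S.br a) := by
  refine Measure.ext_of_lintegral _ fun u hu => ?_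
  rw [S.lintegral_branch a u hu, lintegral_map hu (S.measurable_br a),
    lintegral_withDensity_eq_lintegral_mul _ (S.measurable_J a).ennreal_ofReal
      (g := fun x => u (S.br a x)) (hu.comp (S.measurable_br a))]
  rfl

theorem setIntegral_sym (a : A) {f : X → ℝ} (hf : Measurable f) :
    ∫ x in S.sym ⁻¹' {a}, f x ∂S.m = ∫ x, S.J a x * f (S.br a x) ∂S.m := by
  rw [restrict_sym, integral_map (S.measurable_br a).aemeasurable hf.aestronglyMeasurable,
    integral_withDensity_eq_integral_toReal_smul (S.measurable_J a).ennreal_ofReal (by simp)]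
  refine integral_congr_ae (Filter.Eventually.of_forall fun x => ?_)
  simp [ENNReal.toReal_ofReal (S.J_pos a x).le]

theorem integral_J (a : A) : ∫ x, S.J a x ∂S.m = S.m.real (S.sym ⁻¹' {a}) := by
  have := setIntegral_sym (S := S) a (f := fun _ => 1) measurable_const
  simpa using this.symm

theorem pairwise_disjoint_sym : Pairwise (Function.onFun Disjoint fun a : A => S.sym ⁻¹' {a}) := by
  intro a b hab
  refine Disjoint.preimage _ ?_
  simpa using hab

theorem iUnion_sym : ⋃ a, S.sym ⁻¹' {a} = univ := by
  ext x; simp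

theorem summable_measureReal_sym [Countable A] : Summable fun a => S.m.real (S.sym ⁻¹' {a}) := by
  refine ENNReal.summable_toReal ?_
  rw [← measure_iUnion pairwise_disjoint_sym S.measurableSet_sym, iUnion_sym]
  exact measure_ne_top _ _

/-- Distortion at depth `0` compares all values of `J a`, whose mean is the measure of the branch
domain. This is the summable bound behind all series over branches. -/
theorem J_le (hJ : S.Distortion θ K) (a : A) (x : X) :
    S.J a x ≤ Real.exp K * S.m.real (S.sym ⁻¹' {a}) := by
  have h : ∀ y z, S.J a y ≤ Real.exp K * S.J a z := fun y z => by
    simpa using hJ a 0 y z (agree_zero y z)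
  have hint : Integrable (S.J a) S.m := integrable_of_abs_le (S.measurable_J a)
    (C := Real.exp K * S.J a x) fun y => by rw [abs_of_pos (S.J_pos a y)]; exact h y x
  rw [← integral_J, ← integral_const_mul]
  have := integral_mono (integrable_const (S.J a x)) (hint.const_mul (Real.exp K)) fun y => h x y
  simpa using this

theorem integrable_J (hJ : S.Distortion θ K) (a : A) : Integrable (S.J a) S.m :=
  integrable_of_abs_le (S.measurable_J a) fun y => by
    rw [abs_of_pos (S.J_pos a y)]; exact J_le hJ a y

theorem summable_J_mul [Countable A] (hJ : S.Distortion θ K) {g : X → ℝ} {C : ℝ} (hg : ∀ x, |g x| ≤ C) (x : X) :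
    Summable fun a => S.J a x * g (S.br a x) := by
  refine Summable.of_norm_bounded
    ((summable_measureReal_sym (S := S)).mul_left (Real.exp K * C)) fun a => ?_
  rw [Real.norm_eq_abs, abs_mul, abs_of_pos (S.J_pos a x)]
  calc S.J a x * |g (S.br a x)| ≤ (Real.exp K * S.m.real (S.sym ⁻¹' {a})) * C :=
        mul_le_mul (J_le hJ a x) (hg _) (abs_nonneg _) (by positivity)
    _ = _ := by ring

variable (S) in
/-- The transfer operator of `F`. -/
noncomputable def transfer (g : X → ℝ) (x : X) : ℝ := ∑' a, S.J a x * g (S.br a x)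

theorem measurable_transfer [Countable A] (hJ : S.Distortion θ K) {g : X → ℝ} (hgm : Measurable g) {C : ℝ}
    (hg : ∀ x, |g x| ≤ C) : Measurable (S.transfer g) := by
  refine measurable_of_tendsto_metrizable' (Filter.atTop : Filter (Finset A))
    (f := fun s x => ∑ a ∈ s, S.J a x * g (S.br a x)) (fun s => ?_) ?_
  · exact Finset.measurable_sum s fun a _ => (S.measurable_J a).mul (hgm.comp (S.measurable_br a))
  · exact tendsto_pi_nhds.2 fun x => (summable_J_mul hJ hg x).hasSum

theorem transfer_nonneg {g : X → ℝ} (hg : ∀ x, 0 ≤ g x) (x : X) : 0 ≤ S.transfer g x :=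
  tsum_nonneg fun a => mul_nonneg (S.J_pos a x).le (hg _)

theorem transfer_le [Countable A] (hJ : S.Distortion θ K) {g : X → ℝ} {C : ℝ} (hg : ∀ x, |g x| ≤ C) {x y : X}
    {c : ℝ} (h : ∀ a, S.J a x * g (S.br a x) ≤ c * (S.J a y * g (S.br a y))) :
    S.transfer g x ≤ c * S.transfer g y := by
  unfold transfer
  rw [← tsum_mul_left]
  exact (summable_J_mul hJ hg x).tsum_le_tsum h ((summable_J_mul hJ hg y).mul_left c)

/-- Duality with composition by `F`: change variables on each branch and sum, using `J_le` to
exchange sum and integral. -/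
theorem integral_transfer_mul [Countable A] (hJ : S.Distortion θ K) {g W : X → ℝ} (hgm : Measurable g)
    (hWm : Measurable W) {C B : ℝ} (hg : ∀ x, |g x| ≤ C) (hW : ∀ x, |W x| ≤ B) :
    ∫ x, S.transfer g x * W x ∂S.m = ∫ x, g x * W (S.F x) ∂S.m := by
  obtain ⟨x₀⟩ : Nonempty X := S.nonempty
  have hC : 0 ≤ C := (abs_nonneg _).trans (hg x₀)
  have hB : 0 ≤ B := (abs_nonneg _).trans (hW x₀)
  have hfm : Measurable fun x => g x * W (S.F x) := hgm.mul (hWm.comp S.measurable_F)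
  have hfi : Integrable (fun x => g x * W (S.F x)) S.m := integrable_of_abs_le hfm (C := C * B)
    fun x => by rw [abs_mul]; exact mul_le_mul (hg _) (hW _) (abs_nonneg _) hC
  have h1 : HasSum (fun a => ∫ x in S.sym ⁻¹' {a}, g x * W (S.F x) ∂S.m)
      (∫ x, g x * W (S.F x) ∂S.m) := by
    have := hasSum_integral_iUnion (μ := S.m) S.measurableSet_sym pairwise_disjoint_sym
      (f := fun x => g x * W (S.F x)) hfi.integrableOn
    rwa [iUnion_sym, setIntegral_univ] at this
  have hbd : ∀ a x, |S.J a x * g (S.br a x) * W x| ≤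
      Real.exp K * C * B * S.m.real (S.sym ⁻¹' {a}) := fun a x => by
    rw [abs_mul, abs_mul, abs_of_pos (S.J_pos a x)]
    calc S.J a x * |g (S.br a x)| * |W x| ≤ (Real.exp K * S.m.real (S.sym ⁻¹' {a})) * C * B := by
          have := J_le hJ a x
          gcongr
          exacts [hg _, hW _]
      _ = _ := by ring
  have hm : ∀ a, Measurable fun x => S.J a x * g (S.br a x) * W x := fun a =>
    ((S.measurable_J a).mul (hgm.comp (S.measurable_br a))).mul hWm
  have hi : ∀ a, Integrable (fun x => S.J a x * g (S.br a x) * W x) S.m := fun a =>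
    integrable_of_abs_le (hm a) (hbd a)
  have h2 : HasSum (fun a => ∫ x, S.J a x * g (S.br a x) * W x ∂S.m)
      (∫ x, ∑' a, S.J a x * g (S.br a x) * W x ∂S.m) := by
    refine hasSum_integral_of_summable_integral_norm hi ?_
    refine Summable.of_nonneg_of_le (fun a => integral_nonneg fun x => norm_nonneg _) (fun a => ?_)
      ((summable_measureReal_sym (S := S)).mul_left (Real.exp K * C * B))
    have := integral_mono (hi a).norm (integrable_const _) (hbd a)
    simpa using this
  have h3 : (fun a => ∫ x in S.sym ⁻¹' {a}, g x * W (S.F x) ∂S.m) =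
      fun a => ∫ x, S.J a x * g (S.br a x) * W x ∂S.m := by
    funext a
    rw [setIntegral_sym a hfm]
    refine integral_congr_ae (Filter.Eventually.of_forall fun x => ?_)
    simp only [S.F_br, mul_assoc]
  rw [h3] at h1
  rw [h1.unique h2]
  refine integral_congr_ae (Filter.Eventually.of_forall fun x => ?_)
  simp only [transfer, tsum_mul_right]

/-! ### Densities with a log-Lipschitz bound -/

variable (S) in
/-- Nonnegative densities whose logarithm is Lipschitz with constant `R` in the symbolic metric. -/
structure Cone (θ R : ℝ) (g : X → ℝ) : Prop where
  nonneg : ∀ x, 0 ≤ g x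
  measurable : Measurable g
  regular : ∀ n x y, S.Agree n x y → g x ≤ Real.exp (R * θ ^ n) * g y

namespace Cone

variable {R R' : ℝ} {g : X → ℝ}

theorem le_exp_mul (hg : S.Cone θ R g) (x y : X) : g x ≤ Real.exp R * g y := by
  simpa using hg.regular 0 x y (agree_zero x y)

theorem exists_bound (hg : S.Cone θ R g) : ∃ C, ∀ x, |g x| ≤ C := by
  obtain ⟨x₀⟩ : Nonempty X := S.nonempty
  exact ⟨_, fun x => by rw [abs_of_nonneg (hg.nonneg x)]; exact hg.le_exp_mul x x₀⟩

theorem integrable (hg : S.Cone θ R g) : Integrable g S.m := by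
  obtain ⟨C, hC⟩ := hg.exists_bound
  exact integrable_of_abs_le hg.measurable hC

theorem integral_nonneg (hg : S.Cone θ R g) : 0 ≤ ∫ x, g x ∂S.m :=
  MeasureTheory.integral_nonneg hg.nonneg

theorem le_integral (hg : S.Cone θ R g) (x : X) : g x ≤ Real.exp R * ∫ y, g y ∂S.m := by
  rw [← integral_const_mul]
  have := integral_mono (integrable_const (g x)) (hg.integrable.const_mul (Real.exp R))
    fun y => hg.le_exp_mul x y
  simpa using this

theorem integral_le (hg : S.Cone θ R g) (y : X) : ∫ x, g x ∂S.m ≤ Real.exp R * g y := by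
  have := integral_mono hg.integrable (integrable_const (Real.exp R * g y))
    fun x => hg.le_exp_mul x y
  simpa using this

theorem mono (hg : S.Cone θ R g) (hθ : 0 ≤ θ) (h : R ≤ R') : S.Cone θ R' g where
  nonneg := hg.nonneg
  measurable := hg.measurable
  regular n x y hxy := (hg.regular n x y hxy).trans <| by
    have := hg.nonneg y
    gcongr

theorem one (hθ : 0 ≤ θ) (hR : 0 ≤ R) : S.Cone θ R fun _ => 1 where
  nonneg _ := zero_le_one
  measurable := measurable_const
  regular n x y _ := by
    rw [mul_one]
    exact Real.one_le_exp (by positivity)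

/-- A fixed proportion of the mass can be subtracted at the cost of enlarging the constant. -/
theorem sub_const (hg : S.Cone θ R' g) (hθ : 0 ≤ θ) (hθ1 : θ ≤ 1) (hR' : 0 ≤ R') (hRR : R' < R) :
    S.Cone θ R fun x => g x -
      Real.exp (-R') * ((R - R') / (R * Real.exp R)) * ∫ y, g y ∂S.m := by
  have hR : 0 < R := by linarith
  -- Regularity of `g - c` amounts to `c (e^(Rs) - 1) ≤ g y (e^(Rs) - e^(R's))` with `s = θ ^ n ≤
  -- 1`. The quotient of the two brackets is at least `(R - R') / (R e^R)`, and `g y` is at least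
  -- `e^(-R') ∫ g`.
  set c := Real.exp (-R') * ((R - R') / (R * Real.exp R)) * ∫ y, g y ∂S.m with hc
  have hc1 : ∀ y, c ≤ (R - R') / (R * Real.exp R) * g y := fun y => by
    have h1 := hg.integral_le y
    have h2 : 0 ≤ Real.exp (-R') * ((R - R') / (R * Real.exp R)) := by
      have : 0 ≤ R - R' := by linarith
      positivity
    calc c ≤ Real.exp (-R') * ((R - R') / (R * Real.exp R)) * (Real.exp R' * g y) :=
          mul_le_mul_of_nonneg_left h1 h2
      _ = (Real.exp (-R') * Real.exp R') * ((R - R') / (R * Real.exp R) * g y) := by ring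
      _ = _ := by rw [← Real.exp_add]; simp
  refine ⟨fun x => ?_, hg.measurable.sub_const _, fun n x y hxy => ?_⟩
  · have h1 := hc1 x
    have h2 : (R - R') / (R * Real.exp R) ≤ 1 := by
      rw [div_le_one (by positivity)]
      have := Real.add_one_le_exp R
      nlinarith
    have := mul_le_of_le_one_left (hg.nonneg x) h2
    linarith
  · have h1 := hg.regular n x y hxy
    set s := θ ^ n with hs
    have hs0 : 0 ≤ s := by positivity
    have hs1 : s ≤ 1 := pow_le_one₀ hθ hθ1
    have h2 : (R - R') * s ≤ Real.exp (R * s) - Real.exp (R' * s) := by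
      have e1 : Real.exp (R * s) = Real.exp (R' * s) * Real.exp ((R - R') * s) := by
        rw [← Real.exp_add]; ring_nf
      have e2 := Real.add_one_le_exp ((R - R') * s)
      have e3 : 1 ≤ Real.exp (R' * s) := Real.one_le_exp (by positivity)
      have e4 : 0 ≤ (R - R') * s := mul_nonneg (by linarith) hs0
      rw [e1]
      nlinarith
    have h3 : Real.exp (R * s) - 1 ≤ R * s * Real.exp R := by
      have e1 := Real.add_one_le_exp (-(R * s))
      rw [Real.exp_neg] at e1
      have hp := Real.exp_pos (R * s)
      have e2 := mul_le_mul_of_nonneg_right e1 hp.le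
      rw [inv_mul_cancel₀ hp.ne'] at e2
      have e3 : Real.exp (R * s) ≤ Real.exp R := Real.exp_le_exp.2 (by nlinarith)
      have e4 : R * s * Real.exp (R * s) ≤ R * s * Real.exp R := by gcongr
      linarith
    have h4 : c * (Real.exp (R * s) - 1) ≤ g y * (Real.exp (R * s) - Real.exp (R' * s)) := by
      have e0 : 0 ≤ Real.exp (R * s) - 1 := by
        have := Real.one_le_exp (show 0 ≤ R * s by positivity); linarith
      have hgy := hg.nonneg y
      calc c * (Real.exp (R * s) - 1) ≤
            ((R - R') / (R * Real.exp R) * g y) * (Real.exp (R * s) - 1) :=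
              mul_le_mul_of_nonneg_right (hc1 y) e0
        _ ≤ ((R - R') / (R * Real.exp R) * g y) * (R * s * Real.exp R) := by
              refine mul_le_mul_of_nonneg_left h3 (mul_nonneg (div_nonneg ?_ ?_) hgy)
              · linarith
              · positivity
        _ = g y * ((R - R') * s) := by field_simp
        _ ≤ _ := mul_le_mul_of_nonneg_left h2 hgy
    nlinarith

end Cone

end FullBranchMap


/-- A sequence of functions on the base of the tower that comes from iterating a function on the
tower, up to the factor `c` at each return. -/
def IsTowerSeq {X : Type*} (F : X → X) (ret : X → ℕ) (c : ℝ) (U : ℕ → X → ℝ) : Prop :=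
  ∀ n x, ret x ≤ n → U n x = c * U (n - ret x) (F x)

namespace FullBranchMap

section Return

variable {X A : Type*} [MeasurableSpace X] {S : FullBranchMap X A} {θ K R : ℝ}
  {τ : A → ℕ}

/-- The part of the density `g` that returns at time `t + 1`, pushed forward by `F`. -/
noncomputable def pushReturn (S : FullBranchMap X A) (τ : A → ℕ) (t : ℕ) (g : X → ℝ) : X → ℝ :=
  S.transfer fun x => if τ (S.sym x) = t + 1 then g x else 0

theorem abs_ite_return_le {t : ℕ} {g : X → ℝ} {C : ℝ} (hg : ∀ x, |g x| ≤ C) (x : X) :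
    |if τ (S.sym x) = t + 1 then g x else 0| ≤ C := by
  split_ifs
  · exact hg x
  · simpa using (abs_nonneg _).trans (hg x)

theorem pushReturn_nonneg (t : ℕ) {g : X → ℝ} (hg : ∀ x, 0 ≤ g x) (x : X) :
    0 ≤ S.pushReturn τ t g x := by
  refine transfer_nonneg (fun x => ?_) x
  split_ifs
  exacts [hg x, le_rfl]

theorem sum_ite_return (hτ : ∀ a, 1 ≤ τ a) (n : ℕ) (x : X) (c : ℝ) :
    ∑ t ∈ Finset.range n, (if τ (S.sym x) = t + 1 then c else 0) =
      if τ (S.sym x) ≤ n then c else 0 := by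
  obtain ⟨k, hk⟩ : ∃ k, τ (S.sym x) = k + 1 := ⟨τ (S.sym x) - 1, by have := hτ (S.sym x); omega⟩
  simp [hk]

variable [Countable A]

theorem measurable_comp_sym {β : Type*} [MeasurableSpace β] (S : FullBranchMap X A) (f : A → β) :
    Measurable fun x => f (S.sym x) := by
  let _ : MeasurableSpace A := ⊤
  have hs : Measurable S.sym := measurable_to_countable' fun a => S.measurableSet_sym a
  exact (measurable_from_top (f := f)).comp hs

theorem measurable_ite_return {t : ℕ} {g : X → ℝ} (hg : Measurable g) :
    Measurable fun x => if τ (S.sym x) = t + 1 then g x else 0 :=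
  Measurable.ite (measurableSet_eq_fun (S.measurable_comp_sym τ) measurable_const) hg
    measurable_const

theorem measurable_pushReturn (hJ : S.Distortion θ K) (t : ℕ) {g : X → ℝ} (hgm : Measurable g)
    {C : ℝ} (hg : ∀ x, |g x| ≤ C) : Measurable (S.pushReturn τ t g) :=
  measurable_transfer hJ (measurable_ite_return hgm) (abs_ite_return_le hg)

theorem integral_pushReturn_mul (hJ : S.Distortion θ K) (t : ℕ) {g W : X → ℝ} (hgm : Measurable g)
    (hWm : Measurable W) {C B : ℝ} (hg : ∀ x, |g x| ≤ C) (hW : ∀ x, |W x| ≤ B) :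
    ∫ x, S.pushReturn τ t g x * W x ∂S.m =
      ∫ x, (if τ (S.sym x) = t + 1 then g x * W (S.F x) else 0) ∂S.m := by
  rw [pushReturn, integral_transfer_mul hJ (measurable_ite_return hgm) hWm
    (abs_ite_return_le hg) hW]
  simp only [ite_mul, zero_mul]

theorem integral_pushReturn (hJ : S.Distortion θ K) (t : ℕ) {g : X → ℝ} (hgm : Measurable g)
    {C : ℝ} (hg : ∀ x, |g x| ≤ C) : ∫ x, S.pushReturn τ t g x ∂S.m =
      ∫ x, (if τ (S.sym x) = t + 1 then g x else 0) ∂S.m := by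
  have := integral_pushReturn_mul (τ := τ) hJ t hgm (W := fun _ => 1) measurable_const hg (B := 1)
    (by simp)
  simpa using this

theorem pushReturn_le (hJ : S.Distortion θ K) (t : ℕ) {g : X → ℝ} {C : ℝ} (hg : ∀ x, |g x| ≤ C)
    (hg0 : ∀ x, 0 ≤ g x) {x y : X} {n : ℕ} (hxy : S.Agree n x y) {c : ℝ}
    (h : ∀ a, τ a = t + 1 → g (S.br a x) ≤ Real.exp c * g (S.br a y)) :
    S.pushReturn τ t g x ≤ Real.exp (K * θ ^ n + c) * S.pushReturn τ t g y := by
  refine transfer_le hJ (abs_ite_return_le hg) fun a => ?_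
  simp only [S.sym_br]
  split_ifs with ha
  · calc S.J a x * g (S.br a x) ≤
          (Real.exp (K * θ ^ n) * S.J a y) * (Real.exp c * g (S.br a y)) :=
          mul_le_mul (hJ a n x y hxy) (h a ha) (hg0 _)
            (mul_nonneg (Real.exp_pos _).le (S.J_pos a y).le)
      _ = _ := by rw [Real.exp_add]; ring
  · simp

/-- An inverse branch lengthens agreement by one symbol, which multiplies the old constant by `θ`,
and its Jacobian adds `K`. -/
theorem Cone.pushReturn (hJ : S.Distortion θ K) {g : X → ℝ} (hg : S.Cone θ R g) (t : ℕ) :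
    S.Cone θ (K + θ * R) (S.pushReturn τ t g) := by
  obtain ⟨C, hC⟩ := hg.exists_bound
  refine ⟨pushReturn_nonneg t hg.nonneg, measurable_pushReturn hJ t hg.measurable hC,
    fun n x y hxy => ?_⟩
  have := pushReturn_le (τ := τ) hJ t hC hg.nonneg hxy (c := R * θ ^ (n + 1))
    fun a _ => hg.regular (n + 1) _ _ (hxy.br a)
  rwa [show K * θ ^ n + R * θ ^ (n + 1) = (K + θ * R) * θ ^ n by ring] at this

/-- Splitting an integral according to the return time. -/
theorem integral_eq_sum_return (hτ : ∀ a, 1 ≤ τ a) {f : X → ℝ} (hfm : Measurable f) {C : ℝ}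
    (hf : ∀ x, |f x| ≤ C) (n : ℕ) : ∫ x, f x ∂S.m =
      ∑ t ∈ Finset.range n, ∫ x, (if τ (S.sym x) = t + 1 then f x else 0) ∂S.m +
        ∫ x, (if n < τ (S.sym x) then f x else 0) ∂S.m := by
  have hi : ∀ t ∈ Finset.range n,
      Integrable (fun x => if τ (S.sym x) = t + 1 then f x else 0) S.m := fun t _ =>
    integrable_of_abs_le (measurable_ite_return hfm) (abs_ite_return_le hf)
  have hm : Measurable fun x => if n < τ (S.sym x) then f x else 0 :=
    Measurable.ite (measurableSet_lt measurable_const (S.measurable_comp_sym τ)) hfm measurable_const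
  have hi2 : Integrable (fun x => if n < τ (S.sym x) then f x else 0) S.m := by
    refine integrable_of_abs_le hm (C := C) fun x => ?_
    split_ifs
    · exact hf x
    · simpa using (abs_nonneg _).trans (hf x)
  rw [← integral_finsetSum _ hi, ← integral_add (integrable_finsetSum _ hi) hi2]
  refine integral_congr_ae (Filter.Eventually.of_forall fun x => ?_)
  simp only [sum_ite_return hτ]
  split_ifs with h1 h2 <;> first | omega | simp

theorem Cone.tail_le {g : X → ℝ} (hg : S.Cone θ R g) (n : ℕ) :
    ∫ x, (if n < τ (S.sym x) then g x else 0) ∂S.m ≤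
      (∫ x, g x ∂S.m) * (Real.exp R * S.m.real {x | n < τ (S.sym x)}) := by
  have hs : MeasurableSet {x | n < τ (S.sym x)} :=
    measurableSet_lt measurable_const (S.measurable_comp_sym τ)
  have h1 : ∀ x, (if n < τ (S.sym x) then g x else 0) ≤
      {x | n < τ (S.sym x)}.indicator (fun _ => Real.exp R * ∫ x, g x ∂S.m) x := fun x => by
    rw [indicator_apply]
    simp only [mem_ofPred_eq]
    split_ifs
    · exact hg.le_integral x
    · exact le_rfl
  have h2 := integral_mono_of_nonneg (μ := S.m)
    (Filter.Eventually.of_forall fun x => by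
      show (0 : ℝ) ≤ if n < τ (S.sym x) then g x else 0
      split_ifs
      exacts [hg.nonneg x, le_rfl]) ((integrable_const _).indicator hs)
    (Filter.Eventually.of_forall h1)
  rw [integral_indicator_const _ hs, smul_eq_mul] at h2
  linarith

end Return

/-- The states are the cone densities, their mass is the integral, and regeneration means splitting
off a multiple of the density `1`. Since `K + θ R < R`, the pushed density has room to lose this
part without leaving the cone. -/
theorem exists_base_decay {ι : Type} {r₀ r₁ : ι → ℝ → ℕ → ℝ} (hr : RatePair r₀ r₁)
    {L δ θ K R : ℝ} (hL : 1 ≤ L) (hδ : 0 < δ) (hδ1 : δ ≤ 1) (N : ℕ) (hθ : 0 ≤ θ) (hθ1 : θ ≤ 1)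
    (hK : 0 ≤ K) (hR : K + θ * R < R) (hR0 : 0 < R) :
    ∃ L', 1 ≤ L' ∧ ∀ (i : ι) {X A : Type*} [MeasurableSpace X] [Countable A]
      (S : FullBranchMap X A) (τ : A → ℕ), S.Distortion θ K → (∀ a, 1 ≤ τ a) →
      (∀ n, S.m.real {x | n < τ (S.sym x)} ≤ r₀ i L n) →
      ∀ I : Finset ℕ, (∀ k ∈ I, 0 < k ∧ k ≤ N) → I.gcd id = 1 →
      (∀ k ∈ I, δ ≤ S.m.real {x | τ (S.sym x) = k}) →
      ∀ (W : ℕ → X → ℝ) (B : ℝ), (∀ n, Measurable (W n)) → (∀ n x, |W n x| ≤ B) →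
      IsTowerSeq S.F (fun x => τ (S.sym x)) 1 W →
      ∃ w : ℝ, |w| ≤ B ∧ ∀ n g, S.Cone θ R g →
        |∫ x, g x * W n x ∂S.m - (∫ x, g x ∂S.m) * w| ≤ B * (∫ x, g x ∂S.m) * r₁ i L' n := by
  set R' := K + θ * R with hR'
  have hR'0 : 0 ≤ R' := by positivity
  set ε := Real.exp (-R') * ((R - R') / (R * Real.exp R)) with hε
  have hε0 : 0 < ε := by
    have : 0 < R - R' := by linarith
    positivity
  have hε1 : ε < 1 := by
    have h1 : Real.exp (-R') ≤ 1 := by simpa using hR'0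
    have h2 : (R - R') / (R * Real.exp R) < 1 := by
      rw [div_lt_one (by positivity)]
      have := Real.add_one_lt_exp hR0.ne'
      nlinarith
    have h3 : 0 ≤ (R - R') / (R * Real.exp R) := div_nonneg (by linarith) (by positivity)
    calc ε ≤ 1 * ((R - R') / (R * Real.exp R)) := mul_le_mul_of_nonneg_right h1 h3
      _ < 1 := by rwa [one_mul]
  obtain ⟨L₁, hL₁, hsc⟩ := hr.fst.scale L hL (Real.exp R)
  obtain ⟨L₂, hL₂, hreg⟩ := exists_regenerative_decay hr hL₁ hε0 hε1 hδ hδ1 N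
  refine ⟨L₂, hL₂, fun i X A _ _ S τ hJ hτ htail I hI hIg hIδ W B hWm hWB hW => ?_⟩
  obtain ⟨x₀⟩ : Nonempty X := S.nonempty
  have hB : 0 ≤ B := (abs_nonneg _).trans (hWB 0 x₀)
  let G := {g : X → ℝ // S.Cone θ R g}
  have hrest : ∀ (t : ℕ) (g : G), ∃ g' : G, ∀ x, g'.1 x = S.pushReturn τ t g.1 x -
      ε * ∫ y, S.pushReturn τ t g.1 y ∂S.m := fun t g =>
    ⟨⟨_, (g.2.pushReturn hJ t).sub_const hθ hθ1 hR'0 hR⟩, fun x => rfl⟩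
  choose Rt hRt using hrest
  set M : G → ℝ := fun g => ∫ x, g.1 x ∂S.m with hM
  set pt : ℕ → G → ℝ := fun t g => ∫ x, S.pushReturn τ t g.1 x ∂S.m with hpt
  have hpt' : ∀ t (g : G), pt t g = ∫ x, (if τ (S.sym x) = t + 1 then g.1 x else 0) ∂S.m := by
    intro t g
    obtain ⟨C, hC⟩ := g.2.exists_bound
    exact integral_pushReturn hJ t g.2.measurable hC
  have htailpt : ∀ n (g : G), M g - ∑ t ∈ Finset.range n, pt t g =
      ∫ x, (if n < τ (S.sym x) then g.1 x else 0) ∂S.m := by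
    intro n g
    obtain ⟨C, hC⟩ := g.2.exists_bound
    rw [hM]
    dsimp only
    rw [integral_eq_sum_return hτ g.2.measurable hC n,
      Finset.sum_congr rfl fun t _ => hpt' t g]
    ring
  have hite : ∀ (P : X → Prop) [DecidablePred P] (g : G) (x : X), 0 ≤ if P x then g.1 x else 0 := by
    intro P _ g x
    split_ifs
    exacts [g.2.nonneg x, le_rfl]
  have hRegen : Regenerative M pt Rt ε :=
    { pos := hε0
      mass_nonneg := fun g => g.2.integral_nonneg
      nonneg := fun t g => (g.2.pushReturn hJ t).integral_nonneg
      sum_le := fun n g => by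
        have := htailpt n g
        have h2 : 0 ≤ ∫ x, (if n < τ (S.sym x) then g.1 x else 0) ∂S.m :=
          integral_nonneg (hite _ g)
        linarith
      mass_rest := fun t g => by
        simp only [hM, hpt, hRt]
        rw [integral_sub (g.2.pushReturn hJ t).integrable (integrable_const _)]
        simp
        ring }
  let g₁ : G := ⟨fun _ => 1, Cone.one hθ hR0.le⟩
  have hbd : ∀ (g : G) n, ∃ C, ∀ x, |g.1 x * W n x| ≤ C := fun g n => by
    obtain ⟨C, hC⟩ := g.2.exists_bound
    refine ⟨C * B, fun x => ?_⟩
    rw [abs_mul]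
    exact mul_le_mul (hC x) (hWB n x) (abs_nonneg _) ((abs_nonneg _).trans (hC x))
  obtain ⟨w, hw, hdec⟩ := hreg i hRegen
    (fun n g => by
      rw [htailpt]
      refine (g.2.tail_le n).trans (mul_le_mul_of_nonneg_left ?_ g.2.integral_nonneg)
      exact (mul_le_mul_of_nonneg_left (htail n) (Real.exp_pos R).le).trans (hsc i n))
    g₁ (by simp [hM, g₁]) I hI hIg
    (fun k hk => by
      have hk0 := (hI k hk).1
      refine (hIδ k hk).trans (le_of_eq ?_)
      rw [hpt', Nat.sub_add_cancel hk0]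
      have hs : MeasurableSet {x | τ (S.sym x) = k} :=
        measurableSet_eq_fun (S.measurable_comp_sym τ) measurable_const
      rw [← integral_indicator_one hs]
      refine integral_congr_ae (Filter.Eventually.of_forall fun x => ?_)
      simp [indicator_apply, g₁])
    (fun n g => ∫ x, g.1 x * W n x ∂S.m) B hB
    (fun n => by
      simp only [g₁, one_mul]
      have := norm_integral_le_of_norm_le_const (μ := S.m) (f := W n) (C := B)
        (Filter.Eventually.of_forall fun x => hWB n x)
      simpa using this)
    (fun n g => by
      obtain ⟨C, hC⟩ := hbd g n
      obtain ⟨D, hD⟩ := g.2.exists_bound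
      -- A returning piece is its rest plus the regenerated constant; only the mass that has not
      -- returned by time `n` is missing from the one-return identity.
      have hterm : ∀ t ∈ Finset.range n,
          ∫ x, (if τ (S.sym x) = t + 1 then g.1 x * W n x else 0) ∂S.m =
          ∫ x, (Rt t g).1 x * W (n - 1 - t) x ∂S.m +
            ε * pt t g * ∫ x, g₁.1 x * W (n - 1 - t) x ∂S.m := by
        intro t ht
        have htn := Finset.mem_range.1 ht
        have h1 : ∫ x, (if τ (S.sym x) = t + 1 then g.1 x * W n x else 0) ∂S.m =
            ∫ x, S.pushReturn τ t g.1 x * W (n - 1 - t) x ∂S.m := by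
          rw [integral_pushReturn_mul hJ t g.2.measurable (hWm _) hD (hWB _)]
          refine integral_congr_ae (Filter.Eventually.of_forall fun x => ?_)
          dsimp only
          split_ifs with hx
          · rw [hW n x (by dsimp only; omega), one_mul]
            dsimp only
            rw [hx, show n - (t + 1) = n - 1 - t by omega]
          · rfl
        obtain ⟨C', hC'⟩ := hbd (Rt t g) (n - 1 - t)
        have h2 : Integrable (fun x => (Rt t g).1 x * W (n - 1 - t) x) S.m :=
          integrable_of_abs_le ((Rt t g).2.measurable.mul (hWm _)) hC'
        have h3 : Integrable (fun x => g₁.1 x * W (n - 1 - t) x) S.m := by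
          obtain ⟨C'', hC''⟩ := hbd g₁ (n - 1 - t)
          exact integrable_of_abs_le (g₁.2.measurable.mul (hWm _)) hC''
        rw [h1, ← integral_const_mul, ← integral_add h2 (h3.const_mul _)]
        refine integral_congr_ae (Filter.Eventually.of_forall fun x => ?_)
        simp only [hRt, g₁, hpt]
        ring
      rw [integral_eq_sum_return (f := fun x => g.1 x * W n x) hτ (g.2.measurable.mul (hWm n)) hC n, ← Finset.sum_congr rfl hterm,
        htailpt]
      rw [add_sub_cancel_left, ← integral_const_mul]
      refine abs_integral_le_integral_abs.trans ?_
      have hm : Measurable fun x => if n < τ (S.sym x) then g.1 x else 0 :=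
        Measurable.ite (measurableSet_lt measurable_const (S.measurable_comp_sym τ))
          g.2.measurable measurable_const
      have hi : Integrable (fun x => if n < τ (S.sym x) then g.1 x else 0) S.m := by
        refine integrable_of_abs_le hm (C := D) fun x => ?_
        split_ifs
        · exact hD x
        · simpa using (abs_nonneg _).trans (hD x)
      refine integral_mono_of_nonneg (Filter.Eventually.of_forall fun x => abs_nonneg _)
        (hi.const_mul B) (Filter.Eventually.of_forall fun x => ?_)
      dsimp only
      split_ifs
      · rw [abs_mul, abs_of_nonneg (g.2.nonneg x), mul_comm]
        exact mul_le_mul_of_nonneg_right (hWB n x) (g.2.nonneg x)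
      · simp)
  exact ⟨w, hw, fun n g hg => hdec n ⟨g, hg⟩⟩

end FullBranchMap


/-! ### Tower sequences -/

section Tower

variable {X : Type*}

/-- The sequence that equals `b n x` before the first return and is continued along the tower. -/
def towerLift {β : Type*} (F : X → X) (ret : X → ℕ) (b : ℕ → X → β) (n : ℕ) (x : X) : β :=
  if _h : 0 < ret x ∧ ret x ≤ n then towerLift F ret b (n - ret x) (F x) else b n x
termination_by n
decreasing_by omega

/-- The number of returns to the base up to time `n`. -/
def numReturns (F : X → X) (ret : X → ℕ) (n : ℕ) (x : X) : ℕ :=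
  if _h : 0 < ret x ∧ ret x ≤ n then numReturns F ret (n - ret x) (F x) + 1 else 0
termination_by n
decreasing_by omega

variable {F : X → X} {ret : X → ℕ}

theorem towerLift_of_lt {β : Type*} (b : ℕ → X → β) {n : ℕ} {x : X} (h : n < ret x) :
    towerLift F ret b n x = b n x := by
  rw [towerLift, dif_neg (by omega)]

theorem towerLift_of_le {β : Type*} (b : ℕ → X → β) (hret : ∀ x, 1 ≤ ret x) {n : ℕ} {x : X}
    (h : ret x ≤ n) : towerLift F ret b n x = towerLift F ret b (n - ret x) (F x) := by
  rw [towerLift, dif_pos ⟨hret x, h⟩]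

theorem numReturns_of_lt {n : ℕ} {x : X} (h : n < ret x) : numReturns F ret n x = 0 := by
  rw [numReturns, dif_neg (by omega)]

theorem numReturns_of_le (hret : ∀ x, 1 ≤ ret x) {n : ℕ} {x : X} (h : ret x ≤ n) :
    numReturns F ret n x = numReturns F ret (n - ret x) (F x) + 1 := by
  rw [numReturns, dif_pos ⟨hret x, h⟩]

theorem isTowerSeq_towerLift (hret : ∀ x, 1 ≤ ret x) (b : ℕ → X → ℝ) :
    IsTowerSeq F ret 1 (towerLift F ret b) := fun n x h => by
  rw [one_mul, towerLift_of_le b hret h]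

theorem isTowerSeq_pow_numReturns (hret : ∀ x, 1 ≤ ret x) (ρ : ℝ) :
    IsTowerSeq F ret ρ fun n x => ρ ^ numReturns F ret n x := fun n x h => by
  simp only
  rw [numReturns_of_le hret h, pow_succ']

theorem towerLift_mem {β : Type*} (hret : ∀ x, 1 ≤ ret x) {b : ℕ → X → β} {s : Set β}
    (h : ∀ n x, n < ret x → b n x ∈ s) (n : ℕ) (x : X) : towerLift F ret b n x ∈ s := by
  induction n using Nat.strong_induction_on generalizing x with
  | _ n ih =>
  rcases lt_or_ge n (ret x) with hn | hn
  · rw [towerLift_of_lt b hn]; exact h n x hn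
  · rw [towerLift_of_le b hret hn]
    exact ih _ (by have := hret x; omega) _

theorem numReturns_le (hret : ∀ x, 1 ≤ ret x) (n : ℕ) (x : X) : numReturns F ret n x ≤ n := by
  induction n using Nat.strong_induction_on generalizing x with
  | _ n ih =>
  rcases lt_or_ge n (ret x) with hn | hn
  · rw [numReturns_of_lt hn]; exact Nat.zero_le _
  · rw [numReturns_of_le hret hn]
    have h1 := hret x
    have := ih (n - ret x) (by omega) (F x)
    omega

/-- The sum of a sequence of functions over the levels of the tower. -/
def towerSum (ret : X → ℕ) (u : ℕ → X → ℝ) (x : X) : ℝ := ∑ l ∈ Finset.range (ret x), u l x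

theorem abs_towerSum_le {u : ℕ → X → ℝ} {C : ℝ} {x : X} (hu : ∀ l < ret x, |u l x| ≤ C) :
    |towerSum ret u x| ≤ C * ret x := by
  refine (Finset.abs_sum_le_sum_abs _ _).trans ?_
  refine (Finset.sum_le_card_nsmul _ _ C fun l hl => hu l (Finset.mem_range.1 hl)).trans ?_
  simp [mul_comm]

variable [MeasurableSpace X] {μ : Measure X}

theorem measurable_towerSum (hret : Measurable ret) {u : ℕ → X → ℝ} (hu : ∀ l, Measurable (u l)) :
    Measurable (towerSum ret u) := by
  have h : Measurable fun p : ℕ × X => ∑ l ∈ Finset.range p.1, u l p.2 :=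
    measurable_from_prod_countable_right fun n =>
      Finset.measurable_fun_sum (Finset.range n) fun l _ => hu l
  exact h.comp (hret.prodMk measurable_id)

theorem integrable_towerSum (hret : Measurable ret) (hi : Integrable (fun x => (ret x : ℝ)) μ)
    {u : ℕ → X → ℝ} (hu : ∀ l, Measurable (u l)) {C : ℝ} (hC : ∀ l x, |u l x| ≤ C) :
    Integrable (towerSum ret u) μ :=
  (hi.const_mul C).mono' (measurable_towerSum hret hu).aestronglyMeasurable
    (Filter.Eventually.of_forall fun _ => abs_towerSum_le fun l _ => hC l _)

variable [IsFiniteMeasure μ]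

theorem integrable_ret (hret : Measurable ret)
    (hs : Summable fun l : ℕ => μ.real {x | l < ret x}) : Integrable (fun x => (ret x : ℝ)) μ := by
  have hm : Measurable fun x => (ret x : ℝ) := measurable_from_nat.comp hret
  refine ⟨hm.aestronglyMeasurable, ?_⟩
  have hset : ∀ l, MeasurableSet {x | l < ret x} := fun l => measurableSet_lt measurable_const hret
  have h1 : ∀ x, ‖(ret x : ℝ)‖ₑ = ∑' l : ℕ, {x | l < ret x}.indicator (fun _ => (1 : ℝ≥0∞)) x := by
    intro x
    rw [tsum_eq_sum (s := Finset.range (ret x))]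
    · have : ∀ l ∈ Finset.range (ret x),
          {x | l < ret x}.indicator (fun _ => (1 : ℝ≥0∞)) x = 1 := fun l hl =>
        indicator_of_mem (show x ∈ {x | l < ret x} from Finset.mem_range.1 hl) _
      rw [Finset.sum_congr rfl this]
      simp
    · intro l hl
      have hx : x ∉ {x | l < ret x} := fun h => hl (Finset.mem_range.2 h)
      exact indicator_of_notMem hx _
  rw [HasFiniteIntegral]
  simp only [h1]
  rw [lintegral_tsum fun l => (measurable_const.indicator (hset l)).aemeasurable]
  have h2 := hs.tsum_ofReal_lt_top
  convert h2 using 3 with l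
  rw [measureReal_def, ENNReal.ofReal_toReal (measure_ne_top _ _)]
  exact lintegral_indicator_one (hset l)

theorem hasSum_integral_towerSum (hret : Measurable ret)
    (hs : Summable fun l : ℕ => μ.real {x | l < ret x}) {u : ℕ → X → ℝ}
    (hu : ∀ l, Measurable (u l)) {C : ℝ} (hC : ∀ l x, |u l x| ≤ C) :
    HasSum (fun l => ∫ x, (if l < ret x then u l x else 0) ∂μ) (∫ x, towerSum ret u x ∂μ) := by
  have hset : ∀ l, MeasurableSet {x | l < ret x} := fun l => measurableSet_lt measurable_const hret
  have hm : ∀ l, Measurable fun x => if l < ret x then u l x else 0 := fun l =>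
    Measurable.ite (hset l) (hu l) measurable_const
  have hb : ∀ l x, |if l < ret x then u l x else 0| ≤ C := fun l x => by
    split_ifs
    · exact hC l x
    · simpa using (abs_nonneg _).trans (hC l x)
  have hi : ∀ l, Integrable (fun x => if l < ret x then u l x else 0) μ := fun l =>
    integrable_of_abs_le (hm l) (hb l)
  have hn : Summable fun l => ∫ x, ‖(if l < ret x then u l x else 0 : ℝ)‖ ∂μ := by
    refine Summable.of_nonneg_of_le (fun l => integral_nonneg fun x => norm_nonneg _)
      (fun l => ?_) (hs.mul_left C)
    have : ∀ x, ‖(if l < ret x then u l x else 0 : ℝ)‖ ≤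
        {x | l < ret x}.indicator (fun _ => C) x := fun x => by
      rw [indicator_apply]
      by_cases hx : l < ret x
      · rw [if_pos hx, if_pos (show x ∈ {x | l < ret x} from hx)]; exact hC l x
      · rw [if_neg hx, if_neg (show x ∉ {x | l < ret x} from hx)]; simp
    have h2 := integral_mono (hi l).norm ((integrable_const C).indicator (hset l)) this
    rw [integral_indicator_const _ (hset l), smul_eq_mul] at h2
    linarith
  have h : HasSum _ _ := hasSum_integral_of_summable_integral_norm hi hn
  have heq : ∀ x, ∑' l, (if l < ret x then u l x else 0) = towerSum ret u x := fun x => by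
    rw [tsum_eq_sum (s := Finset.range (ret x)), towerSum]
    · exact Finset.sum_congr rfl fun l hl => if_pos (Finset.mem_range.1 hl)
    · intro l hl
      have hx : ¬ l < ret x := fun h => hl (Finset.mem_range.2 h)
      exact if_neg hx
  simp only [heq] at h
  exact h

/-- The integral over the tower is invariant under the tower map. -/
theorem integral_towerSum_shift (hF : MeasurePreserving F μ μ) (hret : Measurable ret)
    (hi : Integrable (fun x => (ret x : ℝ)) μ) {U : ℕ → X → ℝ} (hU : IsTowerSeq F ret 1 U)
    (hUm : ∀ n, Measurable (U n)) {C : ℝ} (hC : ∀ n x, |U n x| ≤ C) (k : ℕ) :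
    ∫ x, towerSum ret (fun l => U (k + l)) x ∂μ = ∫ x, towerSum ret U x ∂μ := by
  induction k with
  | zero => simp
  | succ k ih =>
    rw [← ih]
    -- Shifting by one step changes the sum over a column by the coboundary `U k ∘ F - U k`, whose
    -- integral vanishes.
    have hpt : ∀ x, towerSum ret (fun l => U (k + 1 + l)) x =
        towerSum ret (fun l => U (k + l)) x + (U k (F x) - U k x) := fun x => by
      have h1 := Finset.sum_range_succ (fun l => U (k + l) x) (ret x)
      have h2 := Finset.sum_range_succ' (fun l => U (k + l) x) (ret x)
      have h3 : U (k + ret x) x = U k (F x) := by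
        rw [hU _ _ (Nat.le_add_left _ _), one_mul, Nat.add_sub_cancel]
      unfold towerSum
      rw [h1] at h2
      rw [h3] at h2
      simp only [add_zero] at h2
      have h4 : ∑ l ∈ Finset.range (ret x), U (k + 1 + l) x =
          ∑ l ∈ Finset.range (ret x), U (k + (l + 1)) x :=
        Finset.sum_congr rfl fun l _ => by rw [show k + 1 + l = k + (l + 1) by ring]
      rw [h4]
      linarith
    simp only [hpt]
    have hUk : Integrable (U k) μ := integrable_of_abs_le (hUm k) (hC k)
    have hUF : Integrable (fun x => U k (F x)) μ :=
      integrable_of_abs_le ((hUm k).comp hF.measurable) fun x => hC k _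
    have hint : ∫ x, U k (F x) ∂μ = ∫ x, U k x ∂μ := by
      have := integral_map (μ := μ) hF.measurable.aemeasurable (f := U k)
        (hUm k).aestronglyMeasurable
      rw [hF.map_eq] at this
      exact this.symm
    have h5 : Integrable (towerSum ret fun l => U (k + l)) μ :=
      integrable_towerSum hret hi (fun l => hUm _) fun l x => hC _ x
    have h6 := integral_add (g := fun x => U k (F x) - U k x) h5 (hUF.sub hUk)
    rw [h6, integral_sub hUF hUk, hint, sub_self, add_zero]

end Tower

/-! ### Functions of finitely many symbols. -/

namespace FullBranchMap

section Dep

variable {X A : Type*} [MeasurableSpace X] {S : FullBranchMap X A}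

variable (S) in
/-- The function `u` depends on the first `n` symbols only. -/
def DependsOn {β : Type*} (n : ℕ) (u : X → β) : Prop := ∀ x y, S.Agree n x y → u x = u y

theorem DependsOn.mono {β : Type*} {n k : ℕ} {u : X → β} (h : S.DependsOn n u) (hk : n ≤ k) :
    S.DependsOn k u := fun x y hxy => h x y (hxy.mono hk)

theorem dependsOn_sym {β : Type*} (f : A → β) : S.DependsOn 1 fun x => f (S.sym x) :=
  fun _ _ h => congrArg f (h 0 Nat.one_pos)

/-- Such a function factors through the countable space of words, on which everything is measurable.
-/
theorem DependsOn.measurable [Countable A] {n : ℕ} {u : X → ℝ} (h : S.DependsOn n u) :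
    Measurable u := by
  let _ : MeasurableSpace A := ⊤
  let it : X → Fin n → A := fun x i => S.sym (S.F^[i] x)
  have hs : Measurable S.sym := measurable_to_countable' fun a => S.measurableSet_sym a
  have hit : Measurable it := measurable_pi_lambda _ fun i =>
    hs.comp (S.measurable_F.iterate i)
  have hfac : Function.FactorsThrough u it := fun x y hxy =>
    h x y fun i hi => congrFun hxy ⟨i, hi⟩
  have : u = (Function.extend it u fun _ => 0) ∘ it := by
    funext x
    exact (hfac.extend_apply _ x).symm
  rw [this]
  exact (measurable_of_countable _).comp hit

/-- Every return takes at least one unit of time, so the continuation up to time `n` shifts the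
window of symbols by no more than the time elapsed. -/
theorem DependsOn.towerLift {β : Type*} {τ : A → ℕ} (hτ : ∀ a, 1 ≤ τ a) {b : ℕ → X → β} {k : ℕ}
    (hb : ∀ n, S.DependsOn (n + 1 + k) (b n)) (n : ℕ) :
    S.DependsOn (n + 1 + k) (towerLift S.F (fun x => τ (S.sym x)) b n) := by
  induction n using Nat.strong_induction_on with
  | _ n ih =>
  intro x y hxy
  have h0 : S.sym x = S.sym y := hxy 0 (by omega)
  rcases lt_or_ge n (τ (S.sym x)) with hn | hn
  · rw [towerLift_of_lt (x := x) b hn, towerLift_of_lt (x := y) b (h0 ▸ hn)]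
    exact hb n x y hxy
  · rw [towerLift_of_le (x := x) b (fun x => hτ _) hn,
      towerLift_of_le (x := y) b (fun x => hτ _) (h0 ▸ hn), ← h0]
    have h1 := hτ (S.sym x)
    refine ih _ (by omega) _ _ ?_
    have h2 : S.Agree (n + k + 1) x y := by rwa [show n + k + 1 = n + 1 + k by ring]
    exact (agree_succ.1 h2).2.mono (by omega)

theorem dependsOn_numReturns {τ : A → ℕ} (hτ : ∀ a, 1 ≤ τ a) (n : ℕ) :
    S.DependsOn (n + 1) (numReturns S.F (fun x => τ (S.sym x)) n) := by
  induction n using Nat.strong_induction_on with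
  | _ n ih =>
  intro x y hxy
  have h0 : S.sym x = S.sym y := hxy 0 (by omega)
  rcases lt_or_ge n (τ (S.sym x)) with hn | hn
  · rw [numReturns_of_lt (ret := fun x => τ (S.sym x)) (x := x) hn,
      numReturns_of_lt (ret := fun x => τ (S.sym x)) (x := y) (h0 ▸ hn)]
  · rw [numReturns_of_le (ret := fun x => τ (S.sym x)) (x := x) (fun x => hτ _) hn,
      numReturns_of_le (ret := fun x => τ (S.sym x)) (x := y) (fun x => hτ _) (h0 ▸ hn), ← h0]
    have h1 := hτ (S.sym x)
    rw [ih _ (by omega) _ _ ((agree_succ.1 hxy).2.mono (by omega))]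

end Dep

end FullBranchMap


/-! ### Densities that are regular only after some returns. -/

namespace FullBranchMap

section After

variable {X A : Type*} [MeasurableSpace X] {S : FullBranchMap X A} {θ K R R₁ R₂ : ℝ} {τ : A → ℕ}

variable (S) in
/-- Densities that become regular after pushing forward by the returns up to time `r`. -/
structure AfterCone (τ : A → ℕ) (θ R₁ R₂ : ℝ) (r : ℕ) (g : X → ℝ) : Prop where
  nonneg : ∀ x, 0 ≤ g x
  measurable : Measurable g
  bound : ∃ C, ∀ x, |g x| ≤ C
  regular : ∀ n x y, S.Agree (numReturns S.F (fun x => τ (S.sym x)) r x + 1 + n) x y →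
    g x ≤ Real.exp (R₁ * θ ^ n +
      R₂ * θ ^ (numReturns S.F (fun x => τ (S.sym x)) r x + 1 + n)) * g y

theorem dependsOn_towerLift_ret (hτ : ∀ a, 1 ≤ τ a) {β : Type*} (f : ℕ → ℕ → β) (n : ℕ) :
    S.DependsOn (n + 1)
      (towerLift S.F (fun x => τ (S.sym x)) (fun n x => f n (τ (S.sym x))) n) :=
  DependsOn.towerLift (k := 0) hτ
    (fun n => (dependsOn_sym fun a => f n (τ a)).mono (by omega)) n

variable [Countable A]

theorem exists_bound_transfer (hJ : S.Distortion θ K) {g : X → ℝ} {C : ℝ} (hg : ∀ x, |g x| ≤ C) :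
    ∃ C', ∀ x, |S.transfer g x| ≤ C' := by
  have hs := ((summable_measureReal_sym (S := S)).mul_left (Real.exp K * C)).hasSum
  refine ⟨_, fun x => (Real.norm_eq_abs _).symm.trans_le (tsum_of_norm_bounded hs fun a => ?_)⟩
  rw [Real.norm_eq_abs, abs_mul, abs_of_pos (S.J_pos a x)]
  calc S.J a x * |g (S.br a x)| ≤ (Real.exp K * S.m.real (S.sym ⁻¹' {a})) * C :=
        mul_le_mul (J_le hJ a x) (hg _) (abs_nonneg _) (by positivity)
    _ = _ := by ring

/-- A return by time `r` uses up one of the returns counted in the regularity condition. The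
distortion it adds is absorbed in the second term because `K + θ R₂ ≤ R₂`; the first term is
unchanged. -/
theorem AfterCone.pushReturn_of_lt (hJ : S.Distortion θ K) (hτ : ∀ a, 1 ≤ τ a) (hθ : 0 ≤ θ)
    (hR : K + θ * R₂ ≤ R₂) {r : ℕ} {g : X → ℝ} (hg : S.AfterCone τ θ R₁ R₂ r g) {t : ℕ}
    (ht : t < r) : S.AfterCone τ θ R₁ R₂ (r - (t + 1)) (S.pushReturn τ t g) := by
  obtain ⟨C, hC⟩ := hg.bound
  refine ⟨pushReturn_nonneg t hg.nonneg, measurable_pushReturn hJ t hg.measurable hC,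
    exists_bound_transfer hJ (abs_ite_return_le hC), fun n x y hxy => ?_⟩
  set N := numReturns S.F (fun x => τ (S.sym x)) (r - (t + 1)) x with hN
  have hbr : ∀ a, τ a = t + 1 →
      numReturns S.F (fun x => τ (S.sym x)) r (S.br a x) = N + 1 := fun a ha => by
    rw [numReturns_of_le (ret := fun x => τ (S.sym x)) (fun x => hτ _)
      (by simp only [S.sym_br]; omega)]
    simp only [S.sym_br, S.F_br, ha, hN]
  have h := pushReturn_le (τ := τ) hJ t hC hg.nonneg hxy (c := R₁ * θ ^ n + R₂ * θ ^ (N + 1 + n + 1))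
    fun a ha => by
      have h1 := hg.regular n (S.br a x) (S.br a y)
      rw [hbr a ha] at h1
      have := h1 ((hxy.br a).mono (by omega))
      rwa [show N + 1 + 1 + n = N + 1 + n + 1 by ring] at this
  refine h.trans (mul_le_mul_of_nonneg_right (Real.exp_le_exp.2 ?_)
    (pushReturn_nonneg t hg.nonneg y))
  have h2 : 0 ≤ θ ^ (N + 1 + n) := by positivity
  have h3 := mul_le_mul_of_nonneg_right hR h2
  rw [pow_succ θ (N + 1 + n)]
  linarith

/-- A point whose first return comes after `r` has no returns left to count, so the pushed density
is already in an ordinary cone. -/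
theorem AfterCone.pushReturn_of_le (hJ : S.Distortion θ K) (hθ : 0 ≤ θ)
    (hR : K + θ * R₂ ≤ R₂) {r : ℕ} {g : X → ℝ} (hg : S.AfterCone τ θ R₁ R₂ r g) {t : ℕ}
    (ht : r ≤ t) : S.Cone θ (R₁ + R₂) (S.pushReturn τ t g) := by
  obtain ⟨C, hC⟩ := hg.bound
  refine ⟨pushReturn_nonneg t hg.nonneg, measurable_pushReturn hJ t hg.measurable hC,
    fun n x y hxy => ?_⟩
  have h := pushReturn_le (τ := τ) hJ t hC hg.nonneg hxy (c := R₁ * θ ^ n + R₂ * θ ^ (n + 1))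
    fun a ha => by
      have h1 := hg.regular n (S.br a x) (S.br a y)
      rw [numReturns_of_lt (by simp only [S.sym_br]; omega)] at h1
      have := h1 ((hxy.br a).mono (by omega))
      rwa [show 0 + 1 + n = n + 1 by ring] at this
  refine h.trans (mul_le_mul_of_nonneg_right (Real.exp_le_exp.2 ?_)
    (pushReturn_nonneg t hg.nonneg y))
  have h2 : 0 ≤ θ ^ n := by positivity
  have h3 := mul_le_mul_of_nonneg_right hR h2
  rw [pow_succ]
  linarith

/-- Follow the mass until its first return after time `r`; there the density lies in the cone and
the bound `E` applies to the time that is left. The tower lift on the right records this time: it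
reaches a position `n < τ` at time `r`, from which `τ - n` steps lead to the return. -/
theorem AfterCone.abs_integral_mul_le (hJ : S.Distortion θ K) (hτ : ∀ a, 1 ≤ τ a) (hθ : 0 ≤ θ)
    (hR : K + θ * R₂ ≤ R₂) {U : ℕ → X → ℝ} {c : ℝ} (hc : 0 ≤ c) (hc1 : c ≤ 1)
    (hU : IsTowerSeq S.F (fun x => τ (S.sym x)) c U) (hUm : ∀ n, Measurable (U n)) {E : ℕ → ℝ}
    (hE : ∀ n, 0 ≤ E n) (hE0 : ∀ n, E n ≤ E 0) (hUE : ∀ n x, |U n x| ≤ E 0)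
    (hcone : ∀ n g, S.Cone θ (R₁ + R₂) g → |∫ x, g x * U n x ∂S.m| ≤ E n * ∫ x, g x ∂S.m)
    (d r : ℕ) {g : X → ℝ} (hg : S.AfterCone τ θ R₁ R₂ r g) :
    |∫ x, g x * U (r + d) x ∂S.m| ≤ ∫ x, g x * towerLift S.F (fun x => τ (S.sym x))
      (fun n x => E (n + d - τ (S.sym x))) r x ∂S.m := by
  set D := towerLift S.F (fun x => τ (S.sym x)) (fun n x => E (n + d - τ (S.sym x))) with hD
  have hDm : ∀ n, Measurable (D n) := fun n =>
    (dependsOn_towerLift_ret hτ (fun n s => E (n + d - s)) n).measurable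
  have hDmem : ∀ n x, D n x ∈ Icc 0 (E 0) := fun n x =>
    towerLift_mem (s := Icc 0 (E 0)) (fun x => hτ _) (fun n x _ => ⟨hE _, hE0 _⟩) n x
  have hDE : ∀ n x, |D n x| ≤ E 0 := fun n x => by
    rw [abs_of_nonneg (hDmem n x).1]; exact (hDmem n x).2
  induction r using Nat.strong_induction_on generalizing g with
  | _ r ih =>
  obtain ⟨C, hC⟩ := hg.bound
  have hb : ∀ (V : X → ℝ), (∀ x, |V x| ≤ E 0) → ∀ x, |g x * V x| ≤ C * E 0 := fun V hV x => by
    rw [abs_mul]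
    exact mul_le_mul (hC x) (hV x) (abs_nonneg _) ((abs_nonneg _).trans (hC x))
  rw [integral_eq_sum_return (f := fun x => g x * U (r + d) x) hτ (hg.measurable.mul (hUm _))
      (hb _ (hUE _)) (r + d),
    integral_eq_sum_return (f := fun x => g x * D r x) hτ (hg.measurable.mul (hDm _))
      (hb _ (hDE _)) (r + d)]
  refine (abs_add_le _ _).trans (add_le_add ((Finset.abs_sum_le_sum_abs _ _).trans
    (Finset.sum_le_sum fun t ht => ?_)) ?_)
  · have htr := Finset.mem_range.1 ht
    have h1 : ∫ x, (if τ (S.sym x) = t + 1 then g x * U (r + d) x else 0) ∂S.m =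
        c * ∫ x, S.pushReturn τ t g x * U (r + d - (t + 1)) x ∂S.m := by
      rw [integral_pushReturn_mul hJ t hg.measurable (hUm _) hC (hUE _), ← integral_const_mul]
      refine integral_congr_ae (Filter.Eventually.of_forall fun x => ?_)
      dsimp only
      split_ifs with hx
      · rw [hU (r + d) x (by dsimp only; omega)]
        beta_reduce
        rw [hx]
        ring
      · simp
    have h2 : |∫ x, S.pushReturn τ t g x * U (r + d - (t + 1)) x ∂S.m| ≤
        ∫ x, (if τ (S.sym x) = t + 1 then g x * D r x else 0) ∂S.m := by
      -- Returns by time `r` are handled by induction; the first return after `r` lands in the cone.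
      rcases lt_or_ge t r with htr' | htr'
      · have h3 := ih (r - (t + 1)) (by omega) (hg.pushReturn_of_lt hJ hτ hθ hR htr')
        rw [show r - (t + 1) + d = r + d - (t + 1) by omega] at h3
        refine h3.trans (le_of_eq ?_)
        rw [integral_pushReturn_mul hJ t hg.measurable (hDm _) hC (hDE _)]
        refine integral_congr_ae (Filter.Eventually.of_forall fun x => ?_)
        beta_reduce
        split_ifs with hx
        · rw [hD, towerLift_of_le (ret := fun x => τ (S.sym x)) (n := r) (x := x) _
            (fun x => hτ _) (by omega)]
          rw [hx]
        · rfl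
      · refine (hcone _ _ (hg.pushReturn_of_le hJ hθ hR htr')).trans (le_of_eq ?_)
        rw [integral_pushReturn hJ t hg.measurable hC, ← integral_const_mul]
        refine integral_congr_ae (Filter.Eventually.of_forall fun x => ?_)
        beta_reduce
        split_ifs with hx
        · rw [hD, towerLift_of_lt (ret := fun x => τ (S.sym x)) (n := r) (x := x) _
            (by omega), hx]
          ring
        · simp
    rw [h1, abs_mul, abs_of_nonneg hc]
    exact (mul_le_of_le_one_left (abs_nonneg _) hc1).trans h2
  · refine abs_integral_le_integral_abs.trans ?_
    refine integral_mono_of_nonneg (Filter.Eventually.of_forall fun x => abs_nonneg _) ?_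
      (Filter.Eventually.of_forall fun x => ?_)
    · refine integrable_of_abs_le (C := C * E 0) (Measurable.ite (measurableSet_lt measurable_const
        (S.measurable_comp_sym τ)) (hg.measurable.mul (hDm r)) measurable_const) fun x => ?_
      split_ifs
      · exact hb _ (hDE _) x
      · simpa using (abs_nonneg _).trans (hb _ (hDE r) x)
    · beta_reduce
      split_ifs with hx
      -- Mass without a return by time `r + d`: the truncated difference is `0`, and `E 0` is the
      -- trivial bound.
      · rw [abs_mul, abs_of_nonneg (hg.nonneg x), hD,
          towerLift_of_lt (ret := fun x => τ (S.sym x)) (n := r) (x := x) _ (by omega),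
          show r + d - τ (S.sym x) = 0 by omega]
        exact mul_le_mul_of_nonneg_left (hUE _ x) (hg.nonneg x)
      · simp

/-- Conditioning on the first return gives a renewal inequality in which each return carries a
factor `θ`, so `solve` applies with `ρ = θ`. -/
theorem exists_returns_decay {ι : Type} {r : ι → ℝ → ℕ → ℝ} (hr : RateFamily r) {L θ K R : ℝ}
    (hL : 1 ≤ L) (hθ : 0 ≤ θ) (hθ1 : θ < 1) (hR : K + θ * R ≤ R) :
    ∃ L', 1 ≤ L' ∧ ∀ (i : ι) {X A : Type*} [MeasurableSpace X] [Countable A]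
      (S : FullBranchMap X A) (τ : A → ℕ), S.Distortion θ K → (∀ a, 1 ≤ τ a) →
      (∀ n, S.m.real {x | n < τ (S.sym x)} ≤ r i L n) → ∀ n g, S.Cone θ R g →
      ∫ x, g x * θ ^ numReturns S.F (fun x => τ (S.sym x)) n x ∂S.m ≤
        min 1 (r i L' n) * ∫ x, g x ∂S.m := by
  obtain ⟨L₁, hL₁, hsc⟩ := hr.scale L hL (Real.exp R)
  obtain ⟨L₂, hL₂, hsolve⟩ := hr.solve_mul hL₁ hθ hθ1
  refine ⟨L₂, hL₂, fun i X A _ _ S τ hJ hτ htail n => ?_⟩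
  set ψ := numReturns S.F (fun x => τ (S.sym x)) with hψ
  have hU : IsTowerSeq S.F (fun x => τ (S.sym x)) θ fun n x => θ ^ ψ n x :=
    isTowerSeq_pow_numReturns (fun x => hτ _) θ
  have hUm : ∀ n, Measurable fun x => θ ^ ψ n x := fun n => by
    refine DependsOn.measurable (S := S) (n := n + 1) fun x y hxy => ?_
    rw [hψ, dependsOn_numReturns hτ n x y hxy]
  have hU1 : ∀ n x, |θ ^ ψ n x| ≤ 1 := fun n x => by
    rw [abs_of_nonneg (by positivity)]; exact pow_le_one₀ hθ hθ1.le
  induction n using Nat.strong_induction_on with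
  | _ n ih =>
  intro g hg
  obtain ⟨C, hC⟩ := hg.exists_bound
  have hb : ∀ x, |g x * θ ^ ψ n x| ≤ C := fun x => by
    rw [abs_mul]
    exact (mul_le_of_le_one_right (abs_nonneg _) (hU1 n x)).trans (hC x)
  have htl : ∀ n, ∫ x, (if n < τ (S.sym x) then g x else 0) ∂S.m ≤
      (∫ x, g x ∂S.m) * r i L₁ n := fun n =>
    (hg.tail_le n).trans (mul_le_mul_of_nonneg_left ((mul_le_mul_of_nonneg_left (htail n)
      (Real.exp_pos R).le).trans (hsc i n)) hg.integral_nonneg)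
  set M := ∫ x, g x ∂S.m with hM
  have htl0 : ∀ n, 0 ≤ ∫ x, (if n < τ (S.sym x) then g x else 0) ∂S.m := fun n =>
    integral_nonneg fun x => by
      show (0 : ℝ) ≤ if n < τ (S.sym x) then g x else 0
      split_ifs
      exacts [hg.nonneg x, le_rfl]
  have hsplit : ∀ n, M = ∑ t ∈ Finset.range n, ∫ x, S.pushReturn τ t g x ∂S.m +
      ∫ x, (if n < τ (S.sym x) then g x else 0) ∂S.m := fun n => by
    rw [hM, integral_eq_sum_return hτ hg.measurable hC n]
    congr 1
    exact Finset.sum_congr rfl fun t _ => (integral_pushReturn hJ t hg.measurable hC).symm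
  have hpt0 : ∀ t, 0 ≤ ∫ x, S.pushReturn τ t g x ∂S.m := fun t =>
    (hg.pushReturn hJ t).integral_nonneg
  have hM0 : 0 ≤ M := hg.integral_nonneg
  rw [min_mul_of_nonneg _ _ hM0]
  refine le_min ?_ ?_
  · rw [one_mul]
    exact integral_mono (integrable_of_abs_le (hg.measurable.mul (hUm n)) hb) hg.integrable
      fun x => mul_le_of_le_one_right (hg.nonneg x) ((le_abs_self _).trans (hU1 n x))
  rw [mul_comm]
  refine le_trans ?_ (hsolve i n (fun t => θ * ∫ x, S.pushReturn τ t g x ∂S.m) M hM0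
    (fun t => mul_nonneg hθ (hpt0 t)) ?_ ?_)
  · rw [integral_eq_sum_return (f := fun x => g x * θ ^ ψ n x) hτ (hg.measurable.mul (hUm n)) hb n,
      add_comm]
    refine add_le_add ((le_of_eq ?_).trans (htl n)) (Finset.sum_le_sum fun t ht => ?_)
    · refine integral_congr_ae (Filter.Eventually.of_forall fun x => ?_)
      dsimp only
      split_ifs with hx
      · rw [hψ, numReturns_of_lt (ret := fun x => τ (S.sym x)) hx, pow_zero, mul_one]
      · rfl
    · have htn := Finset.mem_range.1 ht
      have h1 : ∫ x, (if τ (S.sym x) = t + 1 then g x * θ ^ ψ n x else 0) ∂S.m =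
          θ * ∫ x, S.pushReturn τ t g x * θ ^ ψ (n - 1 - t) x ∂S.m := by
        rw [integral_pushReturn_mul hJ t hg.measurable (hUm _) hC (hU1 _), ← integral_const_mul]
        refine integral_congr_ae (Filter.Eventually.of_forall fun x => ?_)
        beta_reduce
        split_ifs with hx
        · have := hU n x (by dsimp only; omega)
          dsimp only at this
          rw [this, hx, show n - (t + 1) = n - 1 - t by omega]
          ring
        · simp
      rw [h1, mul_assoc, mul_comm (∫ x, S.pushReturn τ t g x ∂S.m)]
      exact mul_le_mul_of_nonneg_left (ih _ (by omega) _ ((hg.pushReturn hJ t).mono hθ hR)) hθ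
  · rw [← Finset.mul_sum]
    refine mul_le_mul_of_nonneg_left ?_ hθ
    have := hsplit n
    linarith [htl0 n]
  · intro s hs
    rw [← Finset.mul_sum]
    refine le_trans (mul_le_of_le_one_left (Finset.sum_nonneg fun t _ => hpt0 t) hθ1.le) ?_
    refine le_trans ?_ (htl s)
    have h1 := hsplit n
    have h2 := hsplit s
    rw [Finset.sum_Ico_eq_sub _ hs]
    linarith [htl0 n]

end After

end FullBranchMap


theorem RatePair.summable_of_le {ι : Type} {r₀ r₁ : ι → ℝ → ℕ → ℝ} (hr : RatePair r₀ r₁) {L : ℝ}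
    (hL : 1 ≤ L) (i : ι) {f : ℕ → ℝ} (h0 : ∀ n, 0 ≤ f n) (hf : ∀ n, f n ≤ r₀ i L n) :
    Summable f := by
  obtain ⟨L', -, hs⟩ := hr.sum L hL
  refine summable_of_sum_range_le (c := r₁ i L' 0) h0 fun n => ?_
  rw [Finset.range_eq_Ico]
  exact (Finset.sum_le_sum fun j _ => hf j).trans (hs i 0 n)

/-! ### Decay on the tower. -/

namespace FullBranchMap

section TowerDecay

variable {X A : Type*} [MeasurableSpace X] {S : FullBranchMap X A} {θ K R R₁ R₂ : ℝ} {τ : A → ℕ}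

variable (S) in
/-- On functions of finitely many symbols, `μ` has a density with a log-Lipschitz bound. -/
def HasDensities (θ R : ℝ) (μ : Measure X) : Prop :=
  ∀ N, ∃ h, S.Cone θ R h ∧ ∀ (u : X → ℝ) (C : ℝ), S.DependsOn N u → (∀ x, |u x| ≤ C) →
    ∫ x, u x ∂μ = ∫ x, u x * h x ∂S.m

variable (S) in
/-- The weight `φ l` on the `l`-th level of the tower is regular after pushing forward by the
returns up to time `k + l`. -/
def WeightRegular (τ : A → ℕ) (θ R : ℝ) (k : ℕ) (φ : ℕ → X → ℝ) : Prop :=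
  ∀ l n x y, l < τ (S.sym x) →
    S.Agree (numReturns S.F (fun x => τ (S.sym x)) (k + l) x + 1 + n) x y →
    φ l x ≤ Real.exp (R * θ ^ n) * φ l y

variable [Countable A]

/-- On level `l` the density is the weight times a density of `μ`. The weight is regular beyond the
returns up to time `k + l` and the density is in the cone, which is exactly an `AfterCone` with `r =
k + l`. -/
theorem abs_integral_level_le (hJ : S.Distortion θ K) (hτ : ∀ a, 1 ≤ τ a) (hθ : 0 ≤ θ)
    (hR : K + θ * R₂ ≤ R₂) {μ : Measure X} [IsProbabilityMeasure μ] (hμ : S.HasDensities θ R₂ μ)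
    {U : ℕ → X → ℝ} {c : ℝ} (hc : 0 ≤ c) (hc1 : c ≤ 1)
    (hU : IsTowerSeq S.F (fun x => τ (S.sym x)) c U) (hUd : ∀ n, ∃ N, S.DependsOn N (U n))
    {E : ℕ → ℝ} (hE : ∀ n, 0 ≤ E n) (hE0 : ∀ n, E n ≤ E 0) (hUE : ∀ n x, |U n x| ≤ E 0)
    (hcone : ∀ n g, S.Cone θ (R₁ + R₂) g → |∫ x, g x * U n x ∂S.m| ≤ E n * ∫ x, g x ∂S.m)
    (k d : ℕ) {φ : ℕ → X → ℝ} {C : ℝ} (hφ : ∀ l x, 0 ≤ φ l x ∧ φ l x ≤ C)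
    (hφd : ∀ l, ∃ N, S.DependsOn N (φ l)) (hφr : S.WeightRegular τ θ R₁ k φ) (l : ℕ) :
    |∫ x, (if l < τ (S.sym x) then φ l x * U (k + l + d) x else 0) ∂μ| ≤
      C * ∫ x, (if l < τ (S.sym x) then towerLift S.F (fun x => τ (S.sym x))
        (fun n x => E (n + d - τ (S.sym x))) (k + l) x else 0) ∂μ := by
  set D := towerLift S.F (fun x => τ (S.sym x)) (fun n x => E (n + d - τ (S.sym x))) with hD
  have hDd : ∀ n, S.DependsOn (n + 1) (D n) := dependsOn_towerLift_ret hτ (fun n s => E (n + d - s))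
  have hDmem : ∀ n x, D n x ∈ Icc 0 (E 0) := fun n x =>
    towerLift_mem (s := Icc 0 (E 0)) (fun x => hτ _) (fun n x _ => ⟨hE _, hE0 _⟩) n x
  have hUm : ∀ n, Measurable (U n) := fun n => (hUd n).choose_spec.measurable
  obtain ⟨N₁, hN₁⟩ := hUd (k + l + d)
  obtain ⟨N₂, hN₂⟩ := hφd l
  obtain ⟨x₀⟩ : Nonempty X := S.nonempty
  have hC : 0 ≤ C := (hφ 0 x₀).1.trans (hφ 0 x₀).2
  have hind : S.DependsOn 1 fun x => l < τ (S.sym x) := dependsOn_sym fun a => l < τ a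
  set N := max (max N₁ N₂) (k + l + 1) with hN
  have hNN : ∀ {x y : X}, S.Agree N x y → U (k + l + d) x = U (k + l + d) y ∧ φ l x = φ l y ∧
      D (k + l) x = D (k + l) y ∧ ((l < τ (S.sym x)) = (l < τ (S.sym y))) := fun {x y} hxy =>
    ⟨hN₁ x y (hxy.mono (by omega)), hN₂ x y (hxy.mono (by omega)),
      hDd _ x y (hxy.mono (by omega)), hind x y (hxy.mono (by omega))⟩
  have hd1 : S.DependsOn N fun x => if l < τ (S.sym x) then φ l x * U (k + l + d) x else 0 := by
    intro x y hxy
    obtain ⟨h1, h2, h3, h4⟩ := hNN hxy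
    simp only [h1, h2, h4]
  have hd2 : S.DependsOn N fun x => if l < τ (S.sym x) then φ l x * D (k + l) x else 0 := by
    intro x y hxy
    obtain ⟨h1, h2, h3, h4⟩ := hNN hxy
    simp only [h2, h3, h4]
  have hd3 : S.DependsOn N fun x => if l < τ (S.sym x) then D (k + l) x else 0 := by
    intro x y hxy
    obtain ⟨h1, h2, h3, h4⟩ := hNN hxy
    simp only [h3, h4]
  have hb : ∀ V : X → ℝ, (∀ x, |V x| ≤ E 0) → ∀ x,
      |if l < τ (S.sym x) then φ l x * V x else 0| ≤ C * E 0 := fun V hV x => by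
    split_ifs
    · rw [abs_mul, abs_of_nonneg (hφ l x).1]
      exact mul_le_mul (hφ l x).2 (hV x) (abs_nonneg _) hC
    · simpa using mul_nonneg hC (hE 0)
  have hDE : ∀ n x, |D n x| ≤ E 0 := fun n x => by
    rw [abs_of_nonneg (hDmem n x).1]; exact (hDmem n x).2
  obtain ⟨h, hh, hint⟩ := hμ N
  have hind' : MeasurableSet {x | l < τ (S.sym x)} :=
    measurableSet_lt measurable_const (S.measurable_comp_sym τ)
  have hφm : Measurable (φ l) := hN₂.measurable
  have hg : S.AfterCone τ θ R₁ R₂ (k + l) fun x => if l < τ (S.sym x) then φ l x * h x else 0 := by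
    refine ⟨fun x => ?_, Measurable.ite hind' (hφm.mul hh.measurable) measurable_const, ?_,
      fun n x y hxy => ?_⟩
    · split_ifs
      exacts [mul_nonneg (hφ l x).1 (hh.nonneg x), le_rfl]
    · obtain ⟨B, hB⟩ := hh.exists_bound
      refine ⟨C * B, fun x => ?_⟩
      have hB0 : 0 ≤ B := (abs_nonneg _).trans (hB x)
      split_ifs
      · rw [abs_mul, abs_of_nonneg (hφ l x).1]
        exact mul_le_mul (hφ l x).2 (hB x) (abs_nonneg _) hC
      · simpa using mul_nonneg hC hB0
    · have h0 : S.sym x = S.sym y := hxy 0 (by omega)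
      rw [← h0]
      split_ifs with hl
      · have h1 := hφr l n x y hl hxy
        have h2 := hh.regular _ x y hxy
        rw [Real.exp_add]
        calc _ ≤ _ := mul_le_mul h1 h2 (hh.nonneg x)
              (mul_nonneg (Real.exp_pos _).le (hφ l y).1)
          _ = _ := by ring
      · simp
  have h1 := hg.abs_integral_mul_le hJ hτ hθ hR hc hc1 hU hUm hE hE0 hUE hcone d
  rw [← hD] at h1
  have h2 : ∀ V : X → ℝ, ∫ x, (if l < τ (S.sym x) then φ l x * h x else 0) * V x ∂S.m =
      ∫ x, (if l < τ (S.sym x) then φ l x * V x else 0) * h x ∂S.m := fun V => by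
    refine integral_congr_ae (Filter.Eventually.of_forall fun x => ?_)
    beta_reduce
    split_ifs
    · ring
    · simp
  rw [h2, h2, ← hint _ _ hd1 (hb _ (hUE _)), ← hint _ _ hd2 (hb _ (hDE _))] at h1
  refine h1.trans ?_
  rw [← integral_const_mul]
  have hmD : Measurable fun x => if l < τ (S.sym x) then D (k + l) x else 0 := hd3.measurable
  refine integral_mono (integrable_of_abs_le hd2.measurable (hb _ (hDE _)))
    ((integrable_of_abs_le hmD (C := E 0) fun x => ?_).const_mul C) fun x => ?_
  · split_ifs
    · exact hDE _ x
    · simpa using hE 0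
  · beta_reduce
    split_ifs
    · exact mul_le_mul_of_nonneg_right (hφ l x).2 (hDmem _ x).1
    · simp

/-- Summing the level bounds gives the integral of a tower lift shifted by `k`. The shift disappears
by invariance, and what remains is the convolution of the tails of `τ` with the decay on the base.
Hence the bound does not depend on `k`. -/
theorem exists_tower_decay {ι : Type} {r₀ r₁ : ι → ℝ → ℕ → ℝ} (hr : RatePair r₀ r₁) {L : ℝ}
    (hL : 1 ≤ L) : ∃ L', 1 ≤ L' ∧ ∀ (i : ι) {X A : Type*} [MeasurableSpace X] [Countable A]
      (S : FullBranchMap X A) (τ : A → ℕ) (θ K R₁ R₂ : ℝ), S.Distortion θ K → (∀ a, 1 ≤ τ a) →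
      0 ≤ θ → K + θ * R₂ ≤ R₂ → ∀ (μ : Measure X) [IsProbabilityMeasure μ],
      MeasurePreserving S.F μ μ → S.HasDensities θ R₂ μ →
      (∀ n, μ.real {x | n < τ (S.sym x)} ≤ r₀ i L n) →
      ∀ (U : ℕ → X → ℝ) (c b : ℝ), 0 ≤ c → c ≤ 1 → 0 ≤ b →
      IsTowerSeq S.F (fun x => τ (S.sym x)) c U → (∀ n, ∃ N, S.DependsOn N (U n)) →
      (∀ n x, |U n x| ≤ b) →
      (∀ n g, S.Cone θ (R₁ + R₂) g →
        |∫ x, g x * U n x ∂S.m| ≤ b * min 1 (r₁ i L n) * ∫ x, g x ∂S.m) →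
      ∀ (k d : ℕ) (φ : ℕ → X → ℝ) (C : ℝ), (∀ l x, 0 ≤ φ l x ∧ φ l x ≤ C) →
      (∀ l, ∃ N, S.DependsOn N (φ l)) → S.WeightRegular τ θ R₁ k φ →
      |∫ x, towerSum (fun x => τ (S.sym x)) (fun l x => φ l x * U (k + l + d) x) x ∂μ| ≤
        C * b * r₁ i L' d := by
  obtain ⟨L₁, hL₁, hsub⟩ := hr.snd.exists_sub hL 1
  obtain ⟨L₂, hL₂, hconv⟩ := hr.exists_conv (le_max_of_le_left hL : 1 ≤ max L L₁)
  refine ⟨L₂, hL₂, fun i X A _ _ S τ θ K R₁ R₂ hJ hτ hθ hR μ _ hF hμ htail U c b hc hc1 hb hU hUd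
    hUb hcone k d φ C hφ hφd hφr => ?_⟩
  obtain ⟨x₀⟩ : Nonempty X := S.nonempty
  have hC : 0 ≤ C := (hφ 0 x₀).1.trans (hφ 0 x₀).2
  set E : ℕ → ℝ := fun n => b * min 1 (r₁ i L n) with hE
  have hE0 : E 0 = b := by
    simp only [hE]
    rw [min_eq_left (hr.snd.one_le_zero i hL), mul_one]
  have hEn : ∀ n, 0 ≤ E n := fun n => mul_nonneg hb (le_min zero_le_one (hr.snd.nonneg i L n hL))
  have hEE : ∀ n, E n ≤ E 0 := fun n => by
    rw [hE0]
    exact mul_le_of_le_one_right hb (min_le_left _ _)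
  have hret : Measurable fun x => τ (S.sym x) := S.measurable_comp_sym τ
  have hs : Summable fun l : ℕ => μ.real {x | l < τ (S.sym x)} :=
    hr.summable_of_le hL i (fun n => measureReal_nonneg) htail
  have hUm : ∀ n, Measurable (U n) := fun n => (hUd n).choose_spec.measurable
  have hφm : ∀ l, Measurable (φ l) := fun l => (hφd l).choose_spec.measurable
  set D := towerLift S.F (fun x => τ (S.sym x)) (fun n x => E (n + d - τ (S.sym x))) with hD
  have hDm : ∀ n, Measurable (D n) := fun n =>
    (dependsOn_towerLift_ret hτ (fun n s => E (n + d - s)) n).measurable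
  have hDmem : ∀ n x, D n x ∈ Icc 0 (E 0) := fun n x =>
    towerLift_mem (s := Icc 0 (E 0)) (fun x => hτ _) (fun n x _ => ⟨hEn _, hEE _⟩) n x
  have hDE : ∀ n x, |D n x| ≤ E 0 := fun n x => by
    rw [abs_of_nonneg (hDmem n x).1]; exact (hDmem n x).2
  have h1 := hasSum_integral_towerSum hret hs (u := fun l x => φ l x * U (k + l + d) x)
    (fun l => (hφm l).mul (hUm _)) (C := C * b) fun l x => by
      rw [abs_mul, abs_of_nonneg (hφ l x).1]
      exact mul_le_mul (hφ l x).2 (hUb _ x) (abs_nonneg _) hC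
  have h2 := (hasSum_integral_towerSum hret hs (u := fun l => D (k + l)) (fun l => hDm _)
    fun l x => hDE _ x).mul_left C
  have h3 : |∫ x, towerSum (fun x => τ (S.sym x)) (fun l x => φ l x * U (k + l + d) x) x ∂μ| ≤
      C * ∫ x, towerSum (fun x => τ (S.sym x)) (fun l => D (k + l)) x ∂μ := by
    rw [← h1.tsum_eq, ← h2.tsum_eq, ← Real.norm_eq_abs]
    refine tsum_of_norm_bounded h2.summable.hasSum fun l => ?_
    exact abs_integral_level_le hJ hτ hθ hR hμ hc hc1 hU hUd hEn hEE
      (fun n x => by rw [hE0]; exact hUb n x) hcone k d hφ hφd hφr l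
  refine h3.trans ?_
  rw [mul_assoc]
  refine mul_le_mul_of_nonneg_left ?_ hC
  rw [integral_towerSum_shift hF hret (integrable_ret hret hs)
    (isTowerSeq_towerLift (fun x => hτ _) _) hDm hDE k]
  -- Before the first return the lift is explicit; reversing the levels turns the distance to the
  -- top of the column into the summation index.
  have h4 : ∀ x, towerSum (fun x => τ (S.sym x)) D x =
      towerSum (fun x => τ (S.sym x)) (fun l _ => E (d - (l + 1))) x := fun x => by
    unfold towerSum
    rw [← Finset.sum_range_reflect]
    refine Finset.sum_congr rfl fun l hl => ?_
    have hl' : l < τ (S.sym x) := Finset.mem_range.1 hl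
    beta_reduce
    rw [hD, towerLift_of_lt (ret := fun x => τ (S.sym x)) _ (by omega),
      show τ (S.sym x) - 1 - l + d - τ (S.sym x) = d - (l + 1) by omega]
  rw [integral_congr_ae (Filter.Eventually.of_forall h4)]
  have h5 := hasSum_integral_towerSum hret hs (u := fun l _ => E (d - (l + 1)))
    (fun l => measurable_const) (C := b) fun l x => by
      rw [abs_of_nonneg (hEn _), ← hE0]; exact hEE _
  rw [← h5.tsum_eq]
  refine Real.tsum_le_of_sum_range_le (fun l => integral_nonneg fun x => ?_) fun n => ?_
  · show (0 : ℝ) ≤ if l < τ (S.sym x) then E (d - (l + 1)) else 0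
    split_ifs
    exacts [hEn _, le_rfl]
  have h6 : ∀ l, ∫ x, (if l < τ (S.sym x) then E (d - (l + 1)) else 0) ∂μ ≤
      b * (r₀ i (max L L₁) l * min 1 (r₁ i L (d - (l + 1)))) := fun l => by
    have h7 : ∫ x, (if l < τ (S.sym x) then E (d - (l + 1)) else 0) ∂μ =
        μ.real {x | l < τ (S.sym x)} * E (d - (l + 1)) := by
      rw [← smul_eq_mul, ← integral_indicator_const _ (measurableSet_lt measurable_const hret)]
      refine integral_congr_ae (Filter.Eventually.of_forall fun x => ?_)
      simp [indicator_apply]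
    rw [h7]
    have h8 := (htail l).trans (hr.fst.mono i L (max L L₁) l hL (le_max_left _ _))
    calc _ ≤ r₀ i (max L L₁) l * E (d - (l + 1)) := mul_le_mul_of_nonneg_right h8 (hEn _)
      _ = _ := by simp only [hE]; ring
  refine (Finset.sum_le_sum fun l _ => h6 l).trans ?_
  rw [← Finset.mul_sum]
  refine mul_le_mul_of_nonneg_left (hconv i d n (fun l => min 1 (r₁ i L (d - (l + 1))))
    (fun j => min_le_left _ _) fun j hj => ?_) hb
  refine (min_le_right _ _).trans ?_
  rw [← Nat.sub_sub]
  exact (hsub i (d - j)).trans (hr.snd.mono i L₁ _ _ hL₁ (le_max_right _ _))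

end TowerDecay

end FullBranchMap


/-! ### Linearity of tower integrals for bounded sequences. -/

section BoundedSeq

variable {X : Type*} [MeasurableSpace X] {ret : X → ℕ} {μ : Measure X} {u v : ℕ → X → ℝ}

/-- A uniformly bounded sequence of measurable functions. -/
structure BoundedSeq (u : ℕ → X → ℝ) : Prop where
  measurable : ∀ n, Measurable (u n)
  bound : ∃ C, ∀ n x, |u n x| ≤ C

namespace BoundedSeq

theorem const (c : ℝ) : BoundedSeq fun (_ : ℕ) (_ : X) => c :=
  ⟨fun _ => measurable_const, |c|, fun _ _ => le_rfl⟩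

theorem add (hu : BoundedSeq u) (hv : BoundedSeq v) : BoundedSeq fun n x => u n x + v n x := by
  obtain ⟨C, hC⟩ := hu.bound
  obtain ⟨D, hD⟩ := hv.bound
  exact ⟨fun n => (hu.measurable n).add (hv.measurable n), C + D, fun n x =>
    (abs_add_le _ _).trans (add_le_add (hC n x) (hD n x))⟩

theorem mul (hu : BoundedSeq u) (hv : BoundedSeq v) : BoundedSeq fun n x => u n x * v n x := by
  obtain ⟨C, hC⟩ := hu.bound
  obtain ⟨D, hD⟩ := hv.bound
  refine ⟨fun n => (hu.measurable n).mul (hv.measurable n), C * D, fun n x => ?_⟩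
  rw [abs_mul]
  exact mul_le_mul (hC n x) (hD n x) (abs_nonneg _) ((abs_nonneg _).trans (hC n x))

theorem const_mul (hu : BoundedSeq u) (c : ℝ) : BoundedSeq fun n x => c * u n x :=
  (const c).mul hu

theorem sub (hu : BoundedSeq u) (hv : BoundedSeq v) : BoundedSeq fun n x => u n x - v n x := by
  have := hu.add (hv.const_mul (-1))
  simpa [sub_eq_add_neg] using this

theorem comp_index (hu : BoundedSeq u) (f : ℕ → ℕ) : BoundedSeq fun n x => u (f n) x := by
  obtain ⟨C, hC⟩ := hu.bound
  exact ⟨fun n => hu.measurable _, C, fun n x => hC _ x⟩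

theorem comp {Y : Type*} [MeasurableSpace Y] {π : Y → X} (hu : BoundedSeq u) (hπ : Measurable π) :
    BoundedSeq fun n y => u n (π y) := by
  obtain ⟨C, hC⟩ := hu.bound
  exact ⟨fun n => (hu.measurable n).comp hπ, C, fun n x => hC _ _⟩

theorem integrable (hret : Measurable ret) (hi : Integrable (fun x => (ret x : ℝ)) μ)
    (hu : BoundedSeq u) : Integrable (towerSum ret u) μ :=
  integrable_towerSum hret hi hu.measurable hu.bound.choose_spec

theorem integral_add (hret : Measurable ret) (hi : Integrable (fun x => (ret x : ℝ)) μ)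
    (hu : BoundedSeq u) (hv : BoundedSeq v) :
    ∫ x, towerSum ret (fun n x => u n x + v n x) x ∂μ =
      ∫ x, towerSum ret u x ∂μ + ∫ x, towerSum ret v x ∂μ := by
  rw [← MeasureTheory.integral_add (hu.integrable hret hi) (hv.integrable hret hi)]
  simp only [towerSum, Finset.sum_add_distrib]

theorem abs_integral_le (hret : Measurable ret) (hi : Integrable (fun x => (ret x : ℝ)) μ)
    (hu : BoundedSeq u) (hv : BoundedSeq v)
    (h : ∀ l x, l < ret x → |u l x| ≤ v l x) :
    |∫ x, towerSum ret u x ∂μ| ≤ ∫ x, towerSum ret v x ∂μ := by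
  refine abs_integral_le_integral_abs.trans (integral_mono (hu.integrable hret hi).abs
    (hv.integrable hret hi) fun x => ?_)
  exact (Finset.abs_sum_le_sum_abs _ _).trans
    (Finset.sum_le_sum fun l hl => h l x (Finset.mem_range.1 hl))

end BoundedSeq

theorem integral_towerSum_const_mul (c : ℝ) :
    ∫ x, towerSum ret (fun n x => c * u n x) x ∂μ = c * ∫ x, towerSum ret u x ∂μ := by
  rw [← integral_const_mul]
  simp only [towerSum, Finset.mul_sum]

theorem integral_towerSum_const (c : ℝ) :
    ∫ x, towerSum ret (fun _ _ => c) x ∂μ = c * ∫ x, (ret x : ℝ) ∂μ := by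
  rw [← integral_const_mul]
  simp [towerSum, mul_comm]

theorem integral_towerSum_comp {Y : Type*} [MeasurableSpace Y] {ν : Measure Y} {π : Y → X}
    (hπ : MeasurePreserving π ν μ) (hret : Measurable ret) (hu : BoundedSeq u) :
    ∫ y, towerSum (fun y => ret (π y)) (fun l y => u l (π y)) y ∂ν = ∫ x, towerSum ret u x ∂μ := by
  have := integral_map (μ := ν) hπ.measurable.aemeasurable (f := towerSum ret u)
    (measurable_towerSum hret hu.measurable).aestronglyMeasurable
  rw [hπ.map_eq] at this
  exact this.symm

end BoundedSeq

/-! ### Approximable observables and their decorrelation. -/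

namespace FullBranchMap

section Decorrelation

variable {X A : Type*} [MeasurableSpace X] {S : FullBranchMap X A} {θ R : ℝ} {τ : A → ℕ}

/-- A cone density of total mass `1` lies between `e^(-R)` and `e^R`. This transfers the hypotheses
on return times from the invariant measure to the reference measure. -/
theorem HasDensities.measureReal_le [Countable A] {μ : Measure X} [IsProbabilityMeasure μ]
    (hμ : S.HasDensities θ R μ) (P : A → Prop) :
    μ.real {x | P (S.sym x)} ≤ Real.exp R * S.m.real {x | P (S.sym x)} ∧
      S.m.real {x | P (S.sym x)} ≤ Real.exp R * μ.real {x | P (S.sym x)} := by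
  classical
  obtain ⟨h, hh, hint⟩ := hμ 1
  have h1 : ∫ x, h x ∂S.m = 1 := by
    have := hint (fun _ => 1) 1 (fun _ _ _ => rfl) (by simp)
    simpa using this.symm
  have hP : MeasurableSet {x | P (S.sym x)} :=
    measurableSet_setOfPred.2 (measurable_to_prop (by
      have := S.measurable_comp_sym P
      exact this (measurableSet_singleton _)))
  have h2 : μ.real {x | P (S.sym x)} = ∫ x in {x | P (S.sym x)}, h x ∂S.m := by
    have hd : S.DependsOn 1 fun x => if P (S.sym x) then (1 : ℝ) else 0 :=
      dependsOn_sym fun a => if P a then (1 : ℝ) else 0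
    have h3 := hint _ 1 hd fun x => by split_ifs <;> simp
    rw [← integral_indicator hP, ← integral_indicator_one hP]
    refine Eq.trans ?_ (h3.trans ?_)
    all_goals
      refine integral_congr_ae (Filter.Eventually.of_forall fun x => ?_)
      by_cases hx : P (S.sym x) <;> simp [hx]
  rw [h2]
  constructor
  · have := setIntegral_mono (s := {x | P (S.sym x)}) hh.integrable.integrableOn
      (integrable_const (Real.exp R)).integrableOn fun x => by
        have := hh.le_integral x
        rwa [h1, mul_one] at this
    simpa [mul_comm] using this
  · have := setIntegral_mono (s := {x | P (S.sym x)})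
      (integrable_const (1 : ℝ)).integrableOn (hh.integrable.const_mul (Real.exp R)).integrableOn
        fun x => by
          have := hh.integral_le x
          rwa [h1] at this
    rw [integral_const_mul] at this
    simpa using this

variable (S) in
/-- A sequence of observables on the tower over an extension `Y` of `X` that is well approximated,
after many returns, by functions of finitely many symbols. -/
structure Approximable {Y : Type*} [MeasurableSpace Y] (τ : A → ℕ) (FY : Y → Y) (π : Y → X)
    (θ C : ℝ) (v : ℕ → Y → ℝ) (a : ℝ) : Prop where
  seq : IsTowerSeq FY (fun y => τ (S.sym (π y))) 1 v
  measurable : ∀ n, Measurable (v n)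
  bound : ∀ n y, |v n y| ≤ a
  approx : ∀ k, ∃ (N : ℕ) (V : ℕ → X → ℝ), (∀ l, S.DependsOn N (V l)) ∧ (∀ l x, |V l x| ≤ a) ∧
    (∀ l y, l < τ (S.sym (π y)) → |v (k + l) y - V l (π y)| ≤
      C * a * θ ^ numReturns S.F (fun x => τ (S.sym x)) (k + l) (π y)) ∧
    ∀ l n x y, l < τ (S.sym x) →
      S.Agree (numReturns S.F (fun x => τ (S.sym x)) (k + l) x + 1 + n) x y →
      |V l x - V l y| ≤ C * a * θ ^ n

theorem Approximable.boundedSeq {Y : Type*} [MeasurableSpace Y] {FY : Y → Y} {π : Y → X}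
    {C a : ℝ} {v : ℕ → Y → ℝ} (h : S.Approximable τ FY π θ C v a) : BoundedSeq v :=
  ⟨h.measurable, a, h.bound⟩

/-- An approximation known only on the levels of the tower extends to all times, because both sides
follow the tower map. -/
theorem abs_sub_towerLift_le {Y : Type*} [MeasurableSpace Y] {FY : Y → Y} {π : Y → X}
    (hπ : ∀ y, π (FY y) = S.F (π y)) (hτ : ∀ a, 1 ≤ τ a) {w : ℕ → Y → ℝ}
    (hw : IsTowerSeq FY (fun y => τ (S.sym (π y))) 1 w) {k : ℕ} {V : ℕ → X → ℝ} {C : ℝ}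
    {e : ℕ → X → ℝ}
    (h : ∀ l y, l < τ (S.sym (π y)) → |w (k + l) y - V l (π y)| ≤ C * e l (π y)) (n : ℕ) (y : Y) :
    |w (k + n) y - towerLift S.F (fun x => τ (S.sym x)) V n (π y)| ≤
      C * towerLift S.F (fun x => τ (S.sym x)) e n (π y) := by
  induction n using Nat.strong_induction_on generalizing y with
  | _ n ih =>
  rcases lt_or_ge n (τ (S.sym (π y))) with hn | hn
  · rw [towerLift_of_lt (ret := fun x => τ (S.sym x)) V hn,
      towerLift_of_lt (ret := fun x => τ (S.sym x)) e hn]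
    exact h n y hn
  · have h1 := hτ (S.sym (π y))
    rw [towerLift_of_le (ret := fun x => τ (S.sym x)) V (fun x => hτ _) hn,
      towerLift_of_le (ret := fun x => τ (S.sym x)) e (fun x => hτ _) hn, hw (k + n) y (by dsimp only; omega),
      ← hπ, one_mul, show k + n - τ (S.sym (π y)) = k + (n - τ (S.sym (π y))) by omega]
    exact ih _ (by omega) _

end Decorrelation

end FullBranchMap


namespace FullBranchMap

/-- Both observables are read `k = n / 2` steps later and replaced by functions of finitely many
symbols, at the price of the mean of `θ ^ (number of returns)`. The second function, minus its limit
`wi`, is a tower sequence with decay on the base. The first acts as a weight that is regular after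
the returns made in `k` steps, and `d = n - k` steps remain for the decay. -/
theorem exists_decorrelation {ι : Type} {r₀ r₁ : ι → ℝ → ℕ → ℝ} (hr : RatePair r₀ r₁)
    {L δ θ K C : ℝ} (hL : 1 ≤ L) (hδ : 0 < δ) (hδ1 : δ ≤ 1) (N : ℕ) (hθ : 0 < θ) (hθ1 : θ < 1)
    (hK : 0 ≤ K) (hC : 0 < C) :
    ∃ L', 1 ≤ L' ∧ ∀ (i : ι) {X A : Type*} [MeasurableSpace X] [Countable A]
      (S : FullBranchMap X A) (τ : A → ℕ), S.Distortion θ K → (∀ a, 1 ≤ τ a) →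
      ∀ (μ : Measure X) [IsProbabilityMeasure μ], MeasurePreserving S.F μ μ →
      S.HasDensities θ (K / (1 - θ)) μ → (∀ n, μ.real {x | n < τ (S.sym x)} ≤ r₀ i L n) →
      ∀ I : Finset ℕ, (∀ k ∈ I, 0 < k ∧ k ≤ N) → I.gcd id = 1 →
      (∀ k ∈ I, δ ≤ μ.real {x | τ (S.sym x) = k}) →
      ∀ {Y : Type*} [MeasurableSpace Y] (FY : Y → Y) (π : Y → X) (ν : Measure Y)
      [IsProbabilityMeasure ν], MeasurePreserving FY ν ν → MeasurePreserving π ν μ →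
      (∀ y, π (FY y) = S.F (π y)) → ∀ (v w : ℕ → Y → ℝ) (a b : ℝ),
      S.Approximable τ FY π θ C v a → S.Approximable τ FY π θ C w b → ∀ n,
      |∫ y, towerSum (fun y => τ (S.sym (π y))) (fun l y => v l y * w (l + n) y) y ∂ν -
        (∫ y, towerSum (fun y => τ (S.sym (π y))) v y ∂ν) *
          (∫ y, towerSum (fun y => τ (S.sym (π y))) w y ∂ν) /
            ∫ y, (τ (S.sym (π y)) : ℝ) ∂ν| ≤ a * b * r₁ i L' n := by
  -- The fixed point of `R ↦ K + θ R`, that is the regularity of invariant densities; any larger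
  -- constant is strictly contracted, here `C + R₂`.
  set R₂ := K / (1 - θ) with hR₂
  have hθ' : 0 < 1 - θ := by linarith
  have hR₂0 : 0 ≤ R₂ := div_nonneg hK hθ'.le
  have hR₂' : K + θ * R₂ = R₂ := by
    rw [hR₂]; field_simp; ring
  have hRlt : K + θ * (C + R₂) < C + R₂ := by nlinarith
  have hR0 : 0 < C + R₂ := by linarith
  obtain ⟨L₁, hL₁, hsc⟩ := hr.fst.scale L hL (Real.exp R₂)
  obtain ⟨L₂, hL₂, hbase⟩ := exists_base_decay hr hL₁ (δ := Real.exp (-R₂) * δ) (by positivity)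
    (mul_le_one₀ (by simpa using hR₂0) hδ.le hδ1) N hθ.le hθ1.le hK hRlt hR0
  obtain ⟨L₃, hL₃, hret⟩ := exists_returns_decay hr.fst hL₁ hθ.le hθ1 hRlt.le
  obtain ⟨L₄, hL₄, hfst⟩ := hr.exists_fst_le hL₃
  set L₅ := max L (max L₂ L₄) with hL₅d
  have hL₅ : 1 ≤ L₅ := le_max_of_le_left hL
  obtain ⟨L₆, hL₆, htower⟩ := exists_tower_decay hr hL₅
  obtain ⟨L₇, hL₇, hhalf⟩ := hr.snd.half L₆ hL₆
  obtain ⟨L₈, hL₈, hsc'⟩ := hr.snd.scale L₇ hL₇ (4 * C + 12)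
  refine ⟨L₈, hL₈, fun i X A _ _ S τ hJ hτ μ _ hF hμ htail I hI hIg hIδ Y _ FY π ν _ hFY hπ hπF v w
    a b hv hw n => ?_⟩
  -- tails and mixing for the reference measure
  have htailm : ∀ n, S.m.real {x | n < τ (S.sym x)} ≤ r₀ i L₁ n := fun n =>
    ((hμ.measureReal_le fun s => n < τ s).2.trans
      (mul_le_mul_of_nonneg_left (htail n) (Real.exp_pos _).le)).trans (hsc i n)
  have hIδm : ∀ k ∈ I, Real.exp (-R₂) * δ ≤ S.m.real {x | τ (S.sym x) = k} := fun k hk => by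
    have := (hIδ k hk).trans (hμ.measureReal_le fun s => τ s = k).1
    rw [Real.exp_neg, inv_mul_le_iff₀ (Real.exp_pos _)]
    exact this
  have htail₅ : ∀ n, μ.real {x | n < τ (S.sym x)} ≤ r₀ i L₅ n := fun n =>
    (htail n).trans (hr.fst.mono i L L₅ n hL (le_max_left _ _))
  have hr₅ : ∀ L, 1 ≤ L → L ≤ L₅ → ∀ n, min 1 (r₁ i L n) ≤ min 1 (r₁ i L₅ n) := fun L h1 h2 n =>
    min_le_min le_rfl (hr.snd.mono i L L₅ n h1 h2)
  obtain ⟨y₀⟩ : Nonempty Y := Measure.nonempty_of_neZero ν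
  have ha : 0 ≤ a := (abs_nonneg _).trans (hv.bound 0 y₀)
  have hb : 0 ≤ b := (abs_nonneg _).trans (hw.bound 0 y₀)
  -- the splitting of the time interval
  set k := n / 2 with hk
  set d := n - k with hd
  obtain ⟨NV, V, hVd, hVb, hVe, hVr⟩ := hv.approx k
  obtain ⟨NW, W₀, hWd₀, hWb₀, hWe₀, -⟩ := hw.approx k
  set ret : X → ℕ := fun x => τ (S.sym x) with hretd
  have hret1 : ∀ x, 1 ≤ ret x := fun x => hτ _
  have hretm : Measurable ret := S.measurable_comp_sym τ
  set W := towerLift S.F ret W₀ with hW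
  have hWs : IsTowerSeq S.F ret 1 W := isTowerSeq_towerLift hret1 W₀
  have hWd : ∀ l, S.DependsOn (l + 1 + NW) (W l) :=
    DependsOn.towerLift hτ fun l => (hWd₀ l).mono (by omega)
  have hWb : ∀ l x, |W l x| ≤ b := fun l x => by
    have := towerLift_mem (F := S.F) (b := W₀) (s := Icc (-b) b) hret1
      (fun l x _ => abs_le.1 (hWb₀ l x)) l x
    exact abs_le.2 this
  obtain ⟨wi, hwi, hdec⟩ := hbase i S τ hJ hτ htailm I hI hIg hIδm W b
    (fun l => (hWd l).measurable) hWb hWs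
  -- the deviation from the limit
  set U : ℕ → X → ℝ := fun l x => W l x - wi with hU
  have hUs : IsTowerSeq S.F ret 1 U := fun l x h => by
    simp only [hU, one_mul]
    rw [hWs l x h, one_mul]
  have hUd : ∀ l, ∃ N, S.DependsOn N (U l) := fun l => ⟨l + 1 + NW, fun x y hxy => by
    simp only [hU, hWd l x y hxy]⟩
  have hUb : ∀ l x, |U l x| ≤ 2 * b := fun l x =>
    (abs_sub _ _).trans (by linarith [hWb l x])
  have hUm : ∀ l, Measurable (U l) := fun l => (hUd l).choose_spec.measurable
  have hUc : ∀ l g, S.Cone θ (C + R₂) g → |∫ x, g x * U l x ∂S.m| ≤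
      2 * b * min 1 (r₁ i L₅ l) * ∫ x, g x ∂S.m := fun l g hg => by
    obtain ⟨B, hB⟩ := hg.exists_bound
    have hgW : Integrable (fun x => g x * W l x) S.m :=
      integrable_of_abs_le (C := B * b) (hg.measurable.mul (hWd l).measurable) fun x => by
        rw [abs_mul]
        exact mul_le_mul (hB x) (hWb l x) (abs_nonneg _) ((abs_nonneg _).trans (hB x))
    have h1 : ∫ x, g x * U l x ∂S.m = ∫ x, g x * W l x ∂S.m - (∫ x, g x ∂S.m) * wi := by
      rw [← integral_mul_const, ← integral_sub hgW (hg.integrable.mul_const _)]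
      simp only [hU, mul_sub]
    have hg0 := hg.integral_nonneg
    have h2 : |∫ x, g x * U l x ∂S.m| ≤ 2 * b * r₁ i L₂ l * ∫ x, g x ∂S.m := by
      rw [h1]
      refine (hdec l g hg).trans ?_
      have h3 : 0 ≤ b * (∫ x, g x ∂S.m) * r₁ i L₂ l :=
        mul_nonneg (mul_nonneg hb hg0) (hr.snd.nonneg i L₂ l hL₂)
      linarith
    have h3 : |∫ x, g x * U l x ∂S.m| ≤ 2 * b * 1 * ∫ x, g x ∂S.m := by
      refine abs_integral_le_integral_abs.trans ?_
      rw [mul_one, ← integral_const_mul]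
      refine integral_mono_of_nonneg (Filter.Eventually.of_forall fun x => abs_nonneg _)
        (hg.integrable.const_mul _) (Filter.Eventually.of_forall fun x => ?_)
      beta_reduce
      rw [abs_mul, abs_of_nonneg (hg.nonneg x), mul_comm]
      exact mul_le_mul_of_nonneg_right (hUb l x) (hg.nonneg x)
    have h4 : |∫ x, g x * U l x ∂S.m| ≤ 2 * b * min 1 (r₁ i L₂ l) * ∫ x, g x ∂S.m := by
      rcases min_cases 1 (r₁ i L₂ l) with h | h <;> rw [h.1] <;> assumption
    refine h4.trans (mul_le_mul_of_nonneg_right (mul_le_mul_of_nonneg_left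
      (hr₅ L₂ hL₂ (le_max_of_le_right (le_max_left _ _)) l) (by positivity)) hg0)
  -- number of returns
  set ψ := numReturns S.F ret with hψ
  set e₀ : ℕ → X → ℝ := fun l x => θ ^ ψ (k + l) x with he₀
  set P : ℕ → X → ℝ := fun l x => θ ^ ψ l x with hP
  have hPd : ∀ l, S.DependsOn (l + 1) (P l) := fun l x y hxy => by
    simp only [hP]
    rw [hψ, dependsOn_numReturns hτ l x y hxy]
  have hPb : ∀ l x, |P l x| ≤ 1 := fun l x => by
    simp only [hP]
    rw [abs_of_nonneg (by positivity)]
    exact pow_le_one₀ hθ.le hθ1.le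
  have hone : ∀ k, S.WeightRegular τ θ C k fun _ _ => 1 := fun k l m x y _ _ => by
    rw [mul_one]
    exact Real.one_le_exp (by positivity)
  have hε := htower i S τ θ K C R₂ hJ hτ hθ.le hR₂'.le μ hF hμ htail₅ P θ 1 hθ.le hθ1.le zero_le_one
    (isTowerSeq_pow_numReturns hret1 θ) (fun l => ⟨_, hPd l⟩) hPb
    (fun l g hg => by
      rw [abs_of_nonneg (integral_nonneg fun x => mul_nonneg (hg.nonneg x) (by positivity)), one_mul]
      refine (hret i S τ hJ hτ htailm l g hg).trans (mul_le_mul_of_nonneg_right ?_ hg.integral_nonneg)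
      exact (min_le_min le_rfl (hfst i l)).trans
        (hr₅ L₄ hL₄ (le_max_of_le_right (le_max_right _ _)) l))
    0 k (fun _ _ => 1) 1 (fun _ _ => ⟨zero_le_one, le_rfl⟩) (fun _ => ⟨0, fun _ _ _ => rfl⟩) (hone 0)
  have hT : ∀ (φ : ℕ → X → ℝ) (c : ℝ), (∀ l x, 0 ≤ φ l x ∧ φ l x ≤ c) →
      (∀ l, ∃ N, S.DependsOn N (φ l)) → S.WeightRegular τ θ C k φ →
      |∫ x, towerSum ret (fun l x => φ l x * U (k + l + d) x) x ∂μ| ≤ c * (2 * b) * r₁ i L₆ d :=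
    htower i S τ θ K C R₂ hJ hτ hθ.le hR₂'.le μ hF hμ htail₅ U 1 (2 * b) zero_le_one le_rfl
      (by positivity) hUs hUd hUb hUc k d
  -- passage to the extension
  set retY : Y → ℕ := fun y => τ (S.sym (π y)) with hretY
  have hretYm : Measurable retY := hretm.comp hπ.measurable
  have hi : Integrable (fun x => (ret x : ℝ)) μ :=
    integrable_ret hretm (hr.summable_of_le hL i (fun n => measureReal_nonneg) htail)
  have hiY : Integrable (fun y => (retY y : ℝ)) ν := hπ.integrable_comp_of_integrable hi
  set T := ∫ y, (retY y : ℝ) ∂ν with hTd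
  have hT1 : 1 ≤ T := by
    have := integral_mono (integrable_const (1 : ℝ)) hiY fun y => by
      show (1 : ℝ) ≤ retY y
      exact_mod_cast hτ (S.sym (π y))
    simpa using this
  set e := towerLift S.F ret e₀ with he
  have hed : ∀ l, S.DependsOn (l + 1 + k) (e l) :=
    DependsOn.towerLift hτ fun l => (by
      have := hPd (k + l)
      rwa [show k + l + 1 = l + 1 + k by ring] at this)
  have heb : ∀ l x, |e l x| ≤ 1 := fun l x => by
    have := towerLift_mem (F := S.F) (b := e₀) (s := Icc (-1) 1) hret1
      (fun l x _ => abs_le.1 (hPb (k + l) x)) l x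
    exact abs_le.2 this
  have hem : ∀ l, Measurable (e l) := fun l => (hed l).measurable
  have hes : IsTowerSeq S.F ret 1 e := isTowerSeq_towerLift hret1 e₀
  have bP : BoundedSeq fun l x => P (k + l) x :=
    ⟨fun l => (hPd _).measurable, 1, fun l x => hPb _ x⟩
  have be : BoundedSeq e := ⟨hem, 1, heb⟩
  set ε := ∫ x, towerSum ret (fun l x => P (k + l) x) x ∂μ with hεd
  have hε' : ε ≤ r₁ i L₆ k := by
    have h1 : ∀ x, towerSum ret (fun l x => 1 * P (0 + l + k) x) x =
        towerSum ret (fun l x => P (k + l) x) x := fun x =>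
      Finset.sum_congr rfl fun l _ => by
        beta_reduce
        rw [one_mul, zero_add, add_comm l k]
    rw [integral_congr_ae (Filter.Eventually.of_forall h1), one_mul, one_mul] at hε
    exact (le_abs_self _).trans hε
  have heε : ∫ y, towerSum retY (fun l y => e (n + l) (π y)) y ∂ν = ε := by
    have h1 : ∫ y, towerSum retY (fun l y => e (n + l) (π y)) y ∂ν =
        ∫ x, towerSum ret (fun l => e (n + l)) x ∂μ :=
      integral_towerSum_comp hπ hretm (be.comp_index fun l => n + l)
    rw [h1, integral_towerSum_shift hF hretm hi hes hem heb n]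
    refine integral_congr_ae (Filter.Eventually.of_forall fun x => ?_)
    refine Finset.sum_congr rfl fun l hl => ?_
    rw [he, towerLift_of_lt e₀ (Finset.mem_range.1 hl)]
  have hPε : ∫ y, towerSum retY (fun l y => P (k + l) (π y)) y ∂ν = ε :=
    integral_towerSum_comp hπ hretm bP
  -- the decomposition
  have bv := hv.boundedSeq
  have bw := hw.boundedSeq
  have bU : BoundedSeq U := ⟨hUm, 2 * b, hUb⟩
  have bV : BoundedSeq V := ⟨fun l => (hVd l).measurable, a, hVb⟩
  set α : ℕ → Y → ℝ := fun l y => v (k + l) y with hα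
  set B : ℕ → Y → ℝ := fun l y => U (k + l + d) (π y) with hB
  -- Adding `2 * a` makes the weight at least `a`, so that an additive modulus of continuity `C a θ
  -- ^ m` becomes the multiplicative one `exp (C θ ^ m)`.
  set φ : ℕ → X → ℝ := fun l x => V l x + 2 * a with hφ
  set E₁ : ℕ → Y → ℝ := fun l y => α l y - V l (π y) with hE₁
  set E₂ : ℕ → Y → ℝ := fun l y => w (k + l + n) y - W (k + l + d) (π y) with hE₂
  have bα : BoundedSeq α := bv.comp_index fun l => k + l
  have bUi : BoundedSeq fun l x => U (k + l + d) x := bU.comp_index fun l => k + l + d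
  have bB : BoundedSeq B := bUi.comp hπ.measurable
  have bφ : BoundedSeq φ := bV.add (BoundedSeq.const (2 * a))
  have bE₁ : BoundedSeq E₁ := bα.sub (bV.comp hπ.measurable)
  have bW : BoundedSeq W := ⟨fun l => (hWd l).measurable, b, hWb⟩
  have bE₂ : BoundedSeq E₂ := (bw.comp_index fun l => k + l + n).sub
    ((bW.comp_index fun l => k + l + d).comp hπ.measurable)
  have bφY : BoundedSeq fun l y => φ l (π y) := bφ.comp hπ.measurable
  have hE₂le : ∀ l y, |E₂ l y| ≤ C * b * e (n + l) (π y) := fun l y => by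
    have := abs_sub_towerLift_le (e := e₀) hπF hτ hw.seq hWe₀ (n + l) y
    simp only [hE₂]
    rw [show k + l + n = k + (n + l) by ring, show k + l + d = n + l by omega]
    exact this
  have hE₁le : ∀ l y, l < retY y → |E₁ l y| ≤ C * a * P (k + l) (π y) := fun l y hl => hVe l y hl
  have hBb : ∀ l y, |B l y| ≤ 2 * b := fun l y => hUb _ _
  have hPY : BoundedSeq fun l y => P (k + l) (π y) := bP.comp hπ.measurable
  have beY : BoundedSeq fun l y => e (n + l) (π y) :=
    (be.comp_index fun l => n + l).comp hπ.measurable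
  have j1 : |∫ y, towerSum retY (fun l y => α l y * E₂ l y) y ∂ν| ≤ a * (C * b) * ε := by
    refine ((bα.mul bE₂).abs_integral_le hretYm hiY (beY.const_mul (a * (C * b)))
      fun l y _ => ?_).trans (le_of_eq ?_)
    · rw [abs_mul, mul_assoc a]
      exact mul_le_mul (hv.bound _ y) (hE₂le l y) (abs_nonneg _) ha
    · rw [integral_towerSum_const_mul, heε]
  have j2 : |∫ y, towerSum retY E₂ y ∂ν| ≤ C * b * ε := by
    refine (bE₂.abs_integral_le hretYm hiY (beY.const_mul (C * b))
      fun l y _ => hE₂le l y).trans (le_of_eq ?_)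
    rw [integral_towerSum_const_mul, heε]
  have j3 : |∫ y, towerSum retY (fun l y => E₁ l y * B l y) y ∂ν| ≤ C * a * (2 * b) * ε := by
    refine ((bE₁.mul bB).abs_integral_le hretYm hiY (hPY.const_mul (C * a * (2 * b)))
      fun l y hl => ?_).trans (le_of_eq ?_)
    · rw [abs_mul]
      calc |E₁ l y| * |B l y| ≤ (C * a * P (k + l) (π y)) * (2 * b) :=
            mul_le_mul (hE₁le l y hl) (hBb l y) (abs_nonneg _) ((abs_nonneg _).trans (hE₁le l y hl))
        _ = _ := by ring
    · rw [integral_towerSum_const_mul, hPε]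
  have j4 : |∫ y, towerSum retY (fun l y => φ l (π y) * B l y) y ∂ν| ≤
      3 * a * (2 * b) * r₁ i L₆ d := by
    have h1 : ∫ y, towerSum retY (fun l y => φ l (π y) * B l y) y ∂ν =
        ∫ x, towerSum ret (fun l x => φ l x * U (k + l + d) x) x ∂μ :=
      integral_towerSum_comp hπ hretm (bφ.mul bUi)
    rw [h1]
    refine hT φ (3 * a) (fun l x => ?_) (fun l => ⟨NV, fun x y hxy => ?_⟩) fun l m x y hl hxy => ?_
    · have := abs_le.1 (hVb l x)
      simp only [hφ]
      constructor <;> linarith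
    · simp only [hφ, hVd l x y hxy]
    · have h2 := (abs_le.1 (hVr l m x y hl hxy)).2
      have h3 := abs_le.1 (hVb l y)
      have h4 := Real.add_one_le_exp (C * θ ^ m)
      have h5 : 0 ≤ C * θ ^ m := by positivity
      simp only [hφ]
      calc V l x + 2 * a ≤ (V l y + 2 * a) + C * θ ^ m * a := by linarith
        _ ≤ (V l y + 2 * a) + C * θ ^ m * (V l y + 2 * a) := by
            gcongr
            linarith
        _ = (C * θ ^ m + 1) * (V l y + 2 * a) := by ring
        _ ≤ _ := mul_le_mul_of_nonneg_right h4 (by linarith)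
  have j5 : |∫ y, towerSum retY B y ∂ν| ≤ 2 * b * r₁ i L₆ d := by
    have h1 : ∫ y, towerSum retY B y ∂ν = ∫ x, towerSum ret (fun l x => 1 * U (k + l + d) x) x ∂μ := by
      simp only [one_mul]
      exact integral_towerSum_comp hπ hretm bUi
    rw [h1]
    have := hT (fun _ _ => 1) 1 (fun _ _ => ⟨zero_le_one, le_rfl⟩) (fun _ => ⟨0, fun _ _ _ => rfl⟩)
      (hone k)
    rwa [one_mul] at this
  -- The product is again a tower sequence, so its integral can be shifted by `k` as well.
  have s1 : ∫ y, towerSum retY (fun l y => v l y * w (l + n) y) y ∂ν =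
      ∫ y, towerSum retY (fun l y => α l y * w (k + l + n) y) y ∂ν := by
    refine (integral_towerSum_shift (U := fun l y => v l y * w (l + n) y) (C := a * b) hFY hretYm hiY
      (fun l y h => ?_) (fun l => (hv.measurable _).mul (hw.measurable _)) (fun l y => ?_) k).symm
    · have h1 := hv.seq l y h
      have h2 := hw.seq (l + n) y (h.trans (Nat.le_add_right _ _))
      beta_reduce at h1 h2 ⊢
      rw [h1, h2, show l + n - retY y = l - retY y + n from Nat.sub_add_comm h]
      ring
    · rw [abs_mul]
      exact mul_le_mul (hv.bound _ y) (hw.bound _ y) (abs_nonneg _) ha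
  have s2 : ∫ y, towerSum retY v y ∂ν = ∫ y, towerSum retY α y ∂ν :=
    (integral_towerSum_shift hFY hretYm hiY hv.seq hv.measurable hv.bound k).symm
  have s3 : ∫ y, towerSum retY w y ∂ν = ∫ y, towerSum retY (fun l y => w (k + l + n) y) y ∂ν := by
    rw [← integral_towerSum_shift hFY hretYm hiY hw.seq hw.measurable hw.bound (k + n)]
    refine integral_congr_ae (Filter.Eventually.of_forall fun y => ?_)
    exact Finset.sum_congr rfl fun l _ => by
      beta_reduce
      rw [show k + n + l = k + l + n by ring]
  -- Replace `w` by `W = U + wi`, then `v` by `V = φ - 2 * a`. The last term is the product of means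
  -- up to the terms in `d2`, where `wi` is compared with the mean of `w`.
  have d1 : ∫ y, towerSum retY (fun l y => α l y * w (k + l + n) y) y ∂ν =
      ∫ y, towerSum retY (fun l y => α l y * E₂ l y) y ∂ν +
      ∫ y, towerSum retY (fun l y => E₁ l y * B l y) y ∂ν +
      ∫ y, towerSum retY (fun l y => φ l (π y) * B l y) y ∂ν +
      -(2 * a) * ∫ y, towerSum retY B y ∂ν + wi * ∫ y, towerSum retY α y ∂ν := by
    rw [← integral_towerSum_const_mul, ← integral_towerSum_const_mul,
      ← (bα.mul bE₂).integral_add hretYm hiY (bE₁.mul bB),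
      ← ((bα.mul bE₂).add (bE₁.mul bB)).integral_add hretYm hiY (bφY.mul bB),
      ← (((bα.mul bE₂).add (bE₁.mul bB)).add (bφY.mul bB)).integral_add hretYm hiY
        (bB.const_mul (-(2 * a))),
      ← ((((bα.mul bE₂).add (bE₁.mul bB)).add (bφY.mul bB)).add
        (bB.const_mul (-(2 * a)))).integral_add hretYm hiY (bα.const_mul wi)]
    refine integral_congr_ae (Filter.Eventually.of_forall fun y => ?_)
    refine Finset.sum_congr rfl fun l _ => ?_
    simp only [hE₁, hE₂, hφ, hB, hU]
    ring
  have d2 : ∫ y, towerSum retY (fun l y => w (k + l + n) y) y ∂ν =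
      ∫ y, towerSum retY E₂ y ∂ν + ∫ y, towerSum retY B y ∂ν + wi * T := by
    rw [hTd, ← integral_towerSum_const, ← bE₂.integral_add hretYm hiY bB,
      ← (bE₂.add bB).integral_add hretYm hiY (BoundedSeq.const wi)]
    refine integral_congr_ae (Filter.Eventually.of_forall fun y => ?_)
    refine Finset.sum_congr rfl fun l _ => ?_
    simp only [hE₂, hB, hU]
    ring
  have hq : |(∫ y, towerSum retY α y ∂ν) / T| ≤ a := by
    rw [abs_div, abs_of_pos (by linarith : 0 < T), div_le_iff₀ (by linarith)]
    refine (bα.abs_integral_le hretYm hiY (BoundedSeq.const a)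
      fun l y _ => hv.bound _ y).trans (le_of_eq ?_)
    rw [integral_towerSum_const]
  rw [s1, s2, s3, d1, d2]
  set q := (∫ y, towerSum retY α y ∂ν) / T with hqd
  have hqT : ∫ y, towerSum retY α y ∂ν = q * T := by
    rw [hqd]; field_simp
  generalize (∫ y, towerSum retY (fun l y => α l y * E₂ l y) y ∂ν) = J₁ at *
  generalize (∫ y, towerSum retY E₂ y ∂ν) = J₂ at *
  generalize (∫ y, towerSum retY (fun l y => E₁ l y * B l y) y ∂ν) = J₃ at *
  generalize (∫ y, towerSum retY (fun l y => φ l (π y) * B l y) y ∂ν) = J₄ at *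
  generalize (∫ y, towerSum retY B y ∂ν) = J₅ at *
  have hT0 : T ≠ 0 := by linarith
  rw [hqT]
  have hfin : J₁ + J₃ + J₄ + -(2 * a) * J₅ + wi * (q * T) - q * T * (J₂ + J₅ + wi * T) / T =
      J₁ + J₃ + J₄ - 2 * a * J₅ - q * (J₂ + J₅) := by
    field_simp
    ring
  rw [hfin]
  have hdk : r₁ i L₆ d ≤ r₁ i L₆ k := hr.snd.anti i L₆ hL₆ (by omega)
  have hk' : r₁ i L₆ k ≤ r₁ i L₇ n := hhalf i n
  have j6 : |q * (J₂ + J₅)| ≤ a * (C * b * ε + 2 * b * r₁ i L₆ d) := by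
    rw [abs_mul]
    exact mul_le_mul hq ((abs_add_le _ _).trans (add_le_add j2 j5)) (abs_nonneg _) ha
  have j7 : |2 * a * J₅| ≤ 2 * a * (2 * b * r₁ i L₆ d) := by
    rw [abs_mul, abs_of_nonneg (by positivity : 0 ≤ 2 * a)]
    gcongr
  have j8 : |J₁ + J₃ + J₄ - 2 * a * J₅ - q * (J₂ + J₅)| ≤
      |J₁| + |J₃| + |J₄| + |2 * a * J₅| + |q * (J₂ + J₅)| :=
    (abs_sub _ _).trans (add_le_add ((abs_sub _ _).trans (add_le_add (abs_add_three _ _ _) le_rfl))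
      le_rfl)
  refine j8.trans ?_
  -- The approximation errors contribute `1 + 2 + 1` times `C`, the decay terms `6 + 4 + 2`.
  have h9 : |J₁| + |J₃| + |J₄| + |2 * a * J₅| + |q * (J₂ + J₅)| ≤
      4 * C * (a * b) * ε + 12 * (a * b) * r₁ i L₆ d := by linarith
  refine h9.trans ?_
  have hab : 0 ≤ a * b := mul_nonneg ha hb
  calc 4 * C * (a * b) * ε + 12 * (a * b) * r₁ i L₆ d ≤
        4 * C * (a * b) * r₁ i L₇ n + 12 * (a * b) * r₁ i L₇ n := by
        gcongr
        · exact hε'.trans hk'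
        · exact hdk.trans hk'
    _ = a * b * ((4 * C + 12) * r₁ i L₇ n) := by ring
    _ ≤ _ := mul_le_mul_of_nonneg_left (hsc' i n) hab

end FullBranchMap


/-! ### Regularity of the invariant density on cylinders. -/

namespace FullBranchMap

section Density

variable {X A : Type*} [MeasurableSpace X] {S : FullBranchMap X A} {θ K R : ℝ}

variable (S) in
/-- The first `n` symbols of `x`. -/
def itinerary (n : ℕ) (x : X) (i : Fin n) : A := S.sym (S.F^[i] x)

theorem itinerary_eq_iff {n : ℕ} {x y : X} :
    S.itinerary n x = S.itinerary n y ↔ S.Agree n x y := by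
  rw [funext_iff, Fin.forall_iff]
  rfl

variable [Countable A]

theorem measurableSet_itinerary {n : ℕ} (t : Set (Fin n → A)) :
    MeasurableSet (S.itinerary n ⁻¹' t) := by
  have h : ∀ s : Fin n → A, MeasurableSet (S.itinerary n ⁻¹' {s}) := fun s => by
    have : S.itinerary n ⁻¹' {s} = ⋂ i : Fin n, S.F^[i] ⁻¹' (S.sym ⁻¹' {s i}) := by
      ext x
      simp [funext_iff, itinerary]
    rw [this]
    exact MeasurableSet.iInter fun i => (S.measurable_F.iterate i) (S.measurableSet_sym _)
  have h2 := MeasurableSet.biUnion t.to_countable fun s _ => h s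
  rwa [← preimage_iUnion₂, biUnion_of_singleton] at h2

variable (S) in
/-- The filtration generated by the symbols. -/
def symbolFiltration : Filtration ℕ ‹MeasurableSpace X› where
  seq n := MeasurableSpace.comap (S.itinerary n) ⊤
  mono' := by
    intro n k hnk s hs
    obtain ⟨t, -, rfl⟩ := hs
    refine ⟨(fun σ (i : Fin n) => σ (Fin.castLE hnk i)) ⁻¹' t, trivial, ?_⟩
    rw [← preimage_comp]
    rfl
  le' n := by
    rintro s ⟨t, -, rfl⟩
    exact measurableSet_itinerary t

theorem measurableSet_symbolFiltration_iff {n : ℕ} {s : Set X} :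
    MeasurableSet[S.symbolFiltration n] s ↔ ∃ t : Set (Fin n → A), S.itinerary n ⁻¹' t = s :=
  ⟨fun ⟨t, _, h⟩ => ⟨t, h⟩, fun ⟨t, h⟩ => ⟨t, trivial, h⟩⟩

theorem dependsOn_of_measurable {n : ℕ} {f : X → ℝ} (hf : Measurable[S.symbolFiltration n] f) :
    S.DependsOn n f := fun x y hxy => by
  obtain ⟨t, ht⟩ := measurableSet_symbolFiltration_iff.1 (hf (measurableSet_singleton (f x)))
  have hx : x ∈ S.itinerary n ⁻¹' t := by rw [ht]; rfl
  have hy : y ∈ S.itinerary n ⁻¹' t := by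
    rw [mem_preimage, ← itinerary_eq_iff.2 hxy]; exact hx
  rw [ht] at hy
  exact (hy : f y = f x).symm

/-- Conditional expectations of the density on finitely many symbols converge in `L¹` to its
projection on the σ-algebra generated by all symbols, which has the same integral as the density
over every cylinder. A truncation makes the approximation bounded, uniformly over all cylinder sets.
-/
theorem exists_dependsOn_approx {μ : Measure X} [IsProbabilityMeasure μ] (hμ : μ ≪ S.m) {ε : ℝ}
    (hε : 0 < ε) : ∃ (M : ℕ) (f : X → ℝ) (C : ℝ), S.DependsOn M f ∧ (∀ x, 0 ≤ f x ∧ f x ≤ C) ∧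
      ∀ n (t : Set (Fin n → A)),
        |μ.real (S.itinerary n ⁻¹' t) - ∫ x in S.itinerary n ⁻¹' t, f x ∂S.m| ≤ ε := by
  set ℱ := S.symbolFiltration with hℱ
  set g : X → ℝ := fun x => (μ.rnDeriv S.m x).toReal with hg
  have hgi : Integrable g S.m := Measure.integrable_toReal_rnDeriv
  have hg0 : 0 ≤ᵐ[S.m] g := Filter.Eventually.of_forall fun x => ENNReal.toReal_nonneg
  have hle : (⨆ n, ℱ n) ≤ ‹MeasurableSpace X› := iSup_le fun n => ℱ.le n
  set q := S.m[g | ⨆ n, ℱ n] with hq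
  have hqi : Integrable q S.m := integrable_condExp
  have hq0 : 0 ≤ᵐ[S.m] q := condExp_nonneg hg0
  obtain ⟨M, hM⟩ : ∃ M, eLpNorm (S.m[g | ℱ M] - q) 1 S.m < ENNReal.ofReal (ε / 2) := by
    have := (tendsto_eLpNorm_condExp (μ := S.m) (ℱ := ℱ) g).eventually
      (gt_mem_nhds (show (0 : ℝ≥0∞) < ENNReal.ofReal (ε / 2) by simpa using hε))
    exact this.exists
  set p := S.m[g | ℱ M] with hp
  have hpi : Integrable p S.m := integrable_condExp
  have hpm : Measurable[ℱ M] p := stronglyMeasurable_condExp.measurable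
  have hpd : S.DependsOn M p := dependsOn_of_measurable hpm
  have h1 : ∫ x, |p x - q x| ∂S.m ≤ ε / 2 := by
    have h := integral_norm_eq_lintegral_enorm (hpi.sub hqi).aestronglyMeasurable
    rw [← eLpNorm_one_eq_lintegral_enorm] at h
    have h' : ∫ x, |p x - q x| ∂S.m = (eLpNorm (p - q) 1 S.m).toReal := h
    rw [h']
    exact ENNReal.toReal_le_of_le_ofReal (by positivity) hM.le
  obtain ⟨B, hB⟩ : ∃ B : ℕ, ∫ x, (|p x| - min |p x| B) ∂S.m < ε / 2 := by
    have hlim : Filter.Tendsto (fun B : ℕ => ∫ x, (|p x| - min |p x| B) ∂S.m) Filter.atTop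
        (nhds (∫ _, (0 : ℝ) ∂S.m)) := by
      refine tendsto_integral_of_dominated_convergence (fun x => |p x|) (fun B => ?_) hpi.abs
        (fun B => Filter.Eventually.of_forall fun x => ?_) (Filter.Eventually.of_forall fun x => ?_)
      · exact (hpi.abs.sub (hpi.abs.inf (integrable_const _))).aestronglyMeasurable
      · have h2 : 0 ≤ min |p x| (B : ℝ) := le_min (abs_nonneg _) (Nat.cast_nonneg _)
        rw [Real.norm_eq_abs, abs_of_nonneg (sub_nonneg.2 (min_le_left _ _))]
        linarith
      · obtain ⟨B₀, hB₀⟩ := exists_nat_ge |p x|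
        refine tendsto_const_nhds.congr' ?_
        filter_upwards [Filter.eventually_ge_atTop B₀] with B hB
        rw [min_eq_left (hB₀.trans (by exact_mod_cast hB)), sub_self]
    rw [integral_zero] at hlim
    exact (hlim.eventually (gt_mem_nhds (half_pos hε))).exists
  set f : X → ℝ := fun x => min |p x| B with hf
  have hfi : Integrable f S.m := hpi.abs.inf (integrable_const _)
  refine ⟨M, f, B, fun x y hxy => ?_, fun x => ⟨le_min (abs_nonneg _) (Nat.cast_nonneg _),
    min_le_right _ _⟩, fun n t => ?_⟩
  · simp only [hf, hpd x y hxy]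
  set E := S.itinerary n ⁻¹' t with hE
  have hEm : MeasurableSet[ℱ n] E := measurableSet_symbolFiltration_iff.2 ⟨t, rfl⟩
  have h2 : μ.real E = ∫ x in E, q x ∂S.m := by
    rw [hq, setIntegral_condExp hle hgi (le_iSup (fun n => ℱ n) n _ hEm), hg,
      Measure.setIntegral_toReal_rnDeriv hμ]
  rw [h2, ← integral_sub hqi.integrableOn hfi.integrableOn]
  have h3 : ∫ x, |q x - f x| ∂S.m ≤ ε := by
    have h4 : ∫ x, |q x - f x| ∂S.m ≤ ∫ x, (|p x - q x| + (|p x| - f x)) ∂S.m := by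
      refine integral_mono_ae (hqi.sub hfi).abs
        ((hpi.sub hqi).abs.add (hpi.abs.sub hfi)) ?_
      filter_upwards [hq0] with x hx
      have h5 : abs (q x - |p x|) ≤ |p x - q x| := by
        have h6 := abs_abs_sub_abs_le (q x) (p x)
        rw [abs_of_nonneg hx, abs_sub_comm (q x) (p x)] at h6
        exact h6
      have h6 : f x ≤ |p x| := min_le_left _ _
      calc |q x - f x| ≤ abs (q x - |p x|) + abs (|p x| - f x) := abs_sub_le _ _ _
        _ ≤ _ := by
          rw [abs_of_nonneg (sub_nonneg.2 h6)]
          linarith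
    have h7 := integral_add (hpi.sub hqi).abs (hpi.abs.sub hfi)
    simp only [Pi.sub_apply] at h7
    rw [h7] at h4
    linarith
  calc |∫ x in E, (q x - f x) ∂S.m| ≤ ∫ x in E, |q x - f x| ∂S.m := abs_integral_le_integral_abs
    _ ≤ ∫ x, |q x - f x| ∂S.m := setIntegral_le_integral (hqi.sub hfi).abs
        (Filter.Eventually.of_forall fun x => abs_nonneg _)
    _ ≤ ε := h3

/-- Pushing forward by `F^M` a density that is regular beyond the `M`-th symbol gives a regular
density. -/
theorem exists_cone_iterate (hJ : S.Distortion θ K) (hR : K + θ * R = R) (M : ℕ) :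
    ∀ (f : X → ℝ) (C : ℝ), Measurable f → (∀ x, 0 ≤ f x ∧ f x ≤ C) →
      (∀ n x y, S.Agree (M + n) x y → f x ≤ Real.exp (R * θ ^ (M + n)) * f y) →
      ∃ G, S.Cone θ R G ∧ ∀ (u : X → ℝ) (B : ℝ), Measurable u → (∀ x, |u x| ≤ B) →
        ∫ x, G x * u x ∂S.m = ∫ x, f x * u (S.F^[M] x) ∂S.m := by
  induction M with
  | zero =>
    intro f C hfm hf hfr
    exact ⟨f, ⟨fun x => (hf x).1, hfm, fun n x y hxy => by
      have := hfr n x y (by rwa [zero_add])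
      rwa [zero_add] at this⟩, fun u B _ _ => rfl⟩
  | succ M ih =>
    intro f C hfm hf hfr
    have hfC : ∀ x, |f x| ≤ C := fun x => by rw [abs_of_nonneg (hf x).1]; exact (hf x).2
    obtain ⟨C', hC'⟩ := exists_bound_transfer hJ hfC
    obtain ⟨G, hG, hint⟩ := ih (S.transfer f) C' (measurable_transfer hJ hfm hfC)
      (fun x => ⟨transfer_nonneg (fun x => (hf x).1) x, (le_abs_self _).trans (hC' x)⟩)
      (fun n x y hxy => transfer_le hJ hfC fun a => by
        have h1 := hfr n (S.br a x) (S.br a y)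
          (by rw [show M + 1 + n = M + n + 1 by ring]; exact hxy.br a)
        have h2 := hJ a _ x y hxy
        have h3 : Real.exp (R * θ ^ (M + n)) =
            Real.exp (K * θ ^ (M + n)) * Real.exp (R * θ ^ (M + 1 + n)) := by
          rw [← Real.exp_add]
          congr 1
          rw [show M + 1 + n = M + n + 1 by ring, pow_succ]
          linear_combination (-θ ^ (M + n)) * hR
        rw [h3]
        calc _ ≤ _ := mul_le_mul h2 h1 (hf _).1
              (mul_nonneg (Real.exp_pos _).le (S.J_pos a y).le)
          _ = _ := by ring)
    refine ⟨G, hG, fun u B hu hB => ?_⟩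
    rw [hint u B hu hB, integral_transfer_mul (W := fun x => u (S.F^[M] x)) hJ hfm
      (hu.comp (S.measurable_F.iterate M)) hfC fun x => hB _]
    rfl

/-- A density constant on `M`-cylinders enters the cone once it is pushed forward by `F^M`.
Invariance of `μ` allows this push without spoiling the approximation, since preimages of cylinder
sets are again cylinder sets. -/
theorem exists_cone_approx (hJ : S.Distortion θ K) (hR : K + θ * R = R) (hθ : 0 ≤ θ)
    (hR0 : 0 ≤ R) {μ : Measure X} [IsProbabilityMeasure μ] (hμ : μ ≪ S.m)
    (hF : MeasurePreserving S.F μ μ) {ε : ℝ} (hε : 0 < ε) :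
    ∃ G, S.Cone θ R G ∧ ∀ n (t : Set (Fin n → A)),
      |μ.real (S.itinerary n ⁻¹' t) - ∫ x in S.itinerary n ⁻¹' t, G x ∂S.m| ≤ ε := by
  obtain ⟨M, f, C, hfd, hf, happ⟩ := exists_dependsOn_approx hμ hε
  obtain ⟨G, hG, hint⟩ := exists_cone_iterate hJ hR M f C hfd.measurable hf fun n x y hxy => by
    rw [hfd x y (hxy.mono (Nat.le_add_right _ _))]
    exact le_mul_of_one_le_left (hf y).1 (Real.one_le_exp (by positivity))
  refine ⟨G, hG, fun n t => ?_⟩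
  set E := S.itinerary n ⁻¹' t with hE
  have hEm : MeasurableSet E := measurableSet_itinerary t
  have h1 : S.F^[M] ⁻¹' E = S.itinerary (M + n) ⁻¹' ((fun σ i => σ (Fin.natAdd M i)) ⁻¹' t) := by
    ext x
    simp only [hE, mem_preimage]
    have : S.itinerary n (S.F^[M] x) = fun i => S.itinerary (M + n) x (Fin.natAdd M i) := by
      funext i
      simp only [itinerary, Fin.val_natAdd]
      rw [← Function.iterate_add_apply, add_comm]
    rw [this]
  have h2 : μ.real (S.F^[M] ⁻¹' E) = μ.real E := by
    rw [measureReal_def, (hF.iterate M).measure_preimage hEm.nullMeasurableSet, measureReal_def]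
  have h3 : ∫ x in E, G x ∂S.m = ∫ x in S.F^[M] ⁻¹' E, f x ∂S.m := by
    have h4 := hint (E.indicator fun _ => 1) 1 (measurable_const.indicator hEm) fun x => by
      by_cases hx : x ∈ E <;> simp [hx]
    rw [← integral_indicator hEm, ← integral_indicator ((S.measurable_F.iterate M) hEm)]
    refine Eq.trans ?_ (h4.trans ?_)
    · refine integral_congr_ae (Filter.Eventually.of_forall fun x => ?_)
      by_cases hx : x ∈ E <;> simp [hx]
    · refine integral_congr_ae (Filter.Eventually.of_forall fun x => ?_)
      by_cases hx : S.F^[M] x ∈ E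
      · have hx' : x ∈ S.F^[M] ⁻¹' E := hx
        simp [hx, hx']
      · have hx' : x ∉ S.F^[M] ⁻¹' E := hx
        simp [hx, hx']
  rw [h3, ← h2, h1]
  exact happ _ _

/-- Pull back one branch at a time; distortion bounds the Jacobian below on the whole space. -/
theorem measureReal_cylinder_pos (hJ : S.Distortion θ K) (N : ℕ) (x : X) :
    0 < S.m.real (S.itinerary N ⁻¹' {S.itinerary N x}) := by
  induction N generalizing x with
  | zero =>
    have : S.itinerary 0 ⁻¹' {S.itinerary 0 x} = univ := by
      ext y
      simp [itinerary_eq_iff, agree_zero]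
    rw [this]
    simp
  | succ N ih =>
    set c := S.itinerary N ⁻¹' {S.itinerary N (S.F x)} with hc
    have hcm : MeasurableSet c := measurableSet_itinerary _
    have h1 : S.itinerary (N + 1) ⁻¹' {S.itinerary (N + 1) x} = S.sym ⁻¹' {S.sym x} ∩ S.F ⁻¹' c := by
      ext y
      simp only [hc, mem_preimage, mem_singleton_iff, mem_inter_iff, itinerary_eq_iff]
      exact agree_succ
    have h2 := setIntegral_sym (S := S) (S.sym x) (f := (S.F ⁻¹' c).indicator fun _ => 1)
      (measurable_const.indicator (S.measurable_F hcm))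
    rw [setIntegral_indicator (S.measurable_F hcm)] at h2
    have h3 : ∫ y, S.J (S.sym x) y * (S.F ⁻¹' c).indicator (fun _ => 1) (S.br (S.sym x) y) ∂S.m =
        ∫ y in c, S.J (S.sym x) y ∂S.m := by
      rw [← integral_indicator hcm]
      refine integral_congr_ae (Filter.Eventually.of_forall fun y => ?_)
      by_cases hy : y ∈ c
      · have : S.br (S.sym x) y ∈ S.F ⁻¹' c := by rw [mem_preimage, S.F_br]; exact hy
        simp [hy, this]
      · have : S.br (S.sym x) y ∉ S.F ⁻¹' c := by rw [mem_preimage, S.F_br]; exact hy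
        simp [hy, this]
    rw [h3] at h2
    have h4 : S.m.real (S.itinerary (N + 1) ⁻¹' {S.itinerary (N + 1) x}) =
        ∫ y in c, S.J (S.sym x) y ∂S.m := by
      rw [← h2, h1]
      simp
    have h5 := setIntegral_mono (s := c) (μ := S.m)
      (integrable_const (Real.exp (-K) * S.J (S.sym x) x)).integrableOn
      (integrable_J hJ (S.sym x)).integrableOn fun y => by
        have := hJ (S.sym x) 0 x y (agree_zero x y)
        rw [pow_zero, mul_one] at this
        rw [Real.exp_neg, inv_mul_le_iff₀ (Real.exp_pos _)]
        exact this
    rw [h4]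
    refine lt_of_lt_of_le ?_ h5
    have := S.J_pos (S.sym x) x
    have := ih (S.F x)
    simp only [integral_const, measureReal_restrict_apply_univ, smul_eq_mul]
    positivity

/-- An absolutely continuous invariant probability measure has log-Lipschitz densities. -/
theorem hasDensities_of_absolutelyContinuous (hJ : S.Distortion θ K) (hR : K + θ * R = R)
    (hθ : 0 ≤ θ) (hR0 : 0 ≤ R) {μ : Measure X} [IsProbabilityMeasure μ] (hμ : μ ≪ S.m)
    (hF : MeasurePreserving S.F μ μ) : S.HasDensities θ R μ := by
  intro N
  set c : X → Set X := fun x => S.itinerary N ⁻¹' {S.itinerary N x} with hc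
  have hcm : ∀ x, MeasurableSet (c x) := fun x => measurableSet_itinerary _
  have hcpos : ∀ x, 0 < S.m.real (c x) := measureReal_cylinder_pos hJ N
  have hceq : ∀ x y, S.Agree N x y → c x = c y := fun x y hxy => by
    simp only [hc, itinerary_eq_iff.2 hxy]
  have hreg : ∀ n x y, S.Agree n x y → n ≤ N →
      μ.real (c x) * S.m.real (c y) ≤ Real.exp (R * θ ^ n) * (μ.real (c y) * S.m.real (c x)) := by
    intro n x y hxy hn
    set E := Real.exp (R * θ ^ n) with hE
    have hE0 : 0 < E := Real.exp_pos _
    -- The inequality, cleared of denominators, holds for a cone density that approximates `μ` and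
    -- survives the limit of the approximation.
    refine le_of_forall_pos_le_add fun ε hε => ?_
    obtain ⟨G, hG, happ⟩ := exists_cone_approx hJ hR hθ hR0 hμ hF
      (show 0 < ε / (1 + E) by positivity)
    have h1 := abs_le.1 (happ N {S.itinerary N x})
    have h2 := abs_le.1 (happ N {S.itinerary N y})
    have hmx := hcpos x
    have hmy := hcpos y
    have hmx1 : S.m.real (c x) ≤ 1 := measureReal_le_one
    have hmy1 : S.m.real (c y) ≤ 1 := measureReal_le_one
    have h3 : ∀ z ∈ c x, ∀ z' ∈ c y, G z ≤ E * G z' := fun z hz z' hz' => by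
      have hz1 : S.Agree N z x := itinerary_eq_iff.1 hz
      have hz2 : S.Agree N z' y := itinerary_eq_iff.1 hz'
      exact hG.regular n z z' (((hz1.mono hn).trans hxy).trans (hz2.mono hn).symm)
    have h4 : (∫ z in c x, G z ∂S.m) * S.m.real (c y) ≤
        E * ((∫ z in c y, G z ∂S.m) * S.m.real (c x)) := by
      have h5 : ∀ z' ∈ c y, ∫ z in c x, G z ∂S.m ≤ S.m.real (c x) * (E * G z') := fun z' hz' => by
        have := setIntegral_mono_on (μ := S.m) hG.integrable.integrableOn
          (integrable_const (E * G z')).integrableOn (hcm x) fun z hz => h3 z hz z' hz'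
        simpa using this
      have h6 := setIntegral_mono_on (μ := S.m) (integrable_const (∫ z in c x, G z ∂S.m)).integrableOn
        ((hG.integrable.const_mul E).const_mul (S.m.real (c x))).integrableOn (hcm y) h5
      rw [integral_const_mul, integral_const_mul] at h6
      simp only [integral_const, measureReal_restrict_apply_univ, smul_eq_mul] at h6
      linarith
    have hq : ε / (1 + E) * (1 + E) = ε := by field_simp
    set ε' := ε / (1 + E) with hε'
    have hε'0 : 0 < ε' := by positivity
    set Gx := ∫ z in c x, G z ∂S.m with hGx
    set Gy := ∫ z in c y, G z ∂S.m with hGy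
    have h7 : μ.real (c x) ≤ Gx + ε' := by linarith [h1.2]
    have h8 : Gy ≤ μ.real (c y) + ε' := by linarith [h2.1]
    calc μ.real (c x) * S.m.real (c y) ≤ (Gx + ε') * S.m.real (c y) := by gcongr
      _ ≤ E * (Gy * S.m.real (c x)) + ε' * 1 := by
          rw [add_mul]
          gcongr
      _ ≤ E * ((μ.real (c y) + ε') * S.m.real (c x)) + ε' * 1 := by gcongr
      _ ≤ E * (μ.real (c y) * S.m.real (c x)) + E * (ε' * 1) + ε' * 1 := by
          rw [add_mul, mul_add]
          gcongr
      _ = _ := by rw [← hq]; ring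
  -- The density is the ratio of the two measures on the `N`-cylinder of `x`; agreement beyond `N`
  -- symbols gives equal values.
  have hcone : S.Cone θ R fun x => μ.real (c x) / S.m.real (c x) := by
    refine ⟨fun x => by positivity, ?_, fun n x y hxy => ?_⟩
    · refine DependsOn.measurable (S := S) (n := N) fun x y hxy => ?_
      rw [hceq x y hxy]
    · rcases le_total n N with hn | hn
      · rw [div_le_iff₀ (hcpos x), mul_assoc, div_mul_eq_mul_div, mul_div_assoc', le_div_iff₀ (hcpos y)]
        exact hreg n x y hxy hn
      · rw [hceq x y (hxy.mono hn)]
        exact le_mul_of_one_le_left (by positivity) (Real.one_le_exp (by positivity))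
  refine ⟨_, hcone, fun u C hu hC => ?_⟩
  obtain ⟨D, hD⟩ := hcone.exists_bound
  have hum : Measurable u := hu.measurable
  have hdisj : Pairwise (Function.onFun Disjoint fun s => S.itinerary N ⁻¹' {s}) := fun s t hst =>
    Disjoint.preimage _ (by simpa using hst)
  have hunion : ⋃ s, S.itinerary N ⁻¹' {s} = univ := by
    ext x; simp
  have hi1 : Integrable u μ := integrable_of_abs_le hum hC
  have hi2 : Integrable (fun x => u x * (μ.real (c x) / S.m.real (c x))) S.m :=
    integrable_of_abs_le (C := C * D) (hum.mul hcone.measurable) fun x => by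
      rw [abs_mul]
      exact mul_le_mul (hC x) (hD x) (abs_nonneg _) ((abs_nonneg _).trans (hC x))
  have s1 := hasSum_integral_iUnion (μ := μ) (fun s => measurableSet_itinerary {s}) hdisj
    (f := u) hi1.integrableOn
  have s2 := hasSum_integral_iUnion (μ := S.m) (fun s => measurableSet_itinerary {s}) hdisj
    (f := fun x => u x * (μ.real (c x) / S.m.real (c x))) hi2.integrableOn
  rw [hunion, setIntegral_univ] at s1 s2
  suffices h : ∀ s, ∫ x in S.itinerary N ⁻¹' {s}, u x ∂μ =
      ∫ x in S.itinerary N ⁻¹' {s}, u x * (μ.real (c x) / S.m.real (c x)) ∂S.m by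
    rw [funext h] at s1
    exact s1.unique s2
  intro s
  rcases (S.itinerary N ⁻¹' {s}).eq_empty_or_nonempty with h | ⟨x, hx⟩
  · rw [h]; simp
  have hx' : S.itinerary N x = s := hx
  subst hx'
  have hux : ∀ y ∈ c x, u y = u x := fun y hy => hu y x (itinerary_eq_iff.1 hy)
  have hcx : ∀ y ∈ c x, c y = c x := fun y hy => hceq y x (itinerary_eq_iff.1 hy)
  have e1 : ∫ y in c x, u y ∂μ = ∫ _ in c x, u x ∂μ := setIntegral_congr_fun (hcm x) hux
  have e2 : ∫ y in c x, u y * (μ.real (c y) / S.m.real (c y)) ∂S.m =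
      ∫ _ in c x, u x * (μ.real (c x) / S.m.real (c x)) ∂S.m :=
    setIntegral_congr_fun (hcm x) fun y hy => by
      rw [hux y hy, hcx y hy]
  refine e1.trans (Eq.trans ?_ e2.symm)
  simp only [integral_const, measureReal_restrict_apply_univ, smul_eq_mul]
  have := (hcpos x).ne'
  field_simp

end Density

end FullBranchMap


/-! ### Uniformly expanding maps as full-branch maps -/

namespace UniformlyExpanding

variable {X : Type*} [MeasurableSpace X] {d : X → X → ℝ} {F : X → X} {m : Measure X}
  {α : Set (Set X)} {lam K η : ℝ}

/-- The element of the partition that contains `x`. -/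
noncomputable def symbol (h : UniformlyExpanding d F m α lam K η) (x : X) : α :=
  ⟨(h.partition.2 x).choose, (h.partition.2 x).choose_spec.1.1⟩

theorem mem_symbol (h : UniformlyExpanding d F m α lam K η) (x : X) : x ∈ (h.symbol x : Set X) :=
  (h.partition.2 x).choose_spec.1.2

theorem symbol_eq_iff (h : UniformlyExpanding d F m α lam K η) {x : X} {a : α} :
    h.symbol x = a ↔ x ∈ (a : Set X) := by
  constructor
  · rintro rfl
    exact h.mem_symbol x
  · intro hx
    exact Subtype.ext ((h.partition.2 x).unique ⟨(h.symbol x).2, h.mem_symbol x⟩ ⟨a.2, hx⟩)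

theorem nonempty (h : UniformlyExpanding d F m α lam K η) : Nonempty X :=
  have := h.prob
  Measure.nonempty_of_neZero m

/-- The inverse of a branch. -/
noncomputable def branch (h : UniformlyExpanding d F m α lam K η) (a : α) : X → X :=
  have := h.nonempty
  Function.invFunOn F a

theorem branch_mem (h : UniformlyExpanding d F m α lam K η) (a : α) (x : X) :
    h.branch a x ∈ (a : Set X) :=
  have := h.nonempty
  Function.invFunOn_mem ((h.bijOn a a.2).surjOn (mem_univ x))

theorem map_branch (h : UniformlyExpanding d F m α lam K η) (a : α) (x : X) :
    F (h.branch a x) = x :=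
  have := h.nonempty
  Function.invFunOn_eq ((h.bijOn a a.2).surjOn (mem_univ x))

theorem preimage_branch (h : UniformlyExpanding d F m α lam K η) (a : α) (E : Set X) :
    h.branch a ⁻¹' E = F '' (a ∩ E) := by
  ext x
  constructor
  · intro hx
    exact ⟨h.branch a x, ⟨h.branch_mem a x, hx⟩, h.map_branch a x⟩
  · rintro ⟨y, ⟨hya, hyE⟩, rfl⟩
    have : h.branch a (F y) = y :=
      (h.bijOn a a.2).injOn (h.branch_mem a _) hya (h.map_branch a _)
    rwa [mem_preimage, this]

theorem measurable_branch (h : UniformlyExpanding d F m α lam K η) (a : α) :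
    Measurable (h.branch a) := fun E hE => by
  rw [preimage_branch]
  exact h.measurableSet_image a a.2 _ inter_subset_left ((h.measurableSet a a.2).inter hE)

/-- The inverse Jacobian. -/
noncomputable def invJacobian (h : UniformlyExpanding d F m α lam K η) : X → ℝ :=
  h.distortion.choose

theorem invJacobian_spec (h : UniformlyExpanding d F m α lam K η) : Measurable h.invJacobian ∧
    (∀ x, 0 < h.invJacobian x) ∧ (∀ a ∈ α, ∀ A ⊆ a, MeasurableSet A →
      m (F '' A) = ∫⁻ x in A, ENNReal.ofReal ((h.invJacobian x)⁻¹) ∂m) ∧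
    (∀ a ∈ α, ∀ x ∈ a, ∀ y ∈ a,
      |Real.log (h.invJacobian x) - Real.log (h.invJacobian y)| ≤ K * d (F x) (F y) ^ η) :=
  h.distortion.choose_spec

/-- The Jacobian formula for images, read on the inverse branch; multiplying the density by `ζ` then
gives the change of variables of a full-branch map. -/
theorem map_branch_measure (h : UniformlyExpanding d F m α lam K η) (a : α) :
    m.map (h.branch a) =
      (m.restrict a).withDensity fun x => ENNReal.ofReal (h.invJacobian x)⁻¹ := by
  ext E hE
  have ha := h.measurableSet a a.2
  rw [Measure.map_apply (h.measurable_branch a) hE, preimage_branch, withDensity_apply _ hE,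
    Measure.restrict_restrict hE, inter_comm E,
    h.invJacobian_spec.2.2.1 a a.2 _ inter_subset_left (ha.inter hE)]

/-- The full-branch map given by a uniformly expanding map. -/
noncomputable def toFullBranchMap (h : UniformlyExpanding d F m α lam K η) : FullBranchMap X α where
  F := F
  sym := h.symbol
  br := h.branch
  J a x := h.invJacobian (h.branch a x)
  m := m
  prob := h.prob
  measurable_F := h.nonsingular.measurable
  measurableSet_sym a := by
    have : h.symbol ⁻¹' {a} = a := by
      ext x
      exact h.symbol_eq_iff
    rw [this]
    exact h.measurableSet a a.2
  measurable_br := h.measurable_branch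
  measurable_J a := h.invJacobian_spec.1.comp (h.measurable_branch a)
  J_pos a x := h.invJacobian_spec.2.1 _
  sym_br a x := h.symbol_eq_iff.2 (h.branch_mem a x)
  F_br := h.map_branch
  lintegral_branch a u hu := by
    have hs : h.symbol ⁻¹' {a} = a := by
      ext x
      exact h.symbol_eq_iff
    obtain ⟨hm, hpos, -⟩ := h.invJacobian_spec
    have h1 := lintegral_map (μ := m) (f := fun x => ENNReal.ofReal (h.invJacobian x) * u x)
      (hm.ennreal_ofReal.mul hu) (h.measurable_branch a)
    have hinv : Measurable fun x => ENNReal.ofReal (h.invJacobian x)⁻¹ := hm.inv.ennreal_ofReal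
    rw [map_branch_measure, lintegral_withDensity_eq_lintegral_mul _ hinv
      (g := fun x => ENNReal.ofReal (h.invJacobian x) * u x) (hm.ennreal_ofReal.mul hu)] at h1
    rw [hs, ← h1]
    refine lintegral_congr fun x => ?_
    simp only [Pi.mul_apply]
    rw [← mul_assoc, ← ENNReal.ofReal_mul (inv_nonneg.2 (hpos x).le),
      inv_mul_cancel₀ (hpos x).ne', ENNReal.ofReal_one, one_mul]

theorem le_sepTime_iff (h : UniformlyExpanding d F m α lam K η) {n : ℕ} {x y : X} :
    (n : ℕ∞) ≤ sepTime F α x y ↔ h.toFullBranchMap.Agree n x y := by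
  constructor
  · intro hn i hi
    by_contra hne
    have : sepTime F α x y ≤ i := sInf_le ⟨i, rfl, h.symbol (F^[i] x), (h.symbol (F^[i] x)).2,
      h.mem_symbol _, fun hy => hne (h.symbol_eq_iff.2 hy).symm⟩
    have h2 := hn.trans this
    norm_cast at h2
    omega
  · intro hA
    refine le_sInf ?_
    rintro k ⟨i, rfl, a, ha, hx, hy⟩
    by_contra hlt
    have hi : i < n := by
      have := not_le.1 hlt
      exact_mod_cast this
    have h1 : h.symbol (F^[i] x) = h.symbol (F^[i] y) := hA i hi
    have h2 : h.symbol (F^[i] x) = ⟨a, ha⟩ := h.symbol_eq_iff.2 hx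
    exact hy (h.symbol_eq_iff.1 (h1.symm.trans h2))

end UniformlyExpanding

theorem symbolicDist_le {X : Type*} {F : X → X} {α : Set (Set X)} {θ : ℝ} (hθ : 0 ≤ θ)
    (hθ1 : θ ≤ 1) {n : ℕ} {x y : X} (h : (n : ℕ∞) ≤ sepTime F α x y) :
    symbolicDist F α θ x y ≤ θ ^ n := by
  unfold symbolicDist
  split_ifs with ht
  · positivity
  · refine pow_le_pow_of_le_one hθ hθ1 ?_
    rw [← ENat.natCast_toNat ht] at h
    exact_mod_cast h

/-- Distortion is measured by the distance of the images under `F`, and the images of the branch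
points are `x` and `y` themselves. The constants may be enlarged so that nearby parameters can share
them. -/
theorem UniformlyExpanding.distortion_toFullBranchMap {X : Type*} [MeasurableSpace X] {F : X → X}
    {m : Measure X} {α : Set (Set X)} {θ lam K θ' K' : ℝ}
    (h : UniformlyExpanding (symbolicDist F α θ) F m α lam K 1) (hθ : 0 ≤ θ) (hK : 0 ≤ K)
    (hθ' : θ ≤ θ') (hθ1 : θ ≤ 1) (hK' : K ≤ K') : h.toFullBranchMap.Distortion θ' K' := by
  intro a n x y hxy
  obtain ⟨-, hpos, -, hdist⟩ := h.invJacobian_spec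
  have h1 := hdist a a.2 _ (h.branch_mem a x) _ (h.branch_mem a y)
  rw [h.map_branch, h.map_branch, Real.rpow_one] at h1
  have h2 := symbolicDist_le hθ hθ1 (h.le_sepTime_iff.2 hxy)
  have h3 : Real.log (h.invJacobian (h.branch a x)) ≤
      K' * θ' ^ n + Real.log (h.invJacobian (h.branch a y)) := by
    have h4 : K * symbolicDist F α θ x y ≤ K' * θ' ^ n := by
      calc K * symbolicDist F α θ x y ≤ K * θ ^ n := by gcongr
        _ ≤ K' * θ' ^ n := by
          have := hK.trans hK'
          gcongr
    linarith [(abs_le.1 h1).2]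
  rw [← Real.exp_le_exp, Real.exp_add, Real.exp_log (hpos _), Real.exp_log (hpos _)] at h3
  exact h3


/-- The first return from level `0` takes more than `l` steps, so at most `k - 1` steps remain for
further returns, one per step. -/
theorem numReturns_add_le {X : Type*} {F : X → X} {ret : X → ℕ} (hret : ∀ x, 1 ≤ ret x) (k : ℕ)
    {l : ℕ} {x : X} (h : l < ret x) : numReturns F ret (k + l) x ≤ k := by
  rcases lt_or_ge (k + l) (ret x) with hn | hn
  · rw [numReturns_of_lt hn]; exact Nat.zero_le _
  · rw [numReturns_of_le hret hn]
    have := numReturns_le (F := F) hret (k + l - ret x) (F x)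
    omega

theorem FullBranchMap.numReturns_eq_of_agree {X A : Type*} [MeasurableSpace X]
    {S : FullBranchMap X A} {τ : A → ℕ} (hτ : ∀ a, 1 ≤ τ a) (n : ℕ) (x y : X)
    (h : S.Agree (numReturns S.F (fun x => τ (S.sym x)) n x + 1) x y) :
    numReturns S.F (fun x => τ (S.sym x)) n x = numReturns S.F (fun x => τ (S.sym x)) n y := by
  induction n using Nat.strong_induction_on generalizing x y with
  | _ n ih =>
  have h0 : S.sym x = S.sym y := h 0 (Nat.succ_pos _)
  rcases lt_or_ge n (τ (S.sym x)) with hn | hn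
  · rw [numReturns_of_lt (ret := fun x => τ (S.sym x)) (x := x) hn,
      numReturns_of_lt (ret := fun x => τ (S.sym x)) (x := y) (h0 ▸ hn)]
  · rw [numReturns_of_le (ret := fun x => τ (S.sym x)) (x := x) (fun x => hτ _) hn] at h ⊢
    rw [numReturns_of_le (ret := fun x => τ (S.sym x)) (x := y) (fun x => hτ _) (h0 ▸ hn), ← h0]
    have h1 := hτ (S.sym x)
    rw [ih _ (by omega) _ _ (FullBranchMap.agree_succ.1 h).2]

/-! ### The quotient along stable disks -/

namespace ProductStructure

variable {M : Type*} (D : ProductStructure M)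

theorem proj_eq_iff {y z : D.Y} : D.proj y = D.proj z ↔ ∃ S ∈ D.stable, y ∈ S ∧ z ∈ S := by
  rw [← D.rel_iff]
  exact Quotient.eq

theorem proj_surjective : Function.Surjective D.proj := Quotient.mk_surjective

theorem proj_mem_iff {a : Set D.Y} (ha : a ∈ D.part) {y : D.Y} : D.proj y ∈ D.proj '' a ↔ y ∈ a := by
  constructor
  · rintro ⟨z, hz, hzy⟩
    obtain ⟨S, hS, hzS, hyS⟩ := D.proj_eq_iff.1 hzy
    exact D.part_saturated a ha S hS ⟨z, hzS, hz⟩ hyS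
  · exact fun h => ⟨y, h, rfl⟩

theorem proj_iterate (n : ℕ) (y : D.Y) : D.proj (D.F^[n] y) = D.Fbar^[n] (D.proj y) :=
  Function.Semiconj.iterate_right (f := D.proj) (fun _ => rfl) n y

theorem sepTime_proj (y z : D.Y) :
    sepTime D.Fbar D.partbar (D.proj y) (D.proj z) = sepTime D.F D.part y z := by
  unfold sepTime
  congr 1
  ext k
  simp only [mem_ofPred_eq, partbar, exists_mem_image]
  refine exists_congr fun n => and_congr_right fun _ => exists_congr fun a => ?_
  refine and_congr_right fun ha => ?_
  rw [← proj_iterate, ← proj_iterate, D.proj_mem_iff ha, D.proj_mem_iff ha]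

theorem τbar_const {a : Set D.Ybar} (ha : a ∈ D.partbar) {x y : D.Ybar} (hx : x ∈ a) (hy : y ∈ a) :
    D.τbar x = D.τbar y := by
  obtain ⟨b, hb, rfl⟩ := ha
  obtain ⟨x, hx, rfl⟩ := hx
  obtain ⟨y, hy, rfl⟩ := hy
  exact D.τ_const b hb x hx y hy

theorem one_le_τbar (x : D.Ybar) : 1 ≤ D.τbar x := by
  obtain ⟨y, rfl⟩ := D.proj_surjective x
  exact D.τ_pos y

/-- A single unstable disk meets every stable disk, so the quotient lifts into it. -/
theorem exists_section [Nonempty D.Ybar] : ∃ (U : Set D.Y) (sec : D.Ybar → D.Y), U ∈ D.unstable ∧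
    ∀ x, sec x ∈ U ∧ D.proj (sec x) = x := by
  obtain ⟨x₀⟩ := ‹Nonempty D.Ybar›
  obtain ⟨y₀, -⟩ := D.proj_surjective x₀
  obtain ⟨U, ⟨hU, -⟩, -⟩ := D.unstable_partition.2 y₀
  have h : ∀ x, ∃ z, z ∈ U ∧ D.proj z = x := fun x => by
    obtain ⟨y, rfl⟩ := D.proj_surjective x
    obtain ⟨S, ⟨hS, hy⟩, -⟩ := D.stable_partition.2 y
    obtain ⟨z, ⟨hzS, hzU⟩, -⟩ := D.inter_unique S hS U hU
    exact ⟨z, hzU, D.proj_eq_iff.2 ⟨S, hS, hzS, hy⟩⟩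
  choose sec hsec using h
  exact ⟨U, sec, hU, hsec⟩

theorem eq_of_mem_unstable {U : Set D.Y} (hU : U ∈ D.unstable) {y z : D.Y} (hy : y ∈ U)
    (hz : z ∈ U) (h : D.proj y = D.proj z) : y = z := by
  obtain ⟨S, hS, hyS, hzS⟩ := D.proj_eq_iff.1 h
  exact (D.inter_unique S hS U hU).unique ⟨hyS, hy⟩ ⟨hzS, hz⟩

theorem iterate_T_of_le {n : ℕ} {y : D.Y} (h : D.τ y ≤ n) :
    D.T^[n] y = D.T^[n - D.τ y] (D.F y) := by
  conv_lhs => rw [← Nat.sub_add_cancel h, Function.iterate_add_apply]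
  rfl

variable [MetricSpace M] [MeasurableSpace M] [MeasurableSpace D.Ybar] {D}
  {m μbar : Measure D.Ybar} {μY : Measure D.Y} {θ K ρ₀ K₀ : ℝ}

namespace NonuniformlyHyperbolic

variable (h : D.NonuniformlyHyperbolic m μbar μY θ K ρ₀ K₀)

/-- The quotient induced map as a full-branch map. -/
noncomputable def toFullBranchMap : FullBranchMap D.Ybar D.partbar :=
  h.uniformlyExpanding.toFullBranchMap

/-- The return time as a function of the symbol. -/
noncomputable def symbolTime (h : D.NonuniformlyHyperbolic m μbar μY θ K ρ₀ K₀) (a : D.partbar) :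
    ℕ :=
  have := h.uniformlyExpanding.nonempty
  D.τbar (h.toFullBranchMap.br a (Classical.arbitrary _))

theorem symbolTime_sym (x : D.Ybar) : h.symbolTime (h.toFullBranchMap.sym x) = D.τbar x :=
  D.τbar_const (h.toFullBranchMap.sym x).2 (h.uniformlyExpanding.branch_mem _ _)
    (h.uniformlyExpanding.mem_symbol x)

theorem one_le_symbolTime (a : D.partbar) : 1 ≤ h.symbolTime a :=
  let _ := h.uniformlyExpanding.nonempty
  D.one_le_τbar _

theorem τ_eq (y : D.Y) : h.symbolTime (h.toFullBranchMap.sym (D.proj y)) = D.τ y :=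
  h.symbolTime_sym _

theorem le_sepTime (y z : D.Y) (n : ℕ) :
    (n : ℕ∞) ≤ sepTime D.F D.part y z ↔ h.toFullBranchMap.Agree n (D.proj y) (D.proj z) := by
  rw [← sepTime_proj]
  exact h.uniformlyExpanding.le_sepTime_iff

/-- If the projections coincide, so do the points, by uniqueness of the intersection; otherwise the
separation time is finite and the contraction along unstable disks applies. -/
theorem dist_iterate_unstable (hρ : 0 < ρ₀) (hρ1 : ρ₀ < 1) (hK₀ : 0 ≤ K₀) {U : Set D.Y}
    (hU : U ∈ D.unstable) {y z : D.Y} (hy : y ∈ U) (hz : z ∈ U) {n j : ℕ}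
    (hA : h.toFullBranchMap.Agree (n + j) (D.proj y) (D.proj z)) :
    dist (D.F^[n] y) (D.F^[n] z) ≤ K₀ * ρ₀ ^ j := by
  by_cases hyz : D.proj y = D.proj z
  · rw [D.eq_of_mem_unstable hU hy hz hyz, dist_self]
    positivity
  · have hs := h.separates _ _ hyz
    rw [sepTime_proj] at hs
    have h1 := (h.le_sepTime y z _).2 hA
    rw [← ENat.natCast_toNat hs] at h1
    have h2 : n + j ≤ (sepTime D.F D.part y z).toNat := by exact_mod_cast h1
    refine (h.p1.unstable U hU y hy z hz n _ (ENat.natCast_toNat hs).symm).trans ?_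
    refine mul_le_mul_of_nonneg_left ?_ hK₀
    rw [← zpow_natCast]
    exact zpow_le_zpow_right_of_le_one₀ hρ hρ1.le (by omega)

theorem dist_iterate_stable (h : D.NonuniformlyHyperbolic m μbar μY θ K ρ₀ K₀) {y z : D.Y} (hyz : D.proj y = D.proj z) (n : ℕ) :
    dist (D.F^[n] y) (D.F^[n] z) ≤ K₀ * ρ₀ ^ n := by
  obtain ⟨S, hS, hy, hz⟩ := D.proj_eq_iff.1 hyz
  exact h.p1.stable S hS y hy z hz n

/-- Orbits with enough common symbols return simultaneously, so at time `r` both are at the same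
height of a flight that starts from the same number of iterates of `F`. -/
theorem exists_flight (r : ℕ) (y z : D.Y)
    (hA : h.toFullBranchMap.Agree (numReturns h.toFullBranchMap.F
      (fun x => h.symbolTime (h.toFullBranchMap.sym x)) r (D.proj y) + 1) (D.proj y) (D.proj z)) :
    ∃ i, i < min (D.τ (D.F^[numReturns h.toFullBranchMap.F
        (fun x => h.symbolTime (h.toFullBranchMap.sym x)) r (D.proj y)] y))
        (D.τ (D.F^[numReturns h.toFullBranchMap.F
        (fun x => h.symbolTime (h.toFullBranchMap.sym x)) r (D.proj y)] z)) ∧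
      D.T^[r] y = D.T^[i] (D.F^[numReturns h.toFullBranchMap.F
        (fun x => h.symbolTime (h.toFullBranchMap.sym x)) r (D.proj y)] y) ∧
      D.T^[r] z = D.T^[i] (D.F^[numReturns h.toFullBranchMap.F
        (fun x => h.symbolTime (h.toFullBranchMap.sym x)) r (D.proj y)] z) := by
  induction r using Nat.strong_induction_on generalizing y z with
  | _ r ih =>
  have h0 : h.toFullBranchMap.sym (D.proj y) = h.toFullBranchMap.sym (D.proj z) :=
    hA 0 (Nat.succ_pos _)
  have h1 : D.τ y = D.τ z := by rw [← h.τ_eq, ← h.τ_eq, h0]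
  rcases lt_or_ge r (D.τ y) with hr | hr
  · rw [numReturns_of_lt (by rw [h.τ_eq]; exact hr)]
    exact ⟨r, lt_min hr (h1 ▸ hr), rfl, rfl⟩
  · rw [numReturns_of_le (fun x => h.one_le_symbolTime _) (by rw [h.τ_eq]; exact hr)] at hA ⊢
    rw [h.τ_eq] at hA ⊢
    have h2 := D.τ_pos y
    obtain ⟨i, hi, e1, e2⟩ := ih (r - D.τ y) (by omega) (D.F y) (D.F z)
      (FullBranchMap.agree_succ.1 hA).2
    refine ⟨i, hi, ?_, ?_⟩
    · rw [D.iterate_T_of_le hr, e1]; rfl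
    · rw [D.iterate_T_of_le (h1 ▸ hr), ← h1, e2]; rfl

theorem dist_iterate_T_le (r : ℕ) (y z : D.Y)
    (hA : h.toFullBranchMap.Agree (numReturns h.toFullBranchMap.F
      (fun x => h.symbolTime (h.toFullBranchMap.sym x)) r (D.proj y) + 1) (D.proj y) (D.proj z)) :
    dist (D.T^[r] y) (D.T^[r] z) ≤ K₀ * dist (D.F^[numReturns h.toFullBranchMap.F
        (fun x => h.symbolTime (h.toFullBranchMap.sym x)) r (D.proj y)] y)
      (D.F^[numReturns h.toFullBranchMap.F
        (fun x => h.symbolTime (h.toFullBranchMap.sym x)) r (D.proj y)] z) := by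
  obtain ⟨i, hi, e1, e2⟩ := h.exists_flight r y z hA
  rw [e1, e2]
  exact h.p1.flight _ _ i hi

end NonuniformlyHyperbolic

end ProductStructure


/-! ### Hölder observables -/

section Holder

variable {M : Type*} [MetricSpace M] {η : ℝ} {v : M → ℝ}

theorem MemCη.abs_le (hv : MemCη η v) (x : M) : |v x| ≤ cηNorm η v := by
  have h : ENNReal.ofReal |v x| ≤ eHolderENorm η v :=
    (le_iSup (fun x => ENNReal.ofReal |v x|) x).trans le_self_add
  have := ENNReal.toReal_mono hv.ne h
  rwa [ENNReal.toReal_ofReal (abs_nonneg _)] at this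

theorem cηNorm_nonneg (η : ℝ) (v : M → ℝ) : 0 ≤ cηNorm η v := ENNReal.toReal_nonneg

theorem MemCη.abs_sub_le (hv : MemCη η v) (x y : M) :
    |v x - v y| ≤ cηNorm η v * dist x y ^ η := by
  rcases eq_or_ne x y with rfl | hxy
  · rw [sub_self, abs_zero]
    exact mul_nonneg (cηNorm_nonneg η v) (Real.rpow_nonneg dist_nonneg _)
  · have h : ENNReal.ofReal (|v x - v y| / dist x y ^ η) ≤ eHolderENorm η v := by
      refine le_trans ?_ le_add_self
      exact le_iSup_of_le x (le_iSup_of_le y (le_iSup_of_le hxy le_rfl))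
    have hd : 0 < dist x y ^ η := Real.rpow_pos_of_pos (dist_pos.2 hxy) _
    have := ENNReal.toReal_mono hv.ne h
    rw [ENNReal.toReal_ofReal (by positivity), div_le_iff₀ hd] at this
    exact this

theorem MemCη.continuous (hη : 0 < η) (hv : MemCη η v) : Continuous v := by
  rw [continuous_iff_continuousAt]
  intro x
  rw [ContinuousAt, tendsto_iff_dist_tendsto_zero]
  have h1 : Filter.Tendsto (fun y => cηNorm η v * dist y x ^ η) (nhds x) (nhds 0) := by
    have h2 : Continuous fun y => cηNorm η v * dist y x ^ η :=
      continuous_const.mul ((continuous_id.dist continuous_const).rpow_const fun _ => Or.inr hη.le)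
    have h3 := h2.tendsto x
    rwa [dist_self, Real.zero_rpow hη.ne', mul_zero] at h3
  exact squeeze_zero (fun _ => dist_nonneg) (fun y => by rw [Real.dist_eq]; exact hv.abs_sub_le y x) h1

theorem MemCη.abs_sub_le_pow (hη : 0 < η) (hη1 : η ≤ 1) (hv : MemCη η v) {x y : M} {C ρ ϑ : ℝ}
    (hC : 1 ≤ C) (hρ : 0 ≤ ρ) (hϑ : ρ ^ η ≤ ϑ) {j : ℕ} (h : dist x y ≤ C * ρ ^ j) :
    |v x - v y| ≤ C * cηNorm η v * ϑ ^ j := by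
  have h1 : dist x y ^ η ≤ C * ϑ ^ j := by
    calc dist x y ^ η ≤ (C * ρ ^ j) ^ η := Real.rpow_le_rpow dist_nonneg h hη.le
      _ = C ^ η * (ρ ^ η) ^ j := by
          rw [Real.mul_rpow (by linarith) (by positivity), ← Real.rpow_natCast, ← Real.rpow_natCast,
            ← Real.rpow_mul hρ, ← Real.rpow_mul hρ, mul_comm η]
      _ ≤ C * ϑ ^ j := by
          have h2 : C ^ η ≤ C := by
            calc C ^ η ≤ C ^ (1 : ℝ) := Real.rpow_le_rpow_of_exponent_le hC hη1
              _ = C := Real.rpow_one C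
          have h3 : 0 ≤ ρ ^ η := Real.rpow_nonneg hρ η
          have h4 : 0 ≤ C := by linarith
          gcongr
  calc |v x - v y| ≤ cηNorm η v * dist x y ^ η := hv.abs_sub_le x y
    _ ≤ cηNorm η v * (C * ϑ ^ j) := mul_le_mul_of_nonneg_left h1 (cηNorm_nonneg η v)
    _ = _ := by ring

end Holder

namespace ProductStructure.NonuniformlyHyperbolic

variable {M : Type*} {D : ProductStructure M} [MetricSpace M] [MeasurableSpace M]
  [MeasurableSpace D.Ybar] {m μbar : Measure D.Ybar} {μY : Measure D.Y} {θ K ρ₀ K₀ : ℝ}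

/-- The approximation evaluates `v` along the orbit of a reference point: on a fixed unstable disk,
above a chosen point of the cylinder of `N` symbols. Moving there along a stable and then an
unstable disk costs `K₀ ρ₀ ^ p` each after `p` returns, and the flight costs another factor `K₀`. -/
theorem approximable [BorelSpace M] (h : D.NonuniformlyHyperbolic m μbar μY θ K ρ₀ K₀)
    (hρ : 0 < ρ₀) (hρ1 : ρ₀ < 1) (hK₀ : 1 ≤ K₀) {η ϑ C : ℝ} (hη : 0 < η) (hη1 : η ≤ 1)
    (hϑ : ρ₀ ^ η ≤ ϑ) (hC : 2 * K₀ ^ 2 ≤ C) {v : M → ℝ} (hv : MemCη η v) :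
    h.toFullBranchMap.Approximable h.symbolTime D.F D.proj ϑ C
      (fun n y => v (D.T^[n] y)) (cηNorm η v) := by
  have hne : Nonempty D.Ybar := h.uniformlyExpanding.nonempty
  obtain ⟨U, sec, hU, hsec⟩ := D.exists_section
  set S := h.toFullBranchMap with hS
  have hC1 : 1 ≤ C := by nlinarith
  have hθ0 : 0 ≤ ϑ := (Real.rpow_nonneg hρ.le η).trans hϑ
  have ha : 0 ≤ cηNorm η v := cηNorm_nonneg η v
  refine ⟨fun n y hn => ?_, fun n => ?_, fun n y => hv.abs_le _, fun k => ?_⟩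
  · beta_reduce at hn ⊢
    rw [h.τ_eq] at hn ⊢
    rw [one_mul, D.iterate_T_of_le hn]
  · exact ((hv.continuous hη).measurable.comp (h.measurable_T.iterate n)).comp measurable_subtype_coe
  set ψ := numReturns S.F (fun x => h.symbolTime (S.sym x)) with hψ
  -- With `p ≤ k` returns, `p` symbols are used up and `p` more give the contraction along the
  -- unstable disk; `p + 1` symbols are needed to locate the flight.
  set N := 2 * k + 1 with hN
  set c : D.Ybar → D.Ybar := fun x => Function.invFun (S.itinerary N) (S.itinerary N x) with hc
  have hcA : ∀ x, S.Agree N (c x) x := fun x =>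
    FullBranchMap.itinerary_eq_iff.1 (Function.invFun_eq ⟨x, rfl⟩)
  have hcc : ∀ x y, S.Agree N x y → c x = c y := fun x y hxy => by
    simp only [hc, FullBranchMap.itinerary_eq_iff.2 hxy]
  have hψk : ∀ l x, l < h.symbolTime (S.sym x) → ψ (k + l) x ≤ k := fun l x hl =>
    numReturns_add_le (fun x => h.one_le_symbolTime _) k hl
  refine ⟨N, fun l x => v (D.T^[k + l] (sec (c x))), fun l x y hxy => ?_, fun l x => hv.abs_le _,
    fun l y hl => ?_, fun l n x y hl hxy => ?_⟩
  · simp only [hcc x y hxy]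
  · set r := k + l with hr
    set p := ψ r (D.proj y) with hp
    have hpk : p ≤ k := hψk l _ hl
    set z := sec (c (D.proj y)) with hz
    set y' := sec (D.proj y) with hy'
    have hzp : D.proj z = c (D.proj y) := (hsec _).2
    have hyp : D.proj y' = D.proj y := (hsec _).2
    have hA : S.Agree N (D.proj y) (D.proj z) := by rw [hzp]; exact (hcA _).symm
    have h1 := h.dist_iterate_T_le r y z (hA.mono (show p + 1 ≤ N by omega))
    have h2 := h.dist_iterate_stable hyp.symm p
    have h3 := h.dist_iterate_unstable hρ hρ1 (by linarith) hU (hsec (D.proj y)).1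
      (hsec (c (D.proj y))).1 (n := p) (j := p) (by
        rw [(hsec (D.proj y)).2]
        exact hA.mono (show p + p ≤ N by omega))
    refine hv.abs_sub_le_pow hη hη1 hC1 hρ.le hϑ (h1.trans ?_)
    have h4 : dist (D.F^[p] y) (D.F^[p] z) ≤ K₀ * ρ₀ ^ p + K₀ * ρ₀ ^ p :=
      (dist_triangle _ _ _).trans (add_le_add h2 h3)
    calc K₀ * dist (D.F^[p] y) (D.F^[p] z) ≤ K₀ * (K₀ * ρ₀ ^ p + K₀ * ρ₀ ^ p) :=
          mul_le_mul_of_nonneg_left h4 (by linarith)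
      _ = 2 * K₀ ^ 2 * ρ₀ ^ p := by ring
      _ ≤ C * ρ₀ ^ p := by gcongr
  · set r := k + l with hr
    set p := ψ r x with hp
    have hpk : p ≤ k := hψk l _ hl
    rcases le_total N (p + 1 + n) with hNn | hNn
    · beta_reduce
      rw [hcc x y (hxy.mono hNn), sub_self, abs_zero]
      positivity
    set z := sec (c x) with hz
    set z' := sec (c y) with hz'
    have hzp : D.proj z = c x := (hsec _).2
    have hzp' : D.proj z' = c y := (hsec _).2
    have hpz : ψ r (D.proj z) = p := by
      rw [hzp]
      exact (FullBranchMap.numReturns_eq_of_agree h.one_le_symbolTime r x (c x)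
        ((hcA x).symm.mono (show p + 1 ≤ N by omega))).symm
    have hA : S.Agree (p + 1 + n) (D.proj z) (D.proj z') := by
      rw [hzp, hzp']
      exact (((hcA x).mono hNn).trans hxy).trans ((hcA y).mono hNn).symm
    have h1 := h.dist_iterate_T_le r z z' (by
      rw [← hS, ← hψ, hpz]
      exact hA.mono (by omega))
    rw [← hS, ← hψ, hpz] at h1
    have h3 := h.dist_iterate_unstable hρ hρ1 (by linarith) hU (hsec (c x)).1
      (hsec (c y)).1 (n := p) (j := n) (hA.mono (by omega))
    refine hv.abs_sub_le_pow hη hη1 hC1 hρ.le hϑ (h1.trans ?_)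
    calc K₀ * dist (D.F^[p] z) (D.F^[p] z') ≤ K₀ * (K₀ * ρ₀ ^ n) :=
          mul_le_mul_of_nonneg_left h3 (by linarith)
      _ = K₀ ^ 2 * ρ₀ ^ n := by ring
      _ ≤ C * ρ₀ ^ n := by
          have : K₀ ^ 2 ≤ C := by nlinarith
          gcongr

end ProductStructure.NonuniformlyHyperbolic


/-! ### Integration over towers -/

theorem integral_towerMeasure {X : Type*} [MeasurableSpace X] {τ : X → ℕ} (hτ : Measurable τ)
    {μ : Measure X} [IsFiniteMeasure μ] (hi : Integrable (fun x => (τ x : ℝ)) μ) {u : ℕ → X → ℝ}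
    (hu : BoundedSeq u) : ∫ p : tower τ, u p.1.2 p.1.1 ∂(towerMeasure τ μ) =
      (∫ x, (τ x : ℝ) ∂μ)⁻¹ * ∫ x, towerSum τ u x ∂μ := by
  obtain ⟨C, hC⟩ := hu.bound
  have hmass : (∫⁻ x, (τ x : ℝ≥0∞) ∂μ) = ENNReal.ofReal (∫ x, (τ x : ℝ) ∂μ) := by
    rw [ofReal_integral_eq_lintegral_ofReal hi (Filter.Eventually.of_forall fun x =>
      Nat.cast_nonneg _)]
    simp
  have hs : MeasurableSet (tower τ) :=
    measurableSet_lt measurable_snd (hτ.comp measurable_fst)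
  have hum : Measurable fun p : X × ℕ => u p.2 p.1 :=
    measurable_from_prod_countable_left fun n => hu.measurable n
  have hslice : ∀ x, Prod.mk x ⁻¹' tower τ = (Finset.range (τ x) : Set ℕ) := fun x => by
    ext l
    simp [tower]
  have hfin : (μ.prod Measure.count) (tower τ) ≠ ⊤ := by
    rw [Measure.prod_apply hs]
    simp only [hslice, Measure.count_apply_finset, Finset.card_range]
    rw [hmass]
    exact ENNReal.ofReal_ne_top
  have hint : IntegrableOn (fun p : X × ℕ => u p.2 p.1) (tower τ) (μ.prod Measure.count) :=
    IntegrableOn.of_bound hfin.lt_top hum.aestronglyMeasurable C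
      (Filter.Eventually.of_forall fun p => hC _ _)
  rw [towerMeasure, integral_smul_measure,
    integral_subtype_comap hs (fun p : X × ℕ => u p.2 p.1), hmass, smul_eq_mul,
    ENNReal.toReal_inv, ENNReal.toReal_ofReal (integral_nonneg fun x => Nat.cast_nonneg _)]
  congr 1
  rw [← integral_indicator hs, integral_prod _ ((integrable_indicator_iff hs).2 hint)]
  refine integral_congr_ae (Filter.Eventually.of_forall fun x => ?_)
  have hzero : ∀ l ∉ Finset.range (τ x),
      (tower τ).indicator (fun p : X × ℕ => u p.2 p.1) (x, l) = 0 := fun l hl =>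
    indicator_of_notMem (fun h : (x, l) ∈ tower τ => hl (Finset.mem_range.2 h)) _
  beta_reduce
  rw [integral_countable (integrable_count_iff.2 (summable_of_ne_finset_zero
    (s := Finset.range (τ x)) fun l hl => by rw [hzero l hl, norm_zero])),
    tsum_eq_sum (s := Finset.range (τ x)) fun l hl => by rw [hzero l hl, smul_zero]]
  refine Finset.sum_congr rfl fun l hl => ?_
  rw [indicator_of_mem (show (x, l) ∈ tower τ from Finset.mem_range.1 hl)]
  simp

namespace ProductStructure

variable {M : Type*} (D : ProductStructure M) [MeasurableSpace M]

theorem integral_measure (hT : Measurable D.T) (hτ : Measurable D.τ) {μY : Measure D.Y}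
    [IsFiniteMeasure μY] (hi : Integrable (fun y => (D.τ y : ℝ)) μY) {φ : M → ℝ}
    (hφ : Measurable φ) {C : ℝ} (hC : ∀ x, |φ x| ≤ C) : ∫ x, φ x ∂(D.measure μY) =
      (∫ y, (D.τ y : ℝ) ∂μY)⁻¹ * ∫ y, towerSum D.τ (fun l y => φ (D.T^[l] y)) y ∂μY := by
  have hm : ∀ l, Measurable fun y : D.Y => D.T^[l] y := fun l =>
    (hT.iterate l).comp measurable_subtype_coe
  have hproj : Measurable D.towerProj := by
    have h : Measurable fun p : D.Y × ℕ => D.T^[p.2] p.1 :=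
      measurable_from_prod_countable_left fun l => hm l
    exact h.comp measurable_subtype_coe
  rw [ProductStructure.measure, integral_map hproj.aemeasurable hφ.aestronglyMeasurable]
  exact integral_towerMeasure hτ hi (u := fun l y => φ (D.T^[l] y))
    ⟨fun l => hφ.comp (hm l), C, fun l y => hC _⟩

end ProductStructure

/-- The common bounds `ϑ`, `K₁`, `K₂`, `δ₁`, `N` and the rates fix the constant, which therefore
serves all systems with parameters in this range. -/
theorem exists_correlation_decay {ι : Type} {r₀ r₁ : ι → ℝ → ℕ → ℝ} (hr : RatePair r₀ r₁)
    {L δ₁ ϑ K₁ K₂ : ℝ} (hL : 1 ≤ L) (hδ₁ : 0 < δ₁) (N : ℕ) (hϑ : 0 < ϑ) (hϑ1 : ϑ < 1)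
    (hK₁ : 0 ≤ K₁) (hK₂ : 1 ≤ K₂) :
    ∃ L', 1 ≤ L' ∧ ∀ (i : ι) (M : Type*) [MetricSpace M] [MeasurableSpace M] [BorelSpace M]
      (D : ProductStructure M) [MeasurableSpace D.Ybar] (m μbar : Measure D.Ybar)
      (μY : Measure D.Y) (θ K δ η ρ₀ K₀ : ℝ) (I : Finset ℕ), 0 < θ → θ ≤ ϑ → 0 < K → K ≤ K₁ →
      δ₁ ≤ δ → I.sup id ≤ N → 0 < η → η ≤ 1 → 0 < ρ₀ → ρ₀ < 1 → ρ₀ ^ η ≤ ϑ → 1 ≤ K₀ → K₀ ≤ K₂ →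
      D.NonuniformlyHyperbolic m μbar μY θ K ρ₀ K₀ → MixingReturnTimes D.τbar μbar δ I →
      (∀ n : ℕ, μbar.real {y | n < D.τbar y} ≤ r₀ i L n) →
      ∀ v w : M → ℝ, MemCη η v → MemCη η w → ∀ n : ℕ,
        |correlation D.T (D.measure μY) v w n| ≤ cηNorm η v * cηNorm η w * r₁ i L' n := by
  obtain ⟨L', hL', hdec⟩ := FullBranchMap.exists_decorrelation hr hL (δ := min δ₁ 1) (K := K₁) (C := 2 * K₂ ^ 2)
    (lt_min hδ₁ one_pos) (min_le_right _ _) N hϑ hϑ1 hK₁ (by positivity)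
  refine ⟨L', hL', fun i M _ _ _ D _ m μbar μY θ K δ η ρ₀ K₀ I hθ hθϑ hK hKK hδ hIN hη hη1 hρ hρ1 hρϑ
    hK₀ hKK₀ h hI htail v w hv hw n => ?_⟩
  set S := h.toFullBranchMap with hS
  have : Countable D.partbar := h.uniformlyExpanding.countable
  have := h.bar_prob
  have := h.prob
  have hJ : S.Distortion ϑ K₁ :=
    h.uniformlyExpanding.distortion_toFullBranchMap hθ.le hK.le hθϑ (hθϑ.trans hϑ1.le) hKK
  have hϑ' : 0 < 1 - ϑ := by linarith
  have hdens : S.HasDensities ϑ (K₁ / (1 - ϑ)) μbar :=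
    FullBranchMap.hasDensities_of_absolutelyContinuous hJ (by field_simp; ring) hϑ.le
      (div_nonneg hK₁ hϑ'.le) h.bar_absolutelyContinuous h.bar_invariant
  have hsym : ∀ x, h.symbolTime (S.sym x) = D.τbar x := h.symbolTime_sym
  have hC : 2 * K₀ ^ 2 ≤ 2 * K₂ ^ 2 := by gcongr
  have hπ : MeasurePreserving D.proj μY μbar := ⟨h.measurable_proj, h.map_proj⟩
  have key := hdec i S h.symbolTime hJ h.one_le_symbolTime μbar h.bar_invariant hdens
    (by simpa only [hsym] using htail) I
    (fun k hk => ⟨hI.1 k hk, (Finset.le_sup (f := id) hk).trans hIN⟩) hI.2.1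
    (fun k hk => by
      simp only [hsym]
      exact ((min_le_left _ _).trans hδ).trans (hI.2.2 k hk))
    D.F D.proj μY h.invariant hπ (fun _ => rfl) _ _ _ _
    (h.approximable hρ hρ1 hK₀ hη hη1 hρϑ hC hv) (h.approximable hρ hρ1 hK₀ hη hη1 hρϑ hC hw) n
  simp only [hS, h.τ_eq] at key
  have hτbarm : Measurable D.τbar := by
    have := S.measurable_comp_sym h.symbolTime
    simpa only [hsym] using this
  have hτm : Measurable D.τ := hτbarm.comp h.measurable_proj
  have hi : Integrable (fun y => (D.τ y : ℝ)) μY := hπ.integrable_comp_of_integrable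
    (integrable_ret hτbarm (hr.summable_of_le hL i (fun n => measureReal_nonneg) htail))
  have hvm := (hv.continuous hη).measurable
  have hwm := (hw.continuous hη).measurable
  have hT := h.measurable_T
  set T := ∫ y, (D.τ y : ℝ) ∂μY with hTd
  have hT1 : 1 ≤ T := by
    have := integral_mono (integrable_const (1 : ℝ)) hi fun y => by
      show (1 : ℝ) ≤ D.τ y
      exact_mod_cast D.τ_pos y
    simpa using this
  have e1 := D.integral_measure hT hτm hi hvm hv.abs_le
  have e2 := D.integral_measure hT hτm hi hwm hw.abs_le
  have e3 := D.integral_measure hT hτm hi (φ := fun x => v x * w (D.T^[n] x))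
    (hvm.mul (hwm.comp (hT.iterate n))) (C := cηNorm η v * cηNorm η w) fun x => by
      rw [abs_mul]
      exact mul_le_mul (hv.abs_le x) (hw.abs_le _) (abs_nonneg _) (cηNorm_nonneg η v)
  have hcomp : ∀ (l : ℕ) (x : M), D.T^[n] (D.T^[l] x) = D.T^[l + n] x := fun l x => by
    rw [← Function.iterate_add_apply, add_comm]
  simp only [hcomp] at e3
  rw [correlation, e1, e2, e3]
  rw [← hTd]
  set P := ∫ y, towerSum D.τ (fun l y => v (D.T^[l] y) * w (D.T^[l + n] y)) y ∂μY
  set V := ∫ y, towerSum D.τ (fun l y => v (D.T^[l] y)) y ∂μY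
  set W := ∫ y, towerSum D.τ (fun l y => w (D.T^[l] y)) y ∂μY
  have hT0 : T ≠ 0 := by linarith
  -- Normalising the tower leaves one factor `T⁻¹ ≤ 1` in front of the unnormalised correlation.
  have hfac : T⁻¹ * P - T⁻¹ * V * (T⁻¹ * W) = T⁻¹ * (P - V * W / T) := by
    field_simp
  rw [hfac, abs_mul, abs_of_pos (by positivity : 0 < T⁻¹)]
  exact (mul_le_of_le_one_left (abs_nonneg _) (inv_le_one_of_one_le₀ hT1)).trans key


/-! ### Constants depending continuously on the parameters -/

/-- A family of up-closed sets of positive constants that is locally uniformly nonempty admits a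
continuous selection. -/
theorem exists_continuousOn_forall_mem {P : Type*} [TopologicalSpace P]
    [TopologicalSpace.MetrizableSpace P] {s : Set P} {t : P → Set ℝ}
    (hup : ∀ p, ∀ c ∈ t p, ∀ c', c ≤ c' → c' ∈ t p)
    (hloc : ∀ p ∈ s, ∃ c, ∀ᶠ q in nhds p, q ∈ s → c ∈ t q) :
    ∃ C : P → ℝ, ContinuousOn C s ∧ ∀ p ∈ s, C p ∈ t p := by
  classical
  let _ := TopologicalSpace.metrizableSpaceMetric P
  obtain ⟨g, hg⟩ := exists_continuous_forall_mem_convex_of_local_const (X := s) (E := ℝ)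
    (t := fun p => t p)
    -- An up-closed set of reals is order connected, hence convex, so locally constant choices can
    -- be averaged.
    (fun p => (OrdConnected.convex ⟨fun c hc c' _ x hx => hup p c hc x hx.1⟩))
    fun p => by
      obtain ⟨c, hc⟩ := hloc p p.2
      refine ⟨c, ?_⟩
      have := (continuous_subtype_val.tendsto p).eventually hc
      exact this.mono fun q hq => hq q.2
  refine ⟨fun p => if h : p ∈ s then g ⟨p, h⟩ else 1, ?_, fun p hp => ?_⟩
  · rw [continuousOn_iff_continuous_domRestrict]
    convert g.continuous using 1
    ext p
    simp
  · simp only [hp, dif_pos]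
    exact hg ⟨p, hp⟩

/-- Near `p` one base serves both the symbolic metric and the Hölder observables, for which
distances `ρ ^ j` turn into `(ρ ^ η) ^ j`. -/
theorem exists_common_contraction {P : Type*} [TopologicalSpace P] {θ η ρ : P → ℝ} {p : P}
    (hθ : Continuous θ) (hη : Continuous η) (hρ : Continuous ρ) (hθ0 : 0 < θ p) (hθ1 : θ p < 1)
    (hη0 : 0 < η p) (hρ0 : 0 < ρ p) (hρ1 : ρ p < 1) :
    ∃ ϑ, 0 < ϑ ∧ ϑ < 1 ∧ ∀ᶠ q in nhds p, θ q ≤ ϑ ∧ ρ q ^ η q ≤ ϑ := by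
  have h1 : ρ p ^ η p < 1 := Real.rpow_lt_one hρ0.le hρ1 hη0
  obtain ⟨ϑ, h2, h3⟩ := exists_between (max_lt hθ1 h1)
  have h4 : ContinuousAt (fun q => ρ q ^ η q) p :=
    hρ.continuousAt.rpow hη.continuousAt (Or.inl hρ0.ne')
  refine ⟨ϑ, hθ0.trans ((le_max_left _ _).trans_lt h2), h3, ?_⟩
  filter_upwards [hθ.continuousAt.eventually (gt_mem_nhds ((le_max_left _ _).trans_lt h2)),
    h4.eventually (gt_mem_nhds ((le_max_right _ _).trans_lt h2))] with q h5 h6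
  exact ⟨h5.le, h6.le⟩

/-- `C` is an admissible constant for polynomial decay of correlations. -/
def PolyDecay.{u} (θ K : ℝ) (N : ℕ) (δ β Cτ η ρ₀ K₀ C : ℝ) : Prop :=
  ∀ (M : Type u) [MetricSpace M] [MeasurableSpace M] [BorelSpace M]
    (D : ProductStructure M) [MeasurableSpace D.Ybar]
    (m μbar : Measure D.Ybar) (μY : Measure D.Y) (I : Finset ℕ), I.sup id = N →
    D.NonuniformlyHyperbolic m μbar μY θ K ρ₀ K₀ →
    MixingReturnTimes D.τbar μbar δ I →
    (∀ n : ℕ, 1 ≤ n → μbar.real {y | n ≤ D.τbar y} ≤ Cτ * (n : ℝ) ^ (-β)) →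
    ∀ v w : M → ℝ, MemCη η v → MemCη η w → ∀ n : ℕ, 1 ≤ n →
      |correlation D.T (D.measure μY) v w n| ≤
        C * (n : ℝ) ^ (-(β - 1)) * cηNorm η v * cηNorm η w

/-- `C` is an admissible constant for stretched exponential decay of correlations. -/
def ExpDecay.{u} (θ K : ℝ) (N : ℕ) (δ A γ Cτ η ρ₀ K₀ C : ℝ) : Prop :=
  ∀ (M : Type u) [MetricSpace M] [MeasurableSpace M] [BorelSpace M]
    (D : ProductStructure M) [MeasurableSpace D.Ybar]
    (m μbar : Measure D.Ybar) (μY : Measure D.Y) (I : Finset ℕ), I.sup id = N →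
    D.NonuniformlyHyperbolic m μbar μY θ K ρ₀ K₀ →
    MixingReturnTimes D.τbar μbar δ I →
    (∀ n : ℕ, 1 ≤ n →
      μbar.real {y | n ≤ D.τbar y} ≤ Cτ * Real.exp (-(A * (n : ℝ) ^ γ))) →
    ∀ v w : M → ℝ, MemCη η v → MemCη η w → ∀ n : ℕ, 1 ≤ n →
      |correlation D.T (D.measure μY) v w n| ≤
        C * Real.exp (-(C⁻¹ * (n : ℝ) ^ γ)) * cηNorm η v * cηNorm η w

theorem PolyDecay.mono.{u} {θ K : ℝ} {N : ℕ} {δ β Cτ η ρ₀ K₀ C C' : ℝ}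
    (h : PolyDecay.{u} θ K N δ β Cτ η ρ₀ K₀ C) (hC : C ≤ C') :
    PolyDecay.{u} θ K N δ β Cτ η ρ₀ K₀ C' := by
  intro M _ _ _ D _ m μbar μY I hI hD hmix ht v w hv hw n hn
  refine (h M D m μbar μY I hI hD hmix ht v w hv hw n hn).trans ?_
  have h1 := cηNorm_nonneg η v
  have h2 := cηNorm_nonneg η w
  gcongr

/-- Taking the inverse of `C` as the rate makes the admissible constants up-closed, so that one
selection provides both constants. -/
theorem ExpDecay.mono.{u} {θ K : ℝ} {N : ℕ} {δ A γ Cτ η ρ₀ K₀ C C' : ℝ}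
    (h : ExpDecay.{u} θ K N δ A γ Cτ η ρ₀ K₀ C) (hC0 : 0 < C) (hC : C ≤ C') :
    ExpDecay.{u} θ K N δ A γ Cτ η ρ₀ K₀ C' := by
  intro M _ _ _ D _ m μbar μY I hI hD hmix ht v w hv hw n hn
  refine (h M D m μbar μY I hI hD hmix ht v w hv hw n hn).trans ?_
  have h1 := cηNorm_nonneg η v
  have h2 := cηNorm_nonneg η w
  have h3 : 0 ≤ C' := hC0.le.trans hC
  gcongr

theorem exists_eventually_polyDecay.{u} {p : ℝ × ℝ × ℕ × ℝ × ℝ × ℝ × ℝ × ℝ × ℝ} (hp : p ∈ polyParams) :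
    ∃ C, ∀ᶠ q in nhds p, q ∈ polyParams → 0 < C ∧
      PolyDecay.{u} q.1 q.2.1 q.2.2.1 q.2.2.2.1 q.2.2.2.2.1 q.2.2.2.2.2.1 q.2.2.2.2.2.2.1
        q.2.2.2.2.2.2.2.1 q.2.2.2.2.2.2.2.2 C := by
  obtain ⟨θ, K, N, δ, β, Cτ, η, ρ₀, K₀⟩ := p
  obtain ⟨⟨hθ0, hθ1⟩, hK, hδ, hβ, hCτ, ⟨hη0, hη1⟩, ⟨hρ0, hρ1⟩, hK₀⟩ := hp
  obtain ⟨ϑ, hϑ0, hϑ1, hϑ⟩ := exists_common_contraction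
    (p := ((θ, K, N, δ, β, Cτ, η, ρ₀, K₀) : ℝ × ℝ × ℕ × ℝ × ℝ × ℝ × ℝ × ℝ × ℝ))
    (θ := fun q => q.1) (η := fun q => q.2.2.2.2.2.2.1) (ρ := fun q => q.2.2.2.2.2.2.2.1)
    (by fun_prop) (by fun_prop) (by fun_prop) hθ0 hθ1 hη0 hρ0 hρ1
  obtain ⟨β₁, hβ₁, hβ₁'⟩ := exists_between hβ
  let ι := {b : ℝ // β₁ ≤ b ∧ b ≤ β + 1}
  have hr : RatePair (polyRate fun i : ι => (i : ℝ)) (polyRate fun i : ι => (i : ℝ) - 1) :=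
    ratePair_poly _ hβ₁ fun i => i.2
  obtain ⟨L, hL, hdec⟩ := exists_correlation_decay hr (L := max 1 (Cτ + 1)) (δ₁ := δ / 2)
    (K₁ := K + 1) (K₂ := K₀ + 1) (le_max_left _ _) (half_pos hδ) N hϑ0 hϑ1 (by linarith) (by linarith)
  refine ⟨L, ?_⟩
  have c2 : Continuous fun q : ℝ × ℝ × ℕ × ℝ × ℝ × ℝ × ℝ × ℝ × ℝ => q.2.1 := by fun_prop
  have c3 : Continuous fun q : ℝ × ℝ × ℕ × ℝ × ℝ × ℝ × ℝ × ℝ × ℝ => q.2.2.1 := by fun_prop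
  have c4 : Continuous fun q : ℝ × ℝ × ℕ × ℝ × ℝ × ℝ × ℝ × ℝ × ℝ => q.2.2.2.1 := by fun_prop
  have c5 : Continuous fun q : ℝ × ℝ × ℕ × ℝ × ℝ × ℝ × ℝ × ℝ × ℝ => q.2.2.2.2.1 := by fun_prop
  have c6 : Continuous fun q : ℝ × ℝ × ℕ × ℝ × ℝ × ℝ × ℝ × ℝ × ℝ => q.2.2.2.2.2.1 := by fun_prop
  have c9 : Continuous fun q : ℝ × ℝ × ℕ × ℝ × ℝ × ℝ × ℝ × ℝ × ℝ => q.2.2.2.2.2.2.2.2 := by fun_prop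
  filter_upwards [hϑ, c2.continuousAt.eventually (gt_mem_nhds (lt_add_one K)),
    -- The coordinate `max I` lies in a discrete space, so it is constant near `p`.
    c3.continuousAt.eventually (IsOpen.mem_nhds (isOpen_discrete {N}) rfl),
    c4.continuousAt.eventually (lt_mem_nhds (half_lt_self hδ)),
    c5.continuousAt.eventually (lt_mem_nhds hβ₁'),
    c5.continuousAt.eventually (gt_mem_nhds (lt_add_one β)),
    c6.continuousAt.eventually (gt_mem_nhds (lt_add_one Cτ)),
    c9.continuousAt.eventually (gt_mem_nhds (lt_add_one K₀))] with q e1 e2 e3 e4 e5 e5' e6 e9 hq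
  obtain ⟨θ', K', N', δ', β', Cτ', η', ρ', K₀'⟩ := q
  obtain ⟨⟨hθ0', hθ1'⟩, hK', hδ', hβ', hCτ', ⟨hη0', hη1'⟩, ⟨hρ0', hρ1'⟩, hK₀'⟩ := hq
  dsimp only at e1 e2 e3 e4 e5 e5' e6 e9 ⊢
  refine ⟨by linarith, fun M _ _ _ D _ m μbar μY I hI hD hmix ht v w hv hw n hn => ?_⟩
  have hN : N' = N := e3
  have h := hdec ⟨β', e5.le, e5'.le⟩ M D m μbar μY θ' K' δ' η' ρ' K₀' I hθ0' e1.1 hK' e2.le e4.le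
    -- The tail hypothesis at `k + 1` bounds `{k < τ}`, which matches the shift by one in
    -- `polyRate`.
    (hI.trans hN).le hη0' hη1' hρ0' hρ1' e1.2 hK₀' e9.le hD hmix (fun k => by
      have h1 := ht (k + 1) (Nat.succ_pos k)
      rw [Nat.cast_add, Nat.cast_one] at h1
      refine h1.trans (mul_le_mul_of_nonneg_right (e6.le.trans (le_max_right _ _)) (by positivity)))
    v w hv hw n
  refine h.trans ?_
  have h1 := cηNorm_nonneg η' v
  have h2 := cηNorm_nonneg η' w
  have hn0 : (0 : ℝ) < n := by exact_mod_cast hn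
  have h3 : polyRate (fun i : ι => (i : ℝ) - 1) ⟨β', e5.le, e5'.le⟩ L n ≤
      L * (n : ℝ) ^ (-(β' - 1)) := by
    unfold polyRate
    refine mul_le_mul_of_nonneg_left ?_ (by linarith)
    exact Real.rpow_le_rpow_of_nonpos hn0 (by linarith) (by linarith)
  calc _ ≤ cηNorm η' v * cηNorm η' w * (L * (n : ℝ) ^ (-(β' - 1))) := by gcongr
    _ = _ := by ring

theorem exists_eventually_expDecay.{u} {p : ℝ × ℝ × ℕ × ℝ × ℝ × ℝ × ℝ × ℝ × ℝ × ℝ}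
    (hp : p ∈ expParams) :
    ∃ C, ∀ᶠ q in nhds p, q ∈ expParams → 1 ≤ C ∧
      ExpDecay.{u} q.1 q.2.1 q.2.2.1 q.2.2.2.1 q.2.2.2.2.1 q.2.2.2.2.2.1 q.2.2.2.2.2.2.1
        q.2.2.2.2.2.2.2.1 q.2.2.2.2.2.2.2.2.1 q.2.2.2.2.2.2.2.2.2 C := by
  obtain ⟨θ, K, N, δ, A, γ, Cτ, η, ρ₀, K₀⟩ := p
  obtain ⟨⟨hθ0, hθ1⟩, hK, hδ, hA, ⟨hγ0, hγ1⟩, hCτ, ⟨hη0, hη1⟩, ⟨hρ0, hρ1⟩, hK₀⟩ := hp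
  obtain ⟨ϑ, hϑ0, hϑ1, hϑ⟩ := exists_common_contraction
    (p := ((θ, K, N, δ, A, γ, Cτ, η, ρ₀, K₀) : ℝ × ℝ × ℕ × ℝ × ℝ × ℝ × ℝ × ℝ × ℝ × ℝ))
    (θ := fun q => q.1) (η := fun q => q.2.2.2.2.2.2.2.1) (ρ := fun q => q.2.2.2.2.2.2.2.2.1)
    (by fun_prop) (by fun_prop) (by fun_prop) hθ0 hθ1 hη0 hρ0 hρ1
  let ι := {b : ℝ // γ / 2 ≤ b ∧ b ≤ 1}
  have hr : RatePair (expRate fun i : ι => (i : ℝ)) (expRate fun i : ι => (i : ℝ)) :=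
    ratePair_exp (half_pos hγ0) fun i => i.2
  -- One constant dominates `C_τ` and `1 / A` throughout a neighbourhood.
  set L₀ := max 1 (max (Cτ + 1) (A / 2)⁻¹) with hL₀
  have hL₀1 : 1 ≤ L₀ := le_max_left _ _
  obtain ⟨L, hL, hdec⟩ := exists_correlation_decay hr (L := L₀) (δ₁ := δ / 2)
    (K₁ := K + 1) (K₂ := K₀ + 1) hL₀1 (half_pos hδ) N hϑ0 hϑ1 (by linarith) (by linarith)
  refine ⟨L, ?_⟩
  have c2 : Continuous fun q : ℝ × ℝ × ℕ × ℝ × ℝ × ℝ × ℝ × ℝ × ℝ × ℝ => q.2.1 := by fun_prop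
  have c3 : Continuous fun q : ℝ × ℝ × ℕ × ℝ × ℝ × ℝ × ℝ × ℝ × ℝ × ℝ => q.2.2.1 := by fun_prop
  have c4 : Continuous fun q : ℝ × ℝ × ℕ × ℝ × ℝ × ℝ × ℝ × ℝ × ℝ × ℝ => q.2.2.2.1 := by fun_prop
  have c5 : Continuous fun q : ℝ × ℝ × ℕ × ℝ × ℝ × ℝ × ℝ × ℝ × ℝ × ℝ => q.2.2.2.2.1 := by fun_prop
  have c6 : Continuous fun q : ℝ × ℝ × ℕ × ℝ × ℝ × ℝ × ℝ × ℝ × ℝ × ℝ => q.2.2.2.2.2.1 := by fun_prop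
  have c7 : Continuous fun q : ℝ × ℝ × ℕ × ℝ × ℝ × ℝ × ℝ × ℝ × ℝ × ℝ => q.2.2.2.2.2.2.1 := by
    fun_prop
  have c10 : Continuous fun q : ℝ × ℝ × ℕ × ℝ × ℝ × ℝ × ℝ × ℝ × ℝ × ℝ => q.2.2.2.2.2.2.2.2.2 := by
    fun_prop
  filter_upwards [hϑ, c2.continuousAt.eventually (gt_mem_nhds (lt_add_one K)),
    c3.continuousAt.eventually (IsOpen.mem_nhds (isOpen_discrete {N}) rfl),
    c4.continuousAt.eventually (lt_mem_nhds (half_lt_self hδ)),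
    c5.continuousAt.eventually (lt_mem_nhds (half_lt_self hA)),
    c6.continuousAt.eventually (lt_mem_nhds (half_lt_self hγ0)),
    c7.continuousAt.eventually (gt_mem_nhds (lt_add_one Cτ)),
    c10.continuousAt.eventually (gt_mem_nhds (lt_add_one K₀))] with q e1 e2 e3 e4 e5 e6 e7 e10 hq
  obtain ⟨θ', K', N', δ', A', γ', Cτ', η', ρ', K₀'⟩ := q
  obtain ⟨⟨hθ0', hθ1'⟩, hK', hδ', hA', ⟨hγ0', hγ1'⟩, hCτ', ⟨hη0', hη1'⟩, ⟨hρ0', hρ1'⟩, hK₀'⟩ := hq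
  dsimp only at e1 e2 e3 e4 e5 e6 e7 e10 ⊢
  refine ⟨hL, fun M _ _ _ D _ m μbar μY I hI hD hmix ht v w hv hw n hn => ?_⟩
  have hN : N' = N := e3
  have h := hdec ⟨γ', e6.le, hγ1'⟩ M D m μbar μY θ' K' δ' η' ρ' K₀' I hθ0' e1.1 hK' e2.le e4.le
    (hI.trans hN).le hη0' hη1' hρ0' hρ1' e1.2 hK₀' e10.le hD hmix (fun k => by
      have h1 := ht (k + 1) (Nat.succ_pos k)
      refine h1.trans ?_
      unfold expRate
      have h2 : Cτ' ≤ L₀ := e7.le.trans ((le_max_left _ _).trans (le_max_right _ _))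
      have h3 : L₀⁻¹ ≤ A' := by
        rw [inv_le_comm₀ (by linarith) hA']
        refine le_trans ?_ ((le_max_right _ _).trans (le_max_right _ _))
        exact inv_anti₀ (half_pos hA) e5.le
      have h4 : (k : ℝ) ^ γ' / L₀ ≤ A' * ((k + 1 : ℕ) : ℝ) ^ γ' := by
        rw [div_eq_inv_mul]
        refine mul_le_mul h3 ?_ (by positivity) hA'.le
        exact Real.rpow_le_rpow (by positivity) (by push_cast; linarith) hγ0'.le
      exact mul_le_mul h2 (Real.exp_le_exp.2 (neg_le_neg h4)) (Real.exp_pos _).le (by linarith))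
    v w hv hw n
  refine h.trans (le_of_eq ?_)
  unfold expRate
  rw [div_eq_inv_mul]
  ring

theorem mainTheorem7 :
    -- polynomial tails
    (∃ C : ℝ × ℝ × ℕ × ℝ × ℝ × ℝ × ℝ × ℝ × ℝ → ℝ,
      ContinuousOn C polyParams ∧ (∀ p ∈ polyParams, 0 < C p) ∧
      ∀ (M : Type*) [MetricSpace M] [MeasurableSpace M] [BorelSpace M]
        (D : ProductStructure M) [MeasurableSpace D.Ybar]
        (m μbar : Measure D.Ybar) (μY : Measure D.Y)
        (θ K δ β Cτ η ρ₀ K₀ : ℝ) (I : Finset ℕ),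
        (θ, K, I.sup id, δ, β, Cτ, η, ρ₀, K₀) ∈ polyParams →
        D.NonuniformlyHyperbolic m μbar μY θ K ρ₀ K₀ →
        MixingReturnTimes D.τbar μbar δ I →
        (∀ n : ℕ, 1 ≤ n → μbar.real {y | n ≤ D.τbar y} ≤ Cτ * (n : ℝ) ^ (-β)) →
        ∀ v w : M → ℝ, MemCη η v → MemCη η w → ∀ n : ℕ, 1 ≤ n →
          |correlation D.T (D.measure μY) v w n| ≤
            C (θ, K, I.sup id, δ, β, Cτ, η, ρ₀, K₀) * (n : ℝ) ^ (-(β - 1)) *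
              cηNorm η v * cηNorm η w) ∧
    -- (stretched) exponential tails
    (∃ C B : ℝ × ℝ × ℕ × ℝ × ℝ × ℝ × ℝ × ℝ × ℝ × ℝ → ℝ,
      ContinuousOn C expParams ∧ ContinuousOn B expParams ∧
      (∀ p ∈ expParams, 0 < C p ∧ 0 < B p) ∧
      ∀ (M : Type*) [MetricSpace M] [MeasurableSpace M] [BorelSpace M]
        (D : ProductStructure M) [MeasurableSpace D.Ybar]
        (m μbar : Measure D.Ybar) (μY : Measure D.Y)
        (θ K δ A γ Cτ η ρ₀ K₀ : ℝ) (I : Finset ℕ),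
        (θ, K, I.sup id, δ, A, γ, Cτ, η, ρ₀, K₀) ∈ expParams →
        D.NonuniformlyHyperbolic m μbar μY θ K ρ₀ K₀ →
        MixingReturnTimes D.τbar μbar δ I →
        (∀ n : ℕ, 1 ≤ n →
          μbar.real {y | n ≤ D.τbar y} ≤ Cτ * Real.exp (-(A * (n : ℝ) ^ γ))) →
        ∀ v w : M → ℝ, MemCη η v → MemCη η w → ∀ n : ℕ, 1 ≤ n →
          |correlation D.T (D.measure μY) v w n| ≤
            C (θ, K, I.sup id, δ, A, γ, Cτ, η, ρ₀, K₀) *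
              Real.exp (-(B (θ, K, I.sup id, δ, A, γ, Cτ, η, ρ₀, K₀) * (n : ℝ) ^ γ)) *
              cηNorm η v * cηNorm η w) := by
  constructor
  · obtain ⟨C, hC, hCt⟩ := exists_continuousOn_forall_mem (s := polyParams)
      (t := fun q => {C | 0 < C ∧ PolyDecay q.1 q.2.1 q.2.2.1 q.2.2.2.1 q.2.2.2.2.1 q.2.2.2.2.2.1
        q.2.2.2.2.2.2.1 q.2.2.2.2.2.2.2.1 q.2.2.2.2.2.2.2.2 C})
      (fun q c hc c' hcc => ⟨hc.1.trans_le hcc, hc.2.mono hcc⟩)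
      fun p hp => exists_eventually_polyDecay hp
    refine ⟨C, hC, fun p hp => (hCt p hp).1, ?_⟩
    intro M _ _ _ D _ m μbar μY θ K δ β Cτ η ρ₀ K₀ I hp
    exact (hCt _ hp).2 M D m μbar μY I rfl
  · obtain ⟨C, hC, hCt⟩ := exists_continuousOn_forall_mem (s := expParams)
      (t := fun q => {C | 1 ≤ C ∧ ExpDecay q.1 q.2.1 q.2.2.1 q.2.2.2.1 q.2.2.2.2.1 q.2.2.2.2.2.1
        q.2.2.2.2.2.2.1 q.2.2.2.2.2.2.2.1 q.2.2.2.2.2.2.2.2.1 q.2.2.2.2.2.2.2.2.2 C})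
      (fun q c hc c' hcc => ⟨hc.1.trans hcc, hc.2.mono (zero_lt_one.trans_le hc.1) hcc⟩)
      fun p hp => exists_eventually_expDecay hp
    have hpos : ∀ p ∈ expParams, 0 < C p := fun p hp => zero_lt_one.trans_le (hCt p hp).1
    refine ⟨C, fun p => (C p)⁻¹, hC, hC.inv₀ fun p hp => (hpos p hp).ne',
      fun p hp => ⟨hpos p hp, inv_pos.2 (hpos p hp)⟩, ?_⟩
    intro M _ _ _ D _ m μbar μY θ K δ A γ Cτ η ρ₀ K₀ I hp
    exact (hCt _ hp).2 M D m μbar μY I rfl
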